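/- Let $\Gamma$ be a countable group and let $(\Omega,\mu)$ be an ergodic standard Borel probability $\Gamma$-space, i.e. a standard Borel space with a measurable $\Gamma$-action and an invariant ergodic probability measure $\mu$. Let $X$ be a dendrite: a non-empty connected compact metrizable space in which any two distinct points are separated by a point. Let $\mathrm{CL}(X)$ be the set of non-empty closed subsets of $X$ with the Borel structure of the Vietoris topology, and $\mathrm{Homeo}(X)$ the homeomorphism group with the Borel structure of the compact-open topology. Let $\sigma:\Gamma\times\Omega\to\mathrm{Homeo}(X)$ be a virtual dendro-morphism, i.e. a Borel map with $\sigma(\gamma_1\gamma_2,s)=\sigma(\gamma_1,\gamma_2 s)\,\sigma(\gamma_2,s)$ for all $\gamma_1,\gamma_2\in\Gamma$ and almost every $s\in\Omega$. A Borel map $\kappa:\Omega\to\mathrm{CL}(X)$ is $\sigma$-equivariant if $\kappa(\gamma s)=\sigma(\gamma,s)\kappa(s)$ for every $\gamma\in\Gamma$ and almost every $s$. Assume that $\sigma$ is non-elementary, i.e. that there is no $\sigma$-equivariant Borel map from $\Omega$ to the set of subsets of $X$ with one or two points. Let $(B,\nu)$ be a $\Gamma$-boundary in the sense of Bader and Furman: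 a standard Borel space with a non-zero $\sigma$-finite measure whose class is preserved by a measurable $\Gamma$-action, which is amenable in the sense of Zimmer (every Borel field over $B$ of non-empty weak-$*$ compact convex subsets of the unit ball of the dual of a separable Banach space $E$, invariant under the dual of a measurable cocycle with values in the linear isometries of $E$, has a measurable equivariant section), and for which both projections $B\times B\to B$ are relatively metrically ergodic. Here a measurable map $q:Y\to Z$ is relatively metrically ergodic if, for every Borel equivariant map $p:U\to V$ of standard Borel $\Gamma$-spaces with a $\Gamma$-invariant Borel family of separable metrics on the fibers of $p$, and all measurable equivariant maps $f:Y\to U$, $g:Z\to V$ with $p\circ f=g\circ q$, there is a measurable equivariant $\psi:Z\to U$ with $\psi\circ q=f$ and $p\circ\psi=g$ (equivariance of $f,g,\psi$ and the equalities holding almost everywhere). A subdendrite of $X$ is a non-empty closed connected subset. Then there is an equivariant minimal family of subdendrites, i.e. a $\sigma$-equivariant Borel map $s\mapsto M_s\in\mathrm{CL}(X)$ with every $M_s$ a subdendrite such that $M_s\subseteq N_s$ for almost every $s$, for every $\sigma$-equivariant Borel family $\{N_s\}_{s\in\Omega}$ of subdendrites; it is unique up to null sets. Moreover: 1. There is a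 Furstenberg map for $\sigma$, i.e. a Borel map $\phi:B\times\Omega\to X$ such that $\phi(\gamma b,\gamma s)=\sigma(\gamma,s)\phi(b,s)$ for every $\gamma\in\Gamma$ and almost every $(b,s)\in B\times\Omega$, which has the following property: for the minimal family $\{M_s\}_{s\in\Omega}$, for almost every $s\in\Omega$, the slice $\phi_s=\phi(\cdot,s)$ takes values in $\mathrm{Ends}(M_s)$, the set of points $x\in M_s$ such that $M_s\setminus\{x\}$ has exactly one connected component. 2. The Furstenberg map is essentially unique: every Furstenberg map $\psi:B\times\Omega\to X$ for $\sigma$ satisfies $\psi(b,s)=\phi(b,s)$ for almost every $(b,s)\in B\times\Omega$. -/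

import Mathlib

open MeasureTheory TopologicalSpace

universe u

namespace Dendro

/-! ### Dendrites -/

/-- A dendrite: a continuum (non-empty connected compact metrizable space) in which any two
distinct points are separated by a point `z`, i.e. they lie in the two pieces of a partition of
the complement of `z` into two open sets. -/
structure IsDendrite (X : Type u) [TopologicalSpace X] : Prop where
  connected : ConnectedSpace X
  compact : CompactSpace X
  metrizable : MetrizableSpace X
  separated : ∀ x y : X, x ≠ y → ∃ z : X, ∃ U V : Set X,
    IsOpen U ∧ IsOpen V ∧ Disjoint U V ∧ U ∪ V = {z}ᶜ ∧ x ∈ U ∧ y ∈ V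

/-- The end points of a subset `M` (in practice a subdendrite): the points `x` of `M` of order `1`,
that is, such that `M \ {x}` has exactly one connected component. -/
def ends {X : Type u} [TopologicalSpace X] (M : Set X) : Set X :=
  {x | x ∈ M ∧ Nat.card (ConnectedComponents ↥(M \ {x})) = 1}

/-- The Borel structure of the Vietoris topology on `CL(X)`, the space of non-empty closed subsets
of a compact space `X`. -/
abbrev borelCL (X : Type u) [TopologicalSpace X] : MeasurableSpace (NonemptyCompacts X) :=
  borel (NonemptyCompacts X)

/-- The Borel structure of the compact-open topology on the homeomorphism group of `X`. -/
abbrev borelHomeo (X : Type u) [TopologicalSpace X] : MeasurableSpace (X ≃ₜ X) :=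
  @borel (X ≃ₜ X) (TopologicalSpace.induced (fun h : X ≃ₜ X => (h : C(X, X))) inferInstance)

/-! ### Virtual dendro-morphisms -/

section Cocycles

variable {Γ Ω X : Type u} [Group Γ] [MeasurableSpace Ω] [MulAction Γ Ω] [TopologicalSpace X]

/-- Virtual dendro-morphisms, i.e. measurable cocycles `σ : Γ × Ω → Homeo(X)`; the group `Γ` is
countable and discrete, so that measurability is measurability of each `σ γ`. -/
structure IsVirtualDendroMorphism (μ : Measure Ω) (σ : Γ → Ω → (X ≃ₜ X)) : Prop where
  measurable : ∀ γ : Γ, @Measurable Ω (X ≃ₜ X) _ (borelHomeo X) (σ γ)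
  cocycle : ∀ γ₁ γ₂ : Γ, ∀ᵐ s ∂μ, σ (γ₁ * γ₂) s = σ γ₁ (γ₂ • s) * σ γ₂ s

/-- `σ`-equivariant Borel maps from `Ω` to the non-empty closed subsets of `X`. -/
structure IsEquivariantFamily (μ : Measure Ω) (σ : Γ → Ω → (X ≃ₜ X))
    (κ : Ω → NonemptyCompacts X) : Prop where
  measurable : @Measurable Ω (NonemptyCompacts X) _ (borelCL X) κ
  equivariant : ∀ γ : Γ, ∀ᵐ s ∂μ, (κ (γ • s) : Set X) = σ γ s '' (κ s : Set X)

/-- `σ` is elementary if there is a `σ`-equivariant Borel map to the set of subsets of `X` with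
one or two points. -/
def IsElementary (μ : Measure Ω) (σ : Γ → Ω → (X ≃ₜ X)) : Prop :=
  ∃ κ : Ω → NonemptyCompacts X, IsEquivariantFamily μ σ κ ∧
    ∀ s, ∃ x y : X, (κ s : Set X) = {x, y}

/-- Equivariant families of subdendrites (the subdendrites of a dendrite are its non-empty closed
connected subsets). -/
structure IsSubdendriteFamily (μ : Measure Ω) (σ : Γ → Ω → (X ≃ₜ X))
    (M : Ω → NonemptyCompacts X) : Prop extends IsEquivariantFamily μ σ M where
  connected : ∀ s, IsConnected (M s : Set X)

/-- Minimal equivariant families of subdendrites: those which are almost everywhere contained in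
every equivariant family of subdendrites. -/
structure IsMinimalFamily (μ : Measure Ω) (σ : Γ → Ω → (X ≃ₜ X))
    (M : Ω → NonemptyCompacts X) : Prop extends IsSubdendriteFamily μ σ M where
  minimal : ∀ N : Ω → NonemptyCompacts X, IsSubdendriteFamily μ σ N →
    ∀ᵐ s ∂μ, (M s : Set X) ⊆ N s

end Cocycles

/-! ### Boundaries -/

/-- A metric along `p : U → V`: a function `d` which is Borel on the fibered product of `U` with
itself over `p` and restricts to a separable metric on each fiber of `p`. Only the values of `d` at
pairs of points of the same fiber matter. -/
structure IsMetricAlong {U V : Type u} [MeasurableSpace U] (p : U → V) (d : U → U → ℝ) :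
    Prop where
  measurable : Measurable (fun w : {w : U × U // p w.1 = p w.2} => d w.1.1 w.1.2)
  nonneg : ∀ x y, p x = p y → 0 ≤ d x y
  eq_zero_iff : ∀ x y, p x = p y → (d x y = 0 ↔ x = y)
  symm : ∀ x y, p x = p y → d x y = d y x
  triangle : ∀ x y z, p x = p y → p y = p z → d x z ≤ d x y + d y z
  separable : ∀ v : V, ∃ S : Set U, S.Countable ∧ S ⊆ p ⁻¹' {v} ∧
    ∀ x ∈ p ⁻¹' {v}, ∀ ε > 0, ∃ y ∈ S, d x y < ε

section Boundaries

variable (Γ : Type u) [Group Γ]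

/-- A fiberwise isometric action of `Γ` along `p : U → V`, with respect to a metric `d` along
`p`. -/
structure IsFiberwiseIsometric {U V : Type u} [MeasurableSpace U] [MeasurableSpace V]
    [MulAction Γ U] [MulAction Γ V] (p : U → V) (d : U → U → ℝ) : Prop
    extends IsMetricAlong p d where
  measurable_proj : Measurable p
  equivariant_proj : ∀ (γ : Γ) (x : U), p (γ • x) = γ • p x
  isometric : ∀ (γ : Γ) (x y : U), p x = p y → d (γ • x) (γ • y) = d x y

/-- Relative metric ergodicity of a map `q` between the spaces `(Y, η)` and `(Z, ζ)`. As usual for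
spaces equipped with a measure class, equivariance and commutativity of the diagrams are
understood almost everywhere. -/
def IsRelativelyMetricallyErgodic {Y Z : Type u} [MeasurableSpace Y] [MeasurableSpace Z]
    [MulAction Γ Y] [MulAction Γ Z] (η : Measure Y) (ζ : Measure Z) (q : Y → Z) : Prop :=
  ∀ (U V : Type u) [MeasurableSpace U] [StandardBorelSpace U] [MeasurableSpace V]
    [StandardBorelSpace V] [MulAction Γ U] [MeasurableConstSMul Γ U] [MulAction Γ V]
    [MeasurableConstSMul Γ V] (p : U → V) (d : U → U → ℝ) (f : Y → U) (g : Z → V),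
    IsFiberwiseIsometric Γ p d →
    Measurable f → (∀ γ : Γ, ∀ᵐ y ∂η, f (γ • y) = γ • f y) →
    Measurable g → (∀ γ : Γ, ∀ᵐ z ∂ζ, g (γ • z) = γ • g z) →
    (∀ᵐ y ∂η, p (f y) = g (q y)) →
    ∃ ψ : Z → U, Measurable ψ ∧ (∀ γ : Γ, ∀ᵐ z ∂ζ, ψ (γ • z) = γ • ψ z) ∧
      (∀ᵐ y ∂η, ψ (q y) = f y) ∧ (∀ᵐ z ∂ζ, p (ψ z) = g z)

/-- Amenability (in the sense of Zimmer) of the action of `Γ` on `(B, ν)`. For every separable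
Banach space `E`, every measurable cocycle `α` with values in the linear isometries of `E` (with
the Borel structure of the strong operator topology) and every Borel field `A` of non-empty
weak-* compact convex subsets of the unit ball of the dual `E*`, invariant under the dual cocycle
`α* γ b f = f ∘ (α γ b)⁻¹`, there is a measurable equivariant section of `A`.
Note that `g = α* γ b f` means that `g (α γ b e) = f e` for all `e`. -/
def IsZimmerAmenable {B : Type u} [MeasurableSpace B] [MulAction Γ B] (ν : Measure B) : Prop :=
  ∀ (E : Type u) [NormedAddCommGroup E] [NormedSpace ℝ E] [CompleteSpace E] [SeparableSpace E]
    (α : Γ → B → (E ≃ₗᵢ[ℝ] E)) (A : B → Set (WeakDual ℝ E)),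
    (∀ (γ : Γ) (e : E), @Measurable B E _ (borel E) (fun b => α γ b e)) →
    (∀ γ₁ γ₂ : Γ, ∀ᵐ b ∂ν, α (γ₁ * γ₂) b = α γ₁ (γ₂ • b) * α γ₂ b) →
    (∀ b, (A b).Nonempty ∧ IsCompact (A b) ∧ Convex ℝ (A b) ∧ ∀ f ∈ A b, ∀ e : E, |f e| ≤ ‖e‖) →
    @MeasurableSet (B × WeakDual ℝ E) (@Prod.instMeasurableSpace _ _ _ (borel (WeakDual ℝ E)))
      {w | w.2 ∈ A w.1} →
    (∀ γ : Γ, ∀ᵐ b ∂ν, ∀ f g : WeakDual ℝ E, (∀ e, g (α γ b e) = f e) →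
      (f ∈ A b ↔ g ∈ A (γ • b))) →
    ∃ ξ : B → WeakDual ℝ E, @Measurable B (WeakDual ℝ E) _ (borel (WeakDual ℝ E)) ξ ∧
      (∀ᵐ b ∂ν, ξ b ∈ A b) ∧
      ∀ γ : Γ, ∀ᵐ b ∂ν, ∀ e, ξ (γ • b) (α γ b e) = ξ b e

/-- `Γ`-boundaries: amenable Lebesgue `Γ`-spaces (the action preserves the class of `ν`) for which
both projections `B × B → B` are relatively metrically ergodic; `Γ` acts diagonally on `B × B`. -/
structure IsBoundary {B : Type u} [MeasurableSpace B] [MulAction Γ B] (ν : Measure B) :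
    Prop where
  quasiInvariant : ∀ γ : Γ, Measure.QuasiMeasurePreserving (fun b : B => γ • b) ν ν
  amenable : IsZimmerAmenable Γ ν
  ergodic_fst : IsRelativelyMetricallyErgodic Γ (ν.prod ν) ν (Prod.fst : B × B → B)
  ergodic_snd : IsRelativelyMetricallyErgodic Γ (ν.prod ν) ν (Prod.snd : B × B → B)

end Boundaries

/-- Furstenberg maps for `σ`: Borel maps `φ : B × Ω → X` which are `σ`-equivariant. -/
structure IsFurstenbergMap {Γ Ω B X : Type u} [Group Γ] [MeasurableSpace Ω] [MulAction Γ Ω]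
    [MeasurableSpace B] [MulAction Γ B] [TopologicalSpace X] [MeasurableSpace X]
    (ν : Measure B) (μ : Measure Ω) (σ : Γ → Ω → (X ≃ₜ X)) (φ : B × Ω → X) : Prop where
  measurable : Measurable φ
  equivariant : ∀ γ : Γ, ∀ᵐ w ∂(ν.prod μ), φ (γ • w.1, γ • w.2) = σ γ w.2 (φ w)

end Dendro

/-!
Subcontinua of a dendrite have the Helly property, disjoint ones are joined by a gate, and all of
them can be tested against a countable net of subcontinua. Hence the *core* of a measurable
equivariant family of monotone predicates (the intersection of the subcontinua which satisfy the
predicate) is again measurable and equivariant.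

Two equivariant families of subdendrites meet almost everywhere: otherwise the gate of one towards
the other would be an equivariant point, contradicting non-elementarity. So countably many families
can be intersected, and a family which maximizes the measures of the sets `{s | N s ⊆ D}`, for `D`
in the net, is minimal.

Amenability of `B`, applied to states on `L¹(Ω, C(X))`, gives equivariant probability measures
`m (b, s)` on `X`. Let `J (b, s)` be the core of the subcontinua of `m (b, s)`-mass more than
`1 / 2`. By ergodicity of `B × B × Ω`, the sets `J (b, s)` and `J (b', s)` are either almost
always disjoint or almost always meeting. If they meet, then `M s ⊆ J (b, s)` by the Helly
property and minimality; but all subcontinua of this core are arcs, because three disjoint sets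
cannot all have mass at least `1 / 2`, and the end points of the arcs `M s` contradict
non-elementarity. If they are disjoint, the side of `J (b, s)` on which `J (b', s)` lies has a
label in a countable set, so relative metric ergodicity shows that it does not depend on `b'`. The
gate of `J (b, s)` towards this side is then the value of a Furstenberg map. The same dichotomy,
for the values of a Furstenberg map and for the arcs between the values of two Furstenberg maps,
shows that the values are ends of `M s` and that the map is unique.
-/

namespace Dendro

/-! ### Subcontinua of point-separated spaces -/

section Topology

open Set

variable {X : Type*} [TopologicalSpace X] {z : X} {A B C D K L L' L'' O P Q U V : Set X}

/-- The point `z` cuts the space into the two open pieces `U` and `V`, either of which may be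
empty. -/
structure IsCut (z : X) (U V : Set X) : Prop where
  isOpen_left : IsOpen U
  isOpen_right : IsOpen V
  disjoint : Disjoint U V
  union_eq : U ∪ V = {z}ᶜ

/-- The topological property of dendrites which distinguishes them among the continua: any two
distinct points are separated by a third one. It is a class so that the topological lemmas do not
have to carry the other hypotheses bundled in `IsDendrite`. -/
class PointSeparated (X : Type*) [TopologicalSpace X] : Prop where
  exists_isCut : ∀ x y : X, x ≠ y → ∃ z U V, IsCut z U V ∧ x ∈ U ∧ y ∈ V

theorem IsDendrite.pointSeparated {X : Type u} [TopologicalSpace X] (hX : IsDendrite X) :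
    PointSeparated X where
  exists_isCut x y hxy :=
    let ⟨z, U, V, hU, hV, hd, huv, hx, hy⟩ := hX.separated x y hxy
    ⟨z, U, V, ⟨hU, hV, hd, huv⟩, hx, hy⟩

/-- Closed connected sets. The empty set is allowed, so that subcontinua of a dendrite are stable
under arbitrary intersections. -/
structure IsSubcontinuum (D : Set X) : Prop where
  isClosed : IsClosed D
  isPreconnected : IsPreconnected D

theorem IsSubcontinuum.union (hA : IsSubcontinuum A) (hB : IsSubcontinuum B)
    (h : (A ∩ B).Nonempty) : IsSubcontinuum (A ∪ B) :=
  ⟨hA.isClosed.union hB.isClosed, hA.isPreconnected.union' h hB.isPreconnected⟩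

theorem IsSubcontinuum.univ [PreconnectedSpace X] : IsSubcontinuum (univ : Set X) :=
  ⟨isClosed_univ, isPreconnected_univ⟩

theorem isSubcontinuum_singleton [T1Space X] (x : X) : IsSubcontinuum ({x} : Set X) :=
  ⟨isClosed_singleton, isPreconnected_singleton⟩

theorem IsSubcontinuum.image (hD : IsSubcontinuum D) (g : X ≃ₜ X) : IsSubcontinuum (g '' D) :=
  ⟨g.isClosedMap _ hD.isClosed, hD.isPreconnected.image g g.continuous.continuousOn⟩

namespace IsCut

theorem symm (h : IsCut z U V) : IsCut z V U :=
  ⟨h.isOpen_right, h.isOpen_left, h.disjoint.symm, by rw [union_comm, h.union_eq]⟩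

theorem notMem_left (h : IsCut z U V) : z ∉ U := fun hz =>
  (h.union_eq ▸ Or.inl hz : z ∈ ({z} : Set X)ᶜ) rfl

theorem mem_or_mem {x : X} (h : IsCut z U V) (hx : x ≠ z) : x ∈ U ∨ x ∈ V :=
  (h.union_eq ▸ hx : x ∈ U ∪ V)

theorem insert_eq_compl (h : IsCut z U V) : insert z U = Vᶜ := by
  ext x
  rcases eq_or_ne x z with rfl | hx
  · simpa using h.symm.notMem_left
  · have := h.mem_or_mem hx
    have := fun hxU : x ∈ U => Set.disjoint_left.1 h.disjoint hxU
    simp only [mem_insert_iff, mem_compl_iff]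
    tauto

theorem notMem_insert {x : X} (h : IsCut z U V) (hx : x ∈ V) : x ∉ insert z U := by
  rwa [h.insert_eq_compl, notMem_compl_iff]

theorem isClosed_insert (h : IsCut z U V) : IsClosed (insert z U) :=
  h.insert_eq_compl ▸ h.isOpen_right.isClosed_compl

theorem mem_of_isPreconnected {x y : X} (h : IsCut z U V) (hA : IsPreconnected A) (hx : x ∈ A)
    (hy : y ∈ A) (hxU : x ∈ U) (hyV : y ∈ V) : z ∈ A := by
  by_contra hz
  have hAUV : A ⊆ U ∪ V := fun a ha => h.mem_or_mem fun haz => hz (haz ▸ ha)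
  obtain ⟨w, -, hwU, hwV⟩ := hA U V h.isOpen_left h.isOpen_right hAUV ⟨x, hx, hxU⟩ ⟨y, hy, hyV⟩
  exact Set.disjoint_left.1 h.disjoint hwU hwV

theorem isPreconnected_inter_insert (h : IsCut z U V) (hA : IsPreconnected A) (hz : z ∈ A) :
    IsPreconnected (A ∩ insert z U) := by
  have meet_of_mem : ∀ O₁ O₂ : Set X, IsOpen O₁ → IsOpen O₂ → A ∩ insert z U ⊆ O₁ ∪ O₂ →
      (A ∩ insert z U ∩ O₂).Nonempty → z ∈ O₁ → (A ∩ insert z U ∩ (O₁ ∩ O₂)).Nonempty := by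
    rintro O₁ O₂ ho₁ ho₂ hcover ⟨t, ⟨htA, rfl | htU⟩, ht₂⟩ hz₁
    · exact ⟨t, ⟨htA, Or.inl rfl⟩, hz₁, ht₂⟩
    have hcover' : A ⊆ O₁ ∪ V ∪ O₂ ∩ U := fun x hx => by
      rcases eq_or_ne x z with rfl | hxz
      · exact Or.inl (Or.inl hz₁)
      rcases h.mem_or_mem hxz with hxU | hxV
      · exact (hcover ⟨hx, Or.inr hxU⟩).imp Or.inl fun hx₂ => ⟨hx₂, hxU⟩
      · exact Or.inl (Or.inr hxV)
    obtain ⟨x, hxA, hx₁ | hxV, hx₂, hxU⟩ := hA _ _ (ho₁.union h.isOpen_right)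
      (ho₂.inter h.isOpen_left) hcover' ⟨z, hz, Or.inl hz₁⟩ ⟨t, htA, ht₂, htU⟩
    · exact ⟨x, ⟨hxA, Or.inr hxU⟩, hx₁, hx₂⟩
    · exact absurd hxV (Set.disjoint_left.1 h.disjoint hxU)
  intro O₁ O₂ ho₁ ho₂ hcover hne₁ hne₂
  rcases hcover ⟨hz, Or.inl rfl⟩ with hz₁ | hz₂
  · exact meet_of_mem O₁ O₂ ho₁ ho₂ hcover hne₂ hz₁
  · rw [inter_comm O₁]
    exact meet_of_mem O₂ O₁ ho₂ ho₁ (by rwa [union_comm]) hne₁ hz₂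

theorem isSubcontinuum_inter_insert (h : IsCut z U V) (hA : IsSubcontinuum A) (hz : z ∈ A) :
    IsSubcontinuum (A ∩ insert z U) :=
  ⟨hA.isClosed.inter h.isClosed_insert, h.isPreconnected_inter_insert hA.isPreconnected hz⟩

theorem isSubcontinuum_insert [PreconnectedSpace X] (h : IsCut z U V) :
    IsSubcontinuum (insert z U) := by
  simpa using h.isSubcontinuum_inter_insert IsSubcontinuum.univ (mem_univ z)

end IsCut

section Compact

variable [CompactSpace X]

theorem nonempty_sInter_inter_of_directedOn {S : Set (Set X)} (hne : S.Nonempty)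
    (hdir : DirectedOn (· ⊇ ·) S) (hS : ∀ D ∈ S, IsClosed D) (hP : IsClosed P)
    (hmeet : ∀ D ∈ S, (D ∩ P).Nonempty) : (⋂₀ S ∩ P).Nonempty := by
  have : Nonempty S := hne.to_subtype
  rw [sInter_eq_iInter, iInter_inter]
  refine IsCompact.nonempty_iInter_of_directed_nonempty_isCompact_isClosed
    (fun D : S => (D : Set X) ∩ P) (fun D E => ?_) (fun D => hmeet D D.2)
    (fun D => ((hS D D.2).inter hP).isCompact) fun D => (hS D D.2).inter hP
  obtain ⟨F, hF, hFD, hFE⟩ := hdir D D.2 E E.2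
  exact ⟨⟨F, hF⟩, inter_subset_inter_left _ hFD, inter_subset_inter_left _ hFE⟩

variable [T2Space X]

theorem isPreconnected_sInter_of_directedOn {S : Set (Set X)} (hne : S.Nonempty)
    (hdir : DirectedOn (· ⊇ ·) S) (hS : ∀ D ∈ S, IsSubcontinuum D) : IsPreconnected (⋂₀ S) := by
  have hclosed : IsClosed (⋂₀ S) := isClosed_sInter fun D hD => (hS D hD).isClosed
  rw [isPreconnected_closed_iff]
  intro F₁ F₂ hF₁ hF₂ hcover hne₁ hne₂
  by_contra hempty
  have hdisj : Disjoint (⋂₀ S ∩ F₁) (⋂₀ S ∩ F₂) :=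
    Set.disjoint_left.2 fun x hx hx' => hempty ⟨x, hx.1, hx.2, hx'.2⟩
  obtain ⟨O₁, O₂, ho₁, ho₂, hFO₁, hFO₂, hO⟩ :=
    normal_separation (hclosed.inter hF₁) (hclosed.inter hF₂) hdisj
  have hSO : ⋂₀ S ⊆ O₁ ∪ O₂ := fun x hx =>
    (hcover hx).imp (fun h => hFO₁ ⟨hx, h⟩) fun h => hFO₂ ⟨hx, h⟩
  have : Nonempty S := hne.to_subtype
  obtain ⟨⟨D, hD⟩, hDO⟩ := exists_subset_nhds_of_isCompact' (V := fun D : S => (D : Set X))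
    (directedOn_iff_directed.1 hdir) (fun D => (hS D D.2).isClosed.isCompact)
    (fun D => (hS D D.2).isClosed) (U := O₁ ∪ O₂) fun x hx =>
      (ho₁.union ho₂).mem_nhds (hSO (sInter_eq_iInter ▸ hx))
  have hSD : ⋂₀ S ⊆ D := sInter_subset_of_mem hD
  obtain ⟨w, -, hw₁, hw₂⟩ := (hS D hD).isPreconnected O₁ O₂ ho₁ ho₂ hDO
    (hne₁.mono fun x hx => ⟨hSD hx.1, hFO₁ hx⟩) (hne₂.mono fun x hx => ⟨hSD hx.1, hFO₂ hx⟩)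
  exact Set.disjoint_left.1 hO hw₁ hw₂

theorem exists_minimal_subcontinuum (hA : IsSubcontinuum A) (hP : IsClosed P) (hQ : IsClosed Q)
    (hAP : (A ∩ P).Nonempty) (hAQ : (A ∩ Q).Nonempty) :
    ∃ D, D ⊆ A ∧ Minimal (fun D => IsSubcontinuum D ∧ (D ∩ P).Nonempty ∧ (D ∩ Q).Nonempty) D := by
  refine zorn_superset_nonempty
    {D | IsSubcontinuum D ∧ (D ∩ P).Nonempty ∧ (D ∩ Q).Nonempty} ?_ A ⟨hA, hAP, hAQ⟩
  intro c hc hchain hne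
  have hdir : DirectedOn (· ⊇ ·) c := fun D hD E hE => (hchain.total hD hE).elim
    (fun h => ⟨D, hD, subset_rfl, h⟩) fun h => ⟨E, hE, h, subset_rfl⟩
  have hclosed : ∀ D ∈ c, IsClosed D := fun D hD => (hc hD).1.isClosed
  exact ⟨⋂₀ c, ⟨⟨isClosed_sInter hclosed,
    isPreconnected_sInter_of_directedOn hne hdir fun D hD => (hc hD).1⟩,
    nonempty_sInter_inter_of_directedOn hne hdir hclosed hP fun D hD => (hc hD).2.1,
    nonempty_sInter_inter_of_directedOn hne hdir hclosed hQ fun D hD => (hc hD).2.2⟩,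
    fun D hD => sInter_subset_of_mem hD⟩

variable [PointSeparated X]

/- If `F₁` and `F₂` disconnected `A ∩ B`, a subcontinuum `D` of `A` minimal among those joining
`B ∩ F₁` to `B ∩ F₂` could be shortened at a point which cuts it and lies in `B`. -/
theorem IsSubcontinuum.inter (hA : IsSubcontinuum A) (hB : IsSubcontinuum B) :
    IsSubcontinuum (A ∩ B) := by
  refine ⟨hA.isClosed.inter hB.isClosed, ?_⟩
  rw [isPreconnected_closed_iff]
  intro F₁ F₂ hF₁ hF₂ hcover hne₁ hne₂
  by_contra hempty
  obtain ⟨D, hDA, ⟨hD, ⟨p, hpD, hpB, hp⟩, ⟨q, hqD, hqB, hq⟩⟩, hmin⟩ :=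
    exists_minimal_subcontinuum hA (hB.isClosed.inter hF₁) (hB.isClosed.inter hF₂)
      (by rwa [← inter_assoc]) (by rwa [← inter_assoc])
  have hpq : p ≠ q := by
    rintro rfl
    exact hempty ⟨p, ⟨hDA hpD, hpB⟩, hp, hq⟩
  obtain ⟨z, U, V, hz, hpU, hqV⟩ := PointSeparated.exists_isCut p q hpq
  have hzD := hz.mem_of_isPreconnected hD.isPreconnected hpD hqD hpU hqV
  have hzB := hz.mem_of_isPreconnected hB.isPreconnected hpB hqB hpU hqV
  rcases hcover ⟨hDA hzD, hzB⟩ with hz₁ | hz₂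
  · exact hz.symm.notMem_insert hpU (hmin ⟨hz.symm.isSubcontinuum_inter_insert hD hzD,
      ⟨z, ⟨hzD, Or.inl rfl⟩, hzB, hz₁⟩, ⟨q, ⟨hqD, Or.inr hqV⟩, hqB, hq⟩⟩ inter_subset_left hpD).2
  · exact hz.notMem_insert hqV (hmin ⟨hz.isSubcontinuum_inter_insert hD hzD,
      ⟨p, ⟨hpD, Or.inr hpU⟩, hpB, hp⟩, ⟨z, ⟨hzD, Or.inl rfl⟩, hzB, hz₂⟩⟩ inter_subset_left hqD).2

theorem IsSubcontinuum.nonempty_inter_inter (hA : IsSubcontinuum A) (hB : IsSubcontinuum B)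
    (hC : IsSubcontinuum C) (hAB : (A ∩ B).Nonempty) (hAC : (A ∩ C).Nonempty)
    (hBC : (B ∩ C).Nonempty) : (A ∩ B ∩ C).Nonempty := by
  have hconn := (hA.inter (hB.union hC hBC)).isPreconnected
  rw [isPreconnected_closed_iff] at hconn
  obtain ⟨x, ⟨hxA, -⟩, hxB, hxC⟩ := hconn B C hB.isClosed hC.isClosed inter_subset_right
    (hAB.mono fun x hx => ⟨⟨hx.1, Or.inl hx.2⟩, hx.2⟩)
    (hAC.mono fun x hx => ⟨⟨hx.1, Or.inr hx.2⟩, hx.2⟩)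
  exact ⟨x, ⟨hxA, hxB⟩, hxC⟩

theorem helly_finite {S : Set (Set X)} (hf : S.Finite) (hA : IsSubcontinuum A) (hne : A.Nonempty)
    (hS : ∀ D ∈ S, IsSubcontinuum D) (hAS : ∀ D ∈ S, (A ∩ D).Nonempty)
    (hSS : ∀ D ∈ S, ∀ E ∈ S, (D ∩ E).Nonempty) : (A ∩ ⋂₀ S).Nonempty := by
  induction S, hf using Set.Finite.induction_on generalizing A with
  | empty => simpa
  | @insert D S _ _ ih =>
    rw [sInter_insert, ← inter_assoc]
    simp only [forall_mem_insert] at hS hAS hSS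
    exact ih (hA.inter hS.1) hAS.1 hS.2
      (fun E hE => hA.nonempty_inter_inter hS.1 (hS.2 E hE) hAS.1 (hAS.2 E hE) (hSS.1.2 E hE))
      fun E hE => (hSS.2 E hE).2

section Preconnected

variable [PreconnectedSpace X]

theorem isSubcontinuum_sInter_of_finite {S : Set (Set X)} (hf : S.Finite)
    (hS : ∀ D ∈ S, IsSubcontinuum D) : IsSubcontinuum (⋂₀ S) := by
  induction S, hf using Set.Finite.induction_on with
  | empty => simpa using IsSubcontinuum.univ
  | @insert D S _ _ ih =>
    rw [sInter_insert]
    exact (hS D (mem_insert _ _)).inter (ih fun E hE => hS E (mem_insert_of_mem _ hE))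

theorem isSubcontinuum_sInter {S : Set (Set X)} (hS : ∀ D ∈ S, IsSubcontinuum D) :
    IsSubcontinuum (⋂₀ S) := by
  let T : Set (Set X) := {E | ∃ R ⊆ S, R.Finite ∧ E = ⋂₀ R}
  have hST : ⋂₀ S = ⋂₀ T := by
    refine Subset.antisymm ?_ fun x hx D hD => hx D ⟨{D}, by simpa, finite_singleton _, by simp⟩
    rintro x hx _ ⟨R, hR, -, rfl⟩ D hD
    exact hx D (hR hD)
  have hT : ∀ E ∈ T, IsSubcontinuum E := by
    rintro _ ⟨R, hR, hf, rfl⟩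
    exact isSubcontinuum_sInter_of_finite hf fun D hD => hS D (hR hD)
  refine ⟨isClosed_sInter fun D hD => (hS D hD).isClosed, ?_⟩
  rw [hST]
  refine isPreconnected_sInter_of_directedOn ⟨univ, ∅, empty_subset _, finite_empty, by simp⟩ ?_ hT
  rintro _ ⟨R, hR, hf, rfl⟩ _ ⟨R', hR', hf', rfl⟩
  exact ⟨⋂₀ (R ∪ R'), ⟨R ∪ R', union_subset hR hR', hf.union hf', rfl⟩,
    sInter_subset_sInter subset_union_left, sInter_subset_sInter subset_union_right⟩

theorem exists_subcontinuum_nhds {x : X} (hO : IsOpen O) (hx : x ∈ O) :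
    ∃ D, IsSubcontinuum D ∧ x ∈ interior D ∧ D ⊆ O := by
  have hsep : ∀ y ∈ Oᶜ, ∃ E V : Set X, IsSubcontinuum E ∧ x ∈ interior E ∧
      IsOpen V ∧ y ∈ V ∧ Disjoint E V := by
    intro y hy
    have hxy : x ≠ y := by
      rintro rfl
      exact hy hx
    obtain ⟨z, U, V, hz, hxU, hyV⟩ := PointSeparated.exists_isCut x y hxy
    exact ⟨insert z U, V, hz.isSubcontinuum_insert,
      interior_maximal (subset_insert _ _) hz.isOpen_left hxU, hz.isOpen_right, hyV,
      Set.disjoint_right.2 fun a ha => hz.notMem_insert ha⟩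
  choose! E V hE hxE hV hyV hEV using hsep
  obtain ⟨t, ht, hcover⟩ := hO.isClosed_compl.isCompact.elim_nhds_subcover V
    fun y hy => (hV y hy).mem_nhds (hyV y hy)
  refine ⟨⋂₀ (E '' t), isSubcontinuum_sInter ?_, ?_, ?_⟩
  · rintro _ ⟨y, hy, rfl⟩
    exact hE y (ht y hy)
  · rw [sInter_image, (Finset.finite_toSet t).interior_biInter]
    exact mem_iInter₂.2 fun y hy => hxE y (ht y hy)
  · intro a ha
    by_contra haO
    obtain ⟨y, hy, hay⟩ := mem_iUnion₂.1 (hcover haO)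
    exact Set.disjoint_left.1 (hEV y (ht y hy)) (ha _ ⟨y, hy, rfl⟩) hay

theorem exists_subcontinuum_thickening (hD : IsSubcontinuum D) (hO : IsOpen O) (hDO : D ⊆ O) :
    ∃ E, IsSubcontinuum E ∧ D ⊆ interior E ∧ E ⊆ O := by
  rcases D.eq_empty_or_nonempty with rfl | ⟨d, hd⟩
  · exact ⟨∅, hD, empty_subset _, empty_subset _⟩
  have hlocal : ∀ x ∈ D, ∃ E, IsSubcontinuum E ∧ x ∈ interior E ∧ E ⊆ O :=
    fun x hx => exists_subcontinuum_nhds hO (hDO hx)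
  choose! E hE hxE hEO using hlocal
  obtain ⟨t, ht, hcover⟩ := hD.isClosed.isCompact.elim_nhds_subcover (fun x => interior (E x))
    fun x hx => isOpen_interior.mem_nhds (hxE x hx)
  have hinterior : D ⊆ interior (D ∪ ⋃ x ∈ t, E x) := hcover.trans (iUnion₂_subset fun x hx =>
    interior_mono ((subset_biUnion_of_mem (u := fun x => E x) hx).trans subset_union_right))
  refine ⟨D ∪ ⋃ x ∈ t, E x, ⟨hD.isClosed.union (t.finite_toSet.isClosed_biUnion fun x hx =>
    (hE x (ht x hx)).isClosed), ?_⟩, hinterior,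
    union_subset hDO (iUnion₂_subset fun x hx => hEO x (ht x hx))⟩
  have hstar : D ∪ ⋃ x ∈ t, E x = ⋃₀ insert D ((fun x => D ∪ E x) '' t) := by
    simp only [sUnion_insert, sUnion_image, SetLike.mem_coe, iUnion_union_distrib]
    exact Subset.antisymm (union_subset_union_right _ subset_union_right)
      (union_subset subset_union_left
        (union_subset (iUnion₂_subset fun _ _ => subset_union_left) subset_union_right))
  rw [hstar]
  refine isPreconnected_sUnion d _ ?_ ?_
  · simp [hd]
  · rintro _ (rfl | ⟨x, hx, rfl⟩)
    · exact hD.isPreconnected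
    · exact hD.isPreconnected.union' ⟨x, ht x hx, interior_subset (hxE x (ht x hx))⟩
        (hE x (ht x hx)).isPreconnected

end Preconnected

theorem helly_sInter [ConnectedSpace X] {S : Set (Set X)} (hS : ∀ D ∈ S, IsSubcontinuum D)
    (hSS : ∀ D ∈ S, ∀ E ∈ S, (D ∩ E).Nonempty) : (⋂₀ S).Nonempty := by
  have hfinite (u : Finset S) : (univ ∩ ⋂ D ∈ u, (D : Set X)).Nonempty := by
    have h := helly_finite (S := (fun D : S => (D : Set X)) '' u) (u.finite_toSet.image _)
      IsSubcontinuum.univ univ_nonempty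
      (by rintro _ ⟨D, -, rfl⟩; exact hS D D.2)
      (by rintro _ ⟨D, -, rfl⟩; simpa using hSS D D.2 D D.2)
      (by rintro _ ⟨D, -, rfl⟩ _ ⟨E, -, rfl⟩; exact hSS D D.2 E E.2)
    simpa [sInter_image] using h
  simpa [sInter_eq_iInter] using isCompact_univ.inter_iInter_nonempty
    (fun D : S => (D : Set X)) (fun D => (hS D D.2).isClosed) hfinite

end Compact
end Topology

section Approximation

open Set

variable {X : Type*} [TopologicalSpace X] {K O : Set X}

theorem exists_finite_basis_between {b : Set (Set X)} (hb : IsTopologicalBasis b)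
    (hK : IsCompact K) (hO : IsOpen O) (hKO : K ⊆ O) :
    ∃ F ⊆ b, F.Finite ∧ K ⊆ ⋃₀ F ∧ ⋃₀ F ⊆ O := by
  have hlocal : ∀ x ∈ K, ∃ B ∈ b, x ∈ B ∧ B ⊆ O := fun x hx =>
    hb.exists_subset_of_mem_open (hKO hx) hO
  choose! B hB hxB hBO using hlocal
  obtain ⟨t, ht, hcover⟩ := hK.elim_nhds_subcover B fun x hx =>
    (hb.isOpen (hB x hx)).mem_nhds (hxB x hx)
  refine ⟨B '' t, ?_, t.finite_toSet.image _, by rwa [sUnion_image], ?_⟩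
  · rintro _ ⟨x, hx, rfl⟩
    exact hB x (ht x hx)
  · rw [sUnion_image]
    exact iUnion₂_subset fun x hx => hBO x (ht x hx)

variable [CompactSpace X] [T2Space X] [SecondCountableTopology X] [PointSeparated X]

/- Choose one subcontinuum between any two finite unions of basic open sets, if there is one. -/
theorem exists_countable_subcontinua [PreconnectedSpace X] :
    ∃ 𝒞 : Set (Set X), 𝒞.Countable ∧ (∀ E ∈ 𝒞, IsSubcontinuum E ∧ E.Nonempty) ∧
      ∀ D O : Set X, IsSubcontinuum D → D.Nonempty → IsOpen O → D ⊆ O →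
        ∃ E ∈ 𝒞, D ⊆ E ∧ E ⊆ O := by
  let finiteFamilies : Set (Set (Set X)) := {f | f.Finite ∧ f ⊆ countableBasis X}
  let between (p : Set (Set X) × Set (Set X)) (E : Set X) : Prop :=
    (IsSubcontinuum E ∧ E.Nonempty) ∧ ⋃₀ p.1 ⊆ E ∧ E ⊆ ⋃₀ p.2
  let I := {p ∈ finiteFamilies ×ˢ finiteFamilies | ∃ E, between p E}
  have hI : I.Countable :=
    have := countable_ofPred_finite_subset (countable_countableBasis X)
    (this.prod this).mono (sep_subset _ _)
  have hexists : ∀ p ∈ I, ∃ E, between p E := fun p hp => hp.2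
  choose! c hc using hexists
  refine ⟨c '' I, hI.image c, ?_, fun D O hD hne hO hDO => ?_⟩
  · rintro _ ⟨p, hp, rfl⟩
    exact (hc p hp).1
  obtain ⟨E, hE, hDE, hEO⟩ := exists_subcontinuum_thickening hD hO hDO
  obtain ⟨F₁, hbF₁, hF₁, hDF₁, hF₁E⟩ := exists_finite_basis_between (isBasis_countableBasis X)
    hD.isClosed.isCompact isOpen_interior hDE
  obtain ⟨F₂, hbF₂, hF₂, hEF₂, hF₂O⟩ := exists_finite_basis_between (isBasis_countableBasis X)
    hE.isClosed.isCompact hO hEO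
  have hp : (F₁, F₂) ∈ I := ⟨⟨⟨hF₁, hbF₁⟩, hF₂, hbF₂⟩, E,
    ⟨hE, hne.mono (hDE.trans interior_subset)⟩, hF₁E.trans interior_subset, hEF₂⟩
  exact ⟨_, ⟨_, hp, rfl⟩, hDF₁.trans (hc _ hp).2.1, (hc _ hp).2.2.trans hF₂O⟩

theorem exists_seq_subcontinua (X : Type*) [TopologicalSpace X] [CompactSpace X] [T2Space X]
    [SecondCountableTopology X] [PointSeparated X] [ConnectedSpace X] :
    ∃ 𝒟 : ℕ → Set X, (∀ n, IsSubcontinuum (𝒟 n) ∧ (𝒟 n).Nonempty) ∧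
      ∀ D O : Set X, IsSubcontinuum D → D.Nonempty → IsOpen O → D ⊆ O →
        ∃ n, D ⊆ 𝒟 n ∧ 𝒟 n ⊆ O := by
  obtain ⟨𝒞, hcount, h𝒞, hbetween⟩ := exists_countable_subcontinua (X := X)
  obtain ⟨E, hE, -⟩ :=
    hbetween univ univ IsSubcontinuum.univ univ_nonempty isOpen_univ subset_rfl
  obtain ⟨𝒟, rfl⟩ := hcount.exists_eq_range ⟨E, hE⟩
  exact ⟨𝒟, forall_mem_range.1 h𝒞, fun D O hD hne hO hDO =>
    exists_range_iff.1 (hbetween D O hD hne hO hDO)⟩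

end Approximation

/-! ### Cores, hulls, gates and sides -/

section Cores

open Set

variable {X : Type*} [TopologicalSpace X] {D K L L' L'' M U V : Set X} {P Q : Set X → Prop}
  {a b p q x x' y z : X}

/-- The intersection of all the subcontinua satisfying `P`. When `P` is invariant under a group
acting by homeomorphisms, so is its core: all equivariant families of subcontinua are constructed
in this way. -/
def core (P : Set X → Prop) : Set X := ⋂₀ {D | IsSubcontinuum D ∧ P D}

/-- The smallest subcontinuum containing `L`; the arcs of a dendrite are the hulls of pairs of
points. -/
def hull (L : Set X) : Set X := core (L ⊆ ·)

theorem core_subset (hD : IsSubcontinuum D) (h : P D) : core P ⊆ D := sInter_subset_of_mem ⟨hD, h⟩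

theorem subset_hull (L : Set X) : L ⊆ hull L := fun _ hx _ hD => hD.2 hx

theorem left_mem_hull_pair : x ∈ hull {x, y} := subset_hull _ (mem_insert x _)

theorem right_mem_hull_pair : y ∈ hull {x, y} := subset_hull _ (mem_insert_of_mem x rfl)

theorem hull_subset (hD : IsSubcontinuum D) (h : L ⊆ D) : hull L ⊆ D := core_subset hD h

theorem hull_pair_subset (hD : IsSubcontinuum D) (hx : x ∈ D) (hy : y ∈ D) : hull {x, y} ⊆ D :=
  hull_subset hD (pair_subset hx hy)

/-- The condition on a subcontinuum `D` which defines a gate in `K`: `D` contains `K`, or it meets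
`K` and satisfies `Q` (in practice, `Q D` expresses that `D` reaches some given sets). -/
def GatePred (K : Set X) (Q : Set X → Prop) (D : Set X) : Prop := K ⊆ D ∨ (D ∩ K).Nonempty ∧ Q D

/-- The gate of `L` in `K`: when `K` and `L` are disjoint subcontinua, the singleton of the point
of `K` closest to `L`. -/
def gate (K L : Set X) : Set X := core (GatePred K (L ⊆ ·))

omit [TopologicalSpace X] in
theorem monotone_gatePred (hQ : Monotone Q) : Monotone (GatePred K Q) := fun _ _ hDE hD =>
  hD.imp (fun h => h.trans hDE) fun h => ⟨h.1.mono (inter_subset_inter_left _ hDE), hQ hDE h.2⟩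

omit [TopologicalSpace X] in
theorem not_gatePred_empty (hK : K.Nonempty) : ¬ GatePred K Q ∅ := by
  rintro (h | ⟨h, -⟩)
  · exact hK.ne_empty (subset_empty_iff.1 h)
  · simp at h

theorem core_gatePred_subset (hK : IsSubcontinuum K) : core (GatePred K Q) ⊆ K :=
  core_subset hK (Or.inl subset_rfl)

theorem gate_mono (h : L ⊆ L') : gate K L ⊆ gate K L' :=
  sInter_subset_sInter fun _ hD => ⟨hD.1, hD.2.imp_right fun hL' => ⟨hL'.1, h.trans hL'.2⟩⟩

/-- `L` and `L'` lie in the same component of the complement of `K`; the definition is convenient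
when `K`, `L` and `L'` are subcontinua. -/
def SameSide (K L L' : Set X) : Prop := ∃ D, IsSubcontinuum D ∧ L ⊆ D ∧ L' ⊆ D ∧ Disjoint K D

theorem SameSide.symm (h : SameSide K L L') : SameSide K L' L :=
  let ⟨D, hD, hL, hL', hKD⟩ := h
  ⟨D, hD, hL', hL, hKD⟩

theorem SameSide.trans (hne : L'.Nonempty) (h : SameSide K L L') (h' : SameSide K L' L'') :
    SameSide K L L'' := by
  obtain ⟨D, hD, hLD, hLD', hKD⟩ := h
  obtain ⟨E, hE, hLE', hLE'', hKE⟩ := h'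
  exact ⟨D ∪ E, hD.union hE (hne.mono (subset_inter hLD' hLE')), hLD.trans subset_union_left,
    hLE''.trans subset_union_right, hKD.union_right hKE⟩

/-- The component of the complement of `K` which contains `x`. -/
def side (K : Set X) (x : X) : Set X := {y | SameSide K {x} {y}}

theorem SameSide.subset_side (h : SameSide K {x} L) : L ⊆ side K x := by
  obtain ⟨D, hD, hxD, hLD, hKD⟩ := h
  exact fun y hy => ⟨D, hD, hxD, singleton_subset_iff.2 (hLD hy), hKD⟩

theorem isPreconnected_side : IsPreconnected (side K x) := by
  refine isPreconnected_of_forall x ?_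
  rintro y ⟨D, hD, hxD, hyD, hKD⟩
  exact ⟨D, SameSide.subset_side ⟨D, hD, hxD, subset_rfl, hKD⟩, hxD rfl, hyD rfl,
    hD.isPreconnected⟩

theorem isSubcontinuum_closure_side : IsSubcontinuum (closure (side K x)) :=
  ⟨isClosed_closure, isPreconnected_side.closure⟩

theorem mem_ends_of_isConnected (hp : p ∈ M) (h : IsConnected (M \ {p})) : p ∈ ends M := by
  have : ConnectedSpace ↥(M \ {p}) := isConnected_iff_connectedSpace.1 h
  obtain ⟨x⟩ : Nonempty ↥(M \ {p}) := inferInstance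
  exact ⟨hp, Nat.card_of_subsingleton (ConnectedComponents.mk x)⟩

variable [CompactSpace X] [T2Space X] [PointSeparated X]

theorem mem_ends_of_sameSide (hM : IsSubcontinuum M) (hp : p ∈ M) (hne : (M \ {p}).Nonempty)
    (h : ∀ x ∈ M, ∀ y ∈ M, x ≠ p → y ≠ p → SameSide {p} {x} {y}) : p ∈ ends M := by
  refine mem_ends_of_isConnected hp ⟨hne, isPreconnected_of_forall_pair fun x hx y hy => ?_⟩
  obtain ⟨D, hD, hxD, hyD, hpD⟩ := h x hx.1 y hy.1 hx.2 hy.2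
  exact ⟨M ∩ D, fun a ha => ⟨ha.1, fun hap => Set.disjoint_left.1 hpD hap ha.2⟩,
    ⟨hx.1, hxD rfl⟩, ⟨hy.1, hyD rfl⟩, (hM.inter hD).isPreconnected⟩

section Preconnected

variable [PreconnectedSpace X]

theorem isSubcontinuum_core (P : Set X → Prop) : IsSubcontinuum (core P) :=
  isSubcontinuum_sInter fun _ hD => hD.1

theorem isSubcontinuum_hull (L : Set X) : IsSubcontinuum (hull L) :=
  isSubcontinuum_core _

theorem gate_subset_hull (hx : x ∈ K) : gate K L ⊆ hull (insert x L) :=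
  core_subset (isSubcontinuum_hull _) (Or.inr ⟨⟨x, subset_hull _ (mem_insert _ _), hx⟩,
    (subset_insert _ _).trans (subset_hull _)⟩)

omit [CompactSpace X] [T2Space X] [PointSeparated X] in
theorem IsCut.gate_subset_insert (h : IsCut z U V) (hz : z ∈ K) (hL : L ⊆ insert z U) :
    gate K L ⊆ insert z U :=
  core_subset h.isSubcontinuum_insert (Or.inr ⟨⟨z, mem_insert _ _, hz⟩, hL⟩)

omit [CompactSpace X] [T2Space X] in
theorem subsingleton_gate (hK : IsSubcontinuum K) (hL : IsPreconnected L) (hKL : Disjoint K L) :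
    (gate K L).Subsingleton := by
  intro v hv q hq
  by_contra hvq
  obtain ⟨z, U, V, hz, hvU, hqV⟩ := PointSeparated.exists_isCut v q hvq
  have hzK := hz.mem_of_isPreconnected hK.isPreconnected (core_gatePred_subset hK hv)
    (core_gatePred_subset hK hq) hvU hqV
  have hLUV : L ⊆ U ∪ V := fun x hx =>
    hz.mem_or_mem (hKL.symm.ne_of_mem hx hzK)
  rcases hL.subset_or_subset hz.isOpen_left hz.isOpen_right hz.disjoint hLUV with hLU | hLV
  · exact hz.notMem_insert hqV
      (hz.gate_subset_insert hzK (hLU.trans (subset_insert _ _)) hq)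
  · exact hz.symm.notMem_insert hvU
      (hz.symm.gate_subset_insert hzK (hLV.trans (subset_insert _ _)) hv)

theorem isClosed_setOf_mem_hull_pair (t : X) : IsClosed {p : X × X | t ∈ hull {p.1, p.2}} := by
  rw [← isOpen_compl_iff, isOpen_iff_mem_nhds]
  rintro ⟨x, y⟩ hxy
  obtain ⟨E, hE, hsub, hEt⟩ := exists_subcontinuum_thickening (isSubcontinuum_hull {x, y})
    (isOpen_compl_singleton (x := t)) (subset_compl_singleton_iff.2 hxy)
  filter_upwards [prod_mem_nhds (isOpen_interior.mem_nhds (hsub left_mem_hull_pair))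
    (isOpen_interior.mem_nhds (hsub right_mem_hull_pair))] with p hp ht
  exact hEt (hull_pair_subset hE (interior_subset hp.1) (interior_subset hp.2) ht) rfl

omit [CompactSpace X] [T2Space X] in
theorem eq_of_mem_hull_pair (h : x ∈ hull {x', y}) (h' : x' ∈ hull {x, y}) : x = x' := by
  by_contra hne
  obtain ⟨z, U, V, hz, hxU, hxV'⟩ := PointSeparated.exists_isCut x x' hne
  have hy : y ∈ insert z U ∨ y ∈ insert z V := by
    rcases eq_or_ne y z with rfl | hyz
    · exact Or.inl (mem_insert _ _)
    · exact (hz.mem_or_mem hyz).imp Or.inr Or.inr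
  rcases hy with hy | hy
  · exact hz.notMem_insert hxV'
      (hull_pair_subset hz.isSubcontinuum_insert (Or.inr hxU) hy h')
  · exact hz.symm.notMem_insert hxU
      (hull_pair_subset hz.symm.isSubcontinuum_insert (Or.inr hxV') hy h)

theorem mem_pair_of_hull_eq (h : hull {x, y} = hull {a, b}) : x ∈ ({a, b} : Set X) := by
  have hx : x ∈ hull {a, b} := h ▸ left_mem_hull_pair
  have ha : a ∈ hull {x, y} := h ▸ left_mem_hull_pair
  have hb : b ∈ hull {x, y} := h ▸ right_mem_hull_pair
  have hcover : hull {a, b} ⊆ hull {a, x} ∪ hull {x, b} :=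
    hull_pair_subset ((isSubcontinuum_hull _).union (isSubcontinuum_hull _)
      ⟨x, right_mem_hull_pair, left_mem_hull_pair⟩) (Or.inl left_mem_hull_pair)
      (Or.inr right_mem_hull_pair)
  rcases hcover (h ▸ right_mem_hull_pair : y ∈ hull {a, b}) with hy | hy
  · rw [pair_comm] at hx hy
    exact Or.inr (eq_of_mem_hull_pair hx
      (hull_pair_subset (isSubcontinuum_hull _) left_mem_hull_pair hy hb))
  · exact Or.inl (eq_of_mem_hull_pair hx
      (hull_pair_subset (isSubcontinuum_hull _) left_mem_hull_pair hy ha))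

theorem pair_eq_of_hull_eq (h : hull {x, y} = hull {a, b}) : ({x, y} : Set X) = {a, b} := by
  have h' : hull {y, x} = hull {a, b} := by rwa [pair_comm]
  have hab : hull {b, a} = hull {x, y} := by rw [pair_comm, h]
  exact Subset.antisymm (pair_subset (mem_pair_of_hull_eq h) (mem_pair_of_hull_eq h'))
    (pair_subset (mem_pair_of_hull_eq h.symm) (mem_pair_of_hull_eq hab))

theorem mem_side_of_mem_closure (hK : IsClosed K) (hy : y ∈ closure (side K x)) (hyK : y ∉ K) :
    y ∈ side K x := by
  obtain ⟨D, hD, hyD, hDK⟩ := exists_subcontinuum_nhds hK.isOpen_compl hyK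
  obtain ⟨c, hcD, hc⟩ := mem_closure_iff.1 hy _ isOpen_interior hyD
  exact SameSide.trans (singleton_nonempty c) hc ⟨D, hD,
    singleton_subset_iff.2 (interior_subset hcD), singleton_subset_iff.2 (interior_subset hyD),
    disjoint_compl_right.mono_right hDK⟩

/- Otherwise the closure of the side is clopen, as a thickening of it avoiding `K` is contained in
the side. -/
theorem inter_closure_side_nonempty (hK : IsClosed K) (hKne : K.Nonempty) (hx : x ∉ K) :
    (K ∩ closure (side K x)).Nonempty := by
  by_contra hempty
  have hxside : x ∈ side K x :=
    ⟨hull {x}, isSubcontinuum_hull _, subset_hull _, subset_hull _, (disjoint_singleton_right.2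
      hx).mono_right (hull_subset (isSubcontinuum_singleton x) subset_rfl)⟩
  obtain ⟨E, hE, hsub, hEK⟩ := exists_subcontinuum_thickening isSubcontinuum_closure_side
    hK.isOpen_compl fun y hy hyK => hempty ⟨y, hyK, hy⟩
  have hEside : E ⊆ side K x := SameSide.subset_side ⟨E, hE,
    singleton_subset_iff.2 (interior_subset (hsub (subset_closure hxside))), subset_rfl,
    disjoint_compl_right.mono_right hEK⟩
  have hopen : IsOpen (closure (side K x)) := by
    rw [← subset_interior_iff_isOpen]
    exact hsub.trans (interior_mono (hEside.trans subset_closure))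
  have huniv := IsClopen.eq_univ ⟨isClosed_closure, hopen⟩ ⟨x, subset_closure hxside⟩
  obtain ⟨k, hk⟩ := hKne
  exact hempty ⟨k, hk, huniv ▸ mem_univ k⟩

end Preconnected

variable [ConnectedSpace X]

theorem core_nonempty (h : ∀ D E, IsSubcontinuum D → IsSubcontinuum E → P D → P E →
    (D ∩ E).Nonempty) : (core P).Nonempty :=
  helly_sInter (fun _ hD => hD.1) fun D hD E hE => h D E hD.1 hE.1 hD.2 hE.2

theorem core_gatePred_nonempty (hKne : K.Nonempty) (hQ : ∀ D E, Q D → Q E → (D ∩ E).Nonempty) :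
    (core (GatePred K Q)).Nonempty := by
  refine core_nonempty fun D E _ _ hD hE => ?_
  rcases hD with hKD | ⟨hDK, hQD⟩ <;> rcases hE with hKE | ⟨hEK, hQE⟩
  · exact hKne.mono (subset_inter hKD hKE)
  · exact hEK.mono fun x hx => ⟨hKD hx.2, hx.1⟩
  · exact hDK.mono fun x hx => ⟨hx.1, hKE hx.2⟩
  · exact hQ D E hQD hQE

theorem gate_nonempty (hKne : K.Nonempty) (hLne : L.Nonempty) : (gate K L).Nonempty :=
  core_gatePred_nonempty hKne fun _ _ hD hE => hLne.mono (subset_inter hD hE)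

theorem exists_gate_eq_singleton (hK : IsSubcontinuum K) (hKne : K.Nonempty)
    (hL : IsPreconnected L) (hLne : L.Nonempty) (hKL : Disjoint K L) : ∃ q, gate K L = {q} :=
  exists_eq_singleton_iff_nonempty_subsingleton.2
    ⟨gate_nonempty hKne hLne, subsingleton_gate hK hL hKL⟩

theorem SameSide.gate_eq (h : SameSide K L L') (hK : IsSubcontinuum K) (hKne : K.Nonempty)
    (hLne : L.Nonempty) (hLne' : L'.Nonempty) : gate K L = gate K L' := by
  obtain ⟨D, hD, hLD, hLD', hKD⟩ := h
  have gate_eq_gate : ∀ L : Set X, L.Nonempty → L ⊆ D → gate K L = gate K D :=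
    fun L hLne hLD => (gate_mono hLD).antisymm fun q hq => by
      obtain ⟨r, hr⟩ := gate_nonempty hKne hLne
      rwa [← subsingleton_gate hK hD.isPreconnected hKD (gate_mono hLD hr) hq]
  rw [gate_eq_gate L hLne hLD, gate_eq_gate L' hLne' hLD']

theorem inter_closure_side (hK : IsSubcontinuum K) (hKne : K.Nonempty) (hx : x ∉ K) :
    K ∩ closure (side K x) = gate K {x} := by
  obtain ⟨q, hq⟩ := exists_gate_eq_singleton hK hKne isPreconnected_singleton
    (singleton_nonempty x) (disjoint_singleton_right.2 hx)
  have hqK : q ∈ K := core_gatePred_subset hK (hq ▸ mem_singleton q : q ∈ gate K {x})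
  rw [hq, ← (inter_closure_side_nonempty hK.isClosed hKne hx).subset_singleton_iff]
  rintro v ⟨hvK, hvC⟩
  by_contra hvq
  obtain ⟨z, U, V, hz, hvU, hqV⟩ := PointSeparated.exists_isCut v q hvq
  have hzK := hz.mem_of_isPreconnected hK.isPreconnected hvK hqK hvU hqV
  obtain ⟨c, hcU, hc⟩ := mem_closure_iff.1 hvC U hz.isOpen_left hvU
  have hqc : q ∈ gate K {c} := by
    rw [← SameSide.gate_eq hc hK hKne (singleton_nonempty x) (singleton_nonempty c), hq]
    rfl
  exact hz.notMem_insert hqV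
    (hz.gate_subset_insert hzK (singleton_subset_iff.2 (Or.inr hcU)) hqc)

theorem core_gatePred_eq (hK : IsSubcontinuum K) (hKne : K.Nonempty) (hx : x ∉ K)
    (hQ : Q (closure (side K x))) (hside : ∀ D, Q D → ∃ y ∈ D, y ∈ side K x) :
    core (GatePred K Q) = gate K {x} := by
  refine Subset.antisymm ?_ fun q hq D hD => ?_
  · rw [← inter_closure_side hK hKne hx]
    refine subset_inter (core_gatePred_subset hK) (core_subset isSubcontinuum_closure_side
      (Or.inr ⟨?_, hQ⟩))
    rw [inter_comm]
    exact inter_closure_side_nonempty hK.isClosed hKne hx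
  · obtain ⟨hDc, hKD | ⟨hDK, hQD⟩⟩ := hD
    · exact hKD (core_gatePred_subset hK hq)
    · obtain ⟨y, hyD, hy⟩ := hside D hQD
      rw [SameSide.gate_eq hy hK hKne (singleton_nonempty x) (singleton_nonempty y)] at hq
      exact core_subset hDc (Or.inr ⟨hDK, singleton_subset_iff.2 hyD⟩) hq

theorem exists_hull_pair_upper_bound {c : Set (Set X)} (hchain : IsChain (· ⊆ ·) c)
    (hne : c.Nonempty) (hM : IsCompact M) (hc : ∀ H ∈ c, ∃ x ∈ M, ∃ y ∈ M, H = hull {x, y}) :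
    ∃ x ∈ M, ∃ y ∈ M, ∀ H ∈ c, H ⊆ hull {x, y} := by
  have hfinite (u : Finset ↥(⋃₀ c)) :
      ((M ×ˢ M) ∩ ⋂ t ∈ u, {p : X × X | (t : X) ∈ hull {p.1, p.2}}).Nonempty := by
    have hu : (Subtype.val '' (u : Set ↥(⋃₀ c))) ⊆ ⋃₀ c := by
      rintro _ ⟨t, -, rfl⟩
      exact t.2
    obtain ⟨H, hH, huH⟩ := hchain.directedOn.exists_mem_subset_of_finite_of_subset_sUnion hne
      (u.finite_toSet.image _) hu
    obtain ⟨x, hx, y, hy, rfl⟩ := hc H hH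
    exact ⟨(x, y), ⟨hx, hy⟩, mem_iInter₂.2 fun t ht => huH ⟨t, ht, rfl⟩⟩
  obtain ⟨⟨x, y⟩, ⟨hx, hy⟩, hxy⟩ := (hM.prod hM).inter_iInter_nonempty _
    (fun t : ↥(⋃₀ c) => isClosed_setOf_mem_hull_pair (t : X)) hfinite
  exact ⟨x, hx, y, hy, fun H hH t ht => mem_iInter.1 hxy ⟨t, H, hH, ht⟩⟩

/- A subcontinuum without branch points is an arc. -/
theorem exists_eq_hull_pair (hM : IsSubcontinuum M) (hne : M.Nonempty)
    (htri : ∀ x ∈ M, ∀ y ∈ M, ∀ z ∈ M, ∀ p, p ∈ hull {x, y} → p ∈ hull {y, z} →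
      p ∈ hull {x, z} → p = x ∨ p = y ∨ p = z) :
    ∃ x y, M = hull {x, y} := by
  obtain ⟨m, hm⟩ := hne
  obtain ⟨_, -, ⟨x, hx, y, hy, rfl⟩, hmax⟩ :=
    zorn_subset_nonempty {H | ∃ x ∈ M, ∃ y ∈ M, H = hull {x, y}}
      (fun c hc hchain hcne =>
        let ⟨x, hx, y, hy, h⟩ :=
          exists_hull_pair_upper_bound hchain hcne hM.isClosed.isCompact hc
        ⟨hull {x, y}, ⟨x, hx, y, hy, rfl⟩, h⟩)
      (hull {m, m}) ⟨m, hm, m, hm, rfl⟩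
  refine ⟨x, y, Subset.antisymm (fun z hz => ?_) (hull_pair_subset hM hx hy)⟩
  by_contra hzxy
  have not_larger (a : X) (ha : a ∈ M) : ¬ hull {x, y} ⊆ hull {a, z} := fun hsub =>
    hzxy (hmax ⟨a, ha, z, hz, rfl⟩ hsub right_mem_hull_pair)
  obtain ⟨p, hp⟩ := gate_nonempty (K := hull {x, y}) (L := {z}) ⟨x, left_mem_hull_pair⟩
    (singleton_nonempty z)
  have hpxy : p ∈ hull {x, y} := core_gatePred_subset (isSubcontinuum_hull _) hp
  have hpx : p ∈ hull {x, z} := gate_subset_hull left_mem_hull_pair hp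
  have hpy : p ∈ hull {y, z} := gate_subset_hull right_mem_hull_pair hp
  rcases htri x hx y hy z hz p hpxy hpy hpx with rfl | rfl | rfl
  · exact not_larger y hy (hull_pair_subset (isSubcontinuum_hull _) hpy left_mem_hull_pair)
  · exact not_larger x hx (hull_pair_subset (isSubcontinuum_hull _) left_mem_hull_pair hpx)
  · exact hzxy hpxy

end Cores

/-! ### The hyperspace -/

/-- The compact-open topology on the homeomorphism group. -/
abbrev topHomeo (X : Type u) [TopologicalSpace X] : TopologicalSpace (X ≃ₜ X) :=
  TopologicalSpace.induced (fun h : X ≃ₜ X => (h : C(X, X))) inferInstance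

attribute [local instance] borelCL topHomeo borelHomeo

section Hyperspace

open Set

variable {X : Type u} [TopologicalSpace X]

instance borelSpace_nonemptyCompacts : BorelSpace (NonemptyCompacts X) := ⟨rfl⟩

instance borelSpace_homeo : BorelSpace (X ≃ₜ X) := ⟨rfl⟩

/-- The action of the homeomorphism group of `X` on the hyperspace of `X`. -/
def mapCL (g : X ≃ₜ X) (K : NonemptyCompacts X) : NonemptyCompacts X := K.map g g.continuous

@[simp] theorem coe_mapCL (g : X ≃ₜ X) (K : NonemptyCompacts X) :
    (mapCL g K : Set X) = g '' K := rfl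

theorem mapCL_mul (g h : X ≃ₜ X) (K : NonemptyCompacts X) :
    mapCL (g * h) K = mapCL g (mapCL h K) :=
  NonemptyCompacts.map_comp g h g.continuous h.continuous K

theorem mapCL_one (K : NonemptyCompacts X) : mapCL 1 K = K := NonemptyCompacts.map_id K

theorem mapCL_singleton (g : X ≃ₜ X) (x : X) : mapCL g {x} = {g x} :=
  NonemptyCompacts.map_singleton g.continuous x

/-- The pair `{x, y}` as a point of the hyperspace. -/
def pairCL (x y : X) : NonemptyCompacts X := {x} ⊔ {y}

@[simp] theorem coe_pairCL (x y : X) : (pairCL x y : Set X) = {x, y} := by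
  simp only [pairCL, NonemptyCompacts.coe_sup, NonemptyCompacts.coe_singleton]
  rfl

theorem continuous_pairCL : Continuous fun p : X × X => pairCL p.1 p.2 :=
  (NonemptyCompacts.continuous_singleton.comp continuous_fst).sup
    (NonemptyCompacts.continuous_singleton.comp continuous_snd)

theorem image_core (g : X ≃ₜ X) {P Q : Set X → Prop}
    (h : ∀ D, IsSubcontinuum D → (P D ↔ Q (g '' D))) : g '' core P = core Q := by
  refine Subset.antisymm ?_ fun x hx => ?_
  · rintro _ ⟨x, hx, rfl⟩ D ⟨hD, hQ⟩
    have hD' : IsSubcontinuum (g.symm '' D) := hD.image g.symm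
    have hP : P (g.symm '' D) := (h _ hD').2 (by simpa [image_image] using hQ)
    obtain ⟨y, hy, hyx⟩ := hx _ ⟨hD', hP⟩
    simpa [← hyx] using hy
  · refine ⟨g.symm x, fun D ⟨hD, hP⟩ => ?_, g.apply_symm_apply x⟩
    obtain ⟨y, hy, rfl⟩ := hx _ ⟨hD.image g, (h D hD).1 hP⟩
    simpa using hy

theorem image_hull (g : X ≃ₜ X) (L : Set X) : g '' hull L = hull (g '' L) :=
  image_core g fun _ _ => (image_subset_image_iff g.injective).symm

theorem gatePred_image_iff (g : X ≃ₜ X) {K D : Set X} {P Q : Set X → Prop}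
    (h : P D ↔ Q (g '' D)) : GatePred K P D ↔ GatePred (g '' K) Q (g '' D) := by
  simp only [GatePred, image_subset_image_iff g.injective, ← image_inter g.injective,
    image_nonempty, h]

theorem SameSide.image {K L L' : Set X} (h : SameSide K L L') (g : X ≃ₜ X) :
    SameSide (g '' K) (g '' L) (g '' L') := by
  obtain ⟨D, hD, hL, hL', hKD⟩ := h
  exact ⟨g '' D, hD.image g, image_mono hL, image_mono hL', (disjoint_image_iff g.injective).2 hKD⟩

variable {Y : Type*} [MeasurableSpace Y] {f g : Y → NonemptyCompacts X} {F : Set X}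

theorem measurableSet_subset (hf : Measurable f) (hF : IsClosed F) :
    MeasurableSet {y | (f y : Set X) ⊆ F} :=
  hf (NonemptyCompacts.isClosed_subsets_of_isClosed hF).measurableSet

theorem measurableSet_inter_nonempty (hf : Measurable f) (hF : IsClosed F) :
    MeasurableSet {y | ((f y : Set X) ∩ F).Nonempty} :=
  hf (NonemptyCompacts.isClosed_inter_nonempty_of_isClosed hF).measurableSet

theorem measurableSet_gatePred (hf : Measurable f) (hF : IsClosed F) {Q : Y → Set X → Prop}
    (hQ : MeasurableSet {y | Q y F}) : MeasurableSet {y | GatePred (f y : Set X) (Q y) F} := by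
  have hmeets : MeasurableSet {y | (F ∩ (f y : Set X)).Nonempty} := by
    simpa only [inter_comm F] using measurableSet_inter_nonempty hf hF
  exact (measurableSet_subset hf hF).union (hmeets.inter hQ)

theorem measurable_singletonCL_iff [T2Space X] [MeasurableSpace X] [BorelSpace X] {k : Y → X} :
    (Measurable fun y => ({k y} : NonemptyCompacts X)) ↔ Measurable k :=
  (NonemptyCompacts.isClosedEmbedding_singleton (α := X)).measurableEmbedding.measurable_comp_iff

section Compact

variable [CompactSpace X] [T2Space X]

theorem continuous_homeo_apply : Continuous fun p : (X ≃ₜ X) × X => p.1 p.2 := by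
  have hcoe : Continuous fun g : X ≃ₜ X => (g : C(X, X)) := continuous_induced_dom
  have heval : Continuous fun q : C(X, X) × X => q.1 q.2 := continuous_eval
  exact heval.comp ((hcoe.comp continuous_fst).prodMk continuous_snd)

theorem continuous_mapCL : Continuous fun p : (X ≃ₜ X) × NonemptyCompacts X => mapCL p.1 p.2 :=
  Continuous.nonemptyCompacts_map' (g := fun p : (X ≃ₜ X) × NonemptyCompacts X => ⇑p.1)
    continuous_snd (continuous_homeo_apply.comp
      ((continuous_fst.comp continuous_fst).prodMk continuous_snd))

variable [SecondCountableTopology X]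

theorem polishSpace_of_compact (X : Type u) [TopologicalSpace X] [CompactSpace X] [T2Space X]
    [SecondCountableTopology X] : PolishSpace X := by
  let := metrizableSpaceMetric X
  infer_instance

instance standardBorelSpace_nonemptyCompacts : StandardBorelSpace (NonemptyCompacts X) := by
  have := polishSpace_of_compact (NonemptyCompacts X)
  infer_instance

theorem measurable_mapCL {h : Y → (X ≃ₜ X)} (hh : Measurable h) (hf : Measurable f) :
    Measurable fun y => mapCL (h y) (f y) :=
  continuous_mapCL.measurable.comp (hh.prodMk hf)

theorem measurable_homeo_apply [MeasurableSpace X] [BorelSpace X] {h : Y → (X ≃ₜ X)} {k : Y → X}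
    (hh : Measurable h) (hk : Measurable k) : Measurable fun y => h y (k y) :=
  continuous_homeo_apply.measurable.comp (hh.prodMk hk)

omit [CompactSpace X] in
theorem measurableSet_disjoint (hf : Measurable f) (hg : Measurable g) :
    MeasurableSet {y | Disjoint (f y : Set X) (g y : Set X)} :=
  (hf.prodMk hg) (NonemptyCompacts.isOpen_setOfPred_disjoint_coe (α := X)).measurableSet

theorem measurable_of_forall_isClosed
    (h : ∀ F : Set X, IsClosed F → MeasurableSet {y | ((f y : Set X) ∩ F).Nonempty}) :
    Measurable f := by
  have hbasis := (isBasis_countableBasis X).nonemptyCompacts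
  have hgen : borelCL X = _ := hbasis.borel_eq_generateFrom
  rw [hgen]
  refine measurable_generateFrom ?_
  rintro _ ⟨u, ⟨hu, -, hub⟩, rfl⟩
  have hopen : ∀ U ∈ u, IsOpen U := fun U hU => (isBasis_countableBasis X).isOpen (hub hU)
  have hsubset : MeasurableSet {y | (f y : Set X) ⊆ ⋃₀ u} := by
    convert! (h (⋃₀ u)ᶜ (isOpen_sUnion hopen).isClosed_compl).compl using 1
    ext y
    simp [inter_compl_nonempty_iff]
  have hmeets : ∀ U ∈ u, MeasurableSet {y | ((f y : Set X) ∩ U).Nonempty} := by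
    intro U hU
    let := metrizableSpaceMetric X
    obtain ⟨F, hF, -, hFU, -⟩ := (hopen U hU).exists_iUnion_isClosed
    have hunion : {y | ((f y : Set X) ∩ U).Nonempty} =
        ⋃ n, {y | ((f y : Set X) ∩ F n).Nonempty} := by
      ext y
      simp [← hFU, inter_iUnion, nonempty_iUnion]
    exact hunion ▸ .iUnion fun n => h _ (hF n)
  have hpreimage : f ⁻¹' {K : NonemptyCompacts X | ↑K ⊆ ⋃₀ u ∧ ∀ U ∈ u, (↑K ∩ U).Nonempty} =
      {y | (f y : Set X) ⊆ ⋃₀ u} ∩ ⋂ U ∈ u, {y | ((f y : Set X) ∩ U).Nonempty} := by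
    ext y
    simp
  rw [hpreimage]
  exact hsubset.inter (.biInter hu.countable hmeets)

end Compact

section Net

variable [CompactSpace X] [T2Space X] [PointSeparated X] [ConnectedSpace X]
  {P : Set X → Prop} {D F O : Set X}

/-- A non-empty core as a point of the hyperspace. -/
noncomputable def coreCL (P : Set X → Prop) (h : (core P).Nonempty) : NonemptyCompacts X :=
  ⟨⟨core P, (isSubcontinuum_core P).isClosed.isCompact⟩, h⟩

/-- The hull as a self-map of the hyperspace. -/
noncomputable def hullCL (K : NonemptyCompacts X) : NonemptyCompacts X :=
  coreCL ((K : Set X) ⊆ ·) (K.nonempty.mono (subset_hull _))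

@[simp] theorem coe_hullCL (K : NonemptyCompacts X) : (hullCL K : Set X) = hull (K : Set X) := rfl

theorem injOn_hullCL : InjOn (hullCL (X := X)) (range fun p : X × X => pairCL p.1 p.2) := by
  rintro _ ⟨p, rfl⟩ _ ⟨q, rfl⟩ h
  have hhull := congrArg (fun K : NonemptyCompacts X => (K : Set X)) h
  simp only [coe_hullCL, coe_pairCL] at hhull
  apply SetLike.coe_injective
  simpa only [coe_pairCL] using pair_eq_of_hull_eq hhull

variable [SecondCountableTopology X]

variable (X) in
/-- A countable family of non-empty subcontinua approximating all the others from outside. -/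
noncomputable def net : ℕ → Set X := (exists_seq_subcontinua X).choose

theorem isSubcontinuum_net (n : ℕ) : IsSubcontinuum (net X n) :=
  ((exists_seq_subcontinua X).choose_spec.1 n).1

theorem net_nonempty (n : ℕ) : (net X n).Nonempty :=
  ((exists_seq_subcontinua X).choose_spec.1 n).2

theorem exists_net (hD : IsSubcontinuum D) (hne : D.Nonempty) (hO : IsOpen O) (hDO : D ⊆ O) :
    ∃ n, D ⊆ net X n ∧ net X n ⊆ O :=
  (exists_seq_subcontinua X).choose_spec.2 D O hD hne hO hDO

theorem core_eq_iInter_net (hmono : Monotone P) (hP : ¬ P ∅) :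
    core P = ⋂ n, ⋂ _ : P (net X n), net X n := by
  refine Subset.antisymm (subset_iInter₂ fun n hn => core_subset (isSubcontinuum_net n) hn) ?_
  rintro x hx D ⟨hD, hPD⟩
  by_contra hxD
  obtain ⟨n, hn, hnx⟩ := exists_net hD (nonempty_iff_ne_empty.2 fun h => hP (h ▸ hPD))
    (isOpen_compl_singleton (x := x)) (subset_compl_singleton_iff.2 hxD)
  exact hnx (mem_iInter₂.1 hx n (hmono hn hPD)) rfl

theorem core_inter_nonempty_iff (hmono : Monotone P) (hP : ¬ P ∅) (hF : IsClosed F) :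
    (core P ∩ F).Nonempty ↔
      ∀ t : Finset ℕ, (∀ n ∈ t, P (net X n)) → (F ∩ ⋂ n ∈ t, net X n).Nonempty := by
  rw [core_eq_iInter_net hmono hP]
  refine ⟨fun ⟨x, hx, hxF⟩ t ht => ⟨x, hxF, mem_iInter₂.2 fun n hn =>
    mem_iInter₂.1 hx n (ht n hn)⟩, fun h => ?_⟩
  obtain ⟨x, hxF, hx⟩ := hF.isCompact.inter_iInter_nonempty
    (fun n : {n // P (net X n)} => net X n) (fun n => (isSubcontinuum_net _).isClosed) fun u => by
      simpa [iInter_subtype] using h (u.map (Function.Embedding.subtype _))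
        (by simp +contextual)
  exact ⟨x, mem_iInter₂.2 fun n hn => mem_iInter.1 hx ⟨n, hn⟩, hxF⟩

theorem measurable_of_eq_core {Y : Type*} [MeasurableSpace Y] {P : Y → Set X → Prop}
    (hmono : ∀ y, Monotone (P y)) (hP : ∀ y, ¬ P y ∅)
    (hmeas : ∀ n, MeasurableSet {y | P y (net X n)}) {f : Y → NonemptyCompacts X}
    (hf : ∀ y, (f y : Set X) = core (P y)) : Measurable f := by
  refine measurable_of_forall_isClosed fun F hF => ?_
  simp only [hf, core_inter_nonempty_iff (hmono _) (hP _) hF, ofPred_forall]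
  refine .iInter fun t => ?_
  by_cases h : (F ∩ ⋂ n ∈ t, net X n).Nonempty
  · simp [h]
  · simp only [h, imp_false]
    have hall : MeasurableSet (⋂ n ∈ t, {y | P y (net X n)}) :=
      .biInter t.countable_toSet fun n _ => hmeas n
    convert! hall.compl using 1
    ext y
    simp

theorem measurable_hullCL : Measurable (hullCL (X := X)) :=
  measurable_of_eq_core (P := fun (K : NonemptyCompacts X) D => (K : Set X) ⊆ D)
    (fun _ _ _ hDE hD => hD.trans hDE)
    (fun K hK => K.nonempty.ne_empty (subset_empty_iff.1 hK))
    (fun n => measurableSet_subset measurable_id (isSubcontinuum_net n).isClosed) coe_hullCL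

theorem exists_measurable_pair {Y : Type*} [MeasurableSpace Y] {M : Y → NonemptyCompacts X}
    (hM : Measurable M) (h : ∀ y, ∃ a b : X, (M y : Set X) = hull {a, b}) :
    ∃ κ : Y → NonemptyCompacts X, Measurable κ ∧ (∀ y, ∃ a b : X, (κ y : Set X) = {a, b}) ∧
      ∀ y, (M y : Set X) = hull (κ y : Set X) := by
  choose a b hab using h
  let pairs : Set (NonemptyCompacts X) := range fun p : X × X => pairCL p.1 p.2
  have : StandardBorelSpace pairs :=
    (isCompact_range continuous_pairCL).isClosed.measurableSet.standardBorel
  have hemb : MeasurableEmbedding fun K : pairs => hullCL (K : NonemptyCompacts X) :=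
    (measurable_hullCL.comp measurable_subtype_coe).measurableEmbedding injOn_hullCL.injective
  let κ (y : Y) : pairs := ⟨pairCL (a y) (b y), (a y, b y), rfl⟩
  have hκM (y : Y) : hullCL (κ y : NonemptyCompacts X) = M y := by
    apply SetLike.coe_injective
    rw [coe_hullCL, hab, coe_pairCL]
  have hκ : Measurable κ := by
    rw [← hemb.measurable_comp_iff]
    convert! hM using 1
    exact funext hκM
  exact ⟨fun y => κ y, measurable_subtype_coe.comp hκ, fun y => ⟨a y, b y, coe_pairCL _ _⟩,
    fun y => by rw [← hκM y, coe_hullCL]⟩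

end Net

end Hyperspace

/-! ### Fields of probability measures and relative metric ergodicity -/

section ProbabilityMeasures

open Set

theorem standardBorelSpace_of_measurableEmbedding {α β : Type*} [MeasurableSpace α]
    [MeasurableSpace β] [StandardBorelSpace β] {e : α → β} (he : MeasurableEmbedding e) :
    StandardBorelSpace α := by
  obtain ⟨_, hborel, hpolish⟩ := he.measurableSet_range.standardBorel.polish
  let t : TopologicalSpace α := .induced he.equivRange inferInstance
  have hclosed : Topology.IsClosedEmbedding he.equivRange :=
    ⟨⟨⟨rfl⟩, he.equivRange.injective⟩, by
      rw [he.equivRange.surjective.range_eq]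
      exact isClosed_univ⟩
  refine ⟨⟨t, ⟨?_⟩, hclosed.polishSpace⟩⟩
  have hcomap : MeasurableSpace.comap he.equivRange (borel (range e)) = borel α := borel_comap.symm
  rw [← hcomap, ← hborel.measurable_eq]
  exact he.equivRange.measurableEmbedding.comap_eq.symm

theorem borelSpace_of_countablySeparated {α : Type*} [TopologicalSpace α] [PolishSpace α]
    [m : MeasurableSpace α] [MeasurableSpace.CountablySeparated α] (h : m ≤ borel α) :
    BorelSpace α := by
  have hborel : @StandardBorelSpace α (borel α) :=
    @standardBorel_of_polish α (borel α) _ (@BorelSpace.mk _ _ (borel α) rfl) _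
  have hid : @Measurable α α (borel α) m id := measurable_id'' h
  have hmap := @Measurable.map_measurableSpace_eq α α (borel α) hborel m _ id hid
    Function.surjective_id
  rw [MeasurableSpace.map_id] at hmap
  exact ⟨hmap.symm⟩

theorem exists_countable_setAlgebra (T : Type*) [MeasurableSpace T]
    [MeasurableSpace.CountablyGenerated T] : ∃ A : ℕ → Set T, IsSetAlgebra (range A) ∧
      ‹MeasurableSpace T› = MeasurableSpace.generateFrom (range A) := by
  obtain ⟨b, hb, hgen⟩ := MeasurableSpace.CountablyGenerated.isCountablyGenerated (α := T)
  have halg : IsSetAlgebra (generateSetAlgebra b) := isSetAlgebra_generateSetAlgebra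
  obtain ⟨A, hA⟩ := (countable_generateSetAlgebra hb).exists_eq_range ⟨∅, halg.empty_mem⟩
  exact ⟨A, hA ▸ halg, by rw [← hA, generateFrom_generateSetAlgebra_eq, hgen]⟩

instance countablySeparated_probabilityMeasure (T : Type*) [MeasurableSpace T]
    [MeasurableSpace.CountablyGenerated T] :
    MeasurableSpace.CountablySeparated (ProbabilityMeasure T) := by
  obtain ⟨A, hA, hgen⟩ := exists_countable_setAlgebra T
  let e (m : ProbabilityMeasure T) (n : ℕ) : ENNReal := (m : Measure T) (A n)
  have hAm (n : ℕ) : MeasurableSet (A n) := by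
    rw [hgen]
    exact MeasurableSpace.measurableSet_generateFrom (mem_range_self n)
  have he : Measurable e := measurable_pi_iff.2 fun n =>
    (Measure.measurable_coe (hAm n)).comp measurable_subtype_coe
  have hinj : Function.Injective e := fun m m' h => Subtype.ext <|
    ext_of_generate_finite (μ := (m : Measure T)) (ν := m') (range A) hgen
      (fun _ hs _ ht _ => hA.inter_mem hs ht) (by rintro _ ⟨n, rfl⟩; exact congrFun h n) (by simp)
  obtain ⟨S, hS, hSmeas, hSsep⟩ := exists_countable_separating (ℕ → ENNReal) MeasurableSet univ
  refine ⟨⟨(e ⁻¹' ·) '' S, hS.image _, ?_, fun m _ m' _ h => hinj <|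
    hSsep _ (mem_univ _) _ (mem_univ _) fun s hs => h _ ⟨s, hs, rfl⟩⟩⟩
  rintro _ ⟨s, hs, rfl⟩
  exact he (hSmeas s hs)

theorem measurable_measure_of_forall_boundedContinuousFunction {K Y : Type*} [TopologicalSpace K]
    [HasOuterApproxClosed K] [MeasurableSpace K] [BorelSpace K] [MeasurableSpace Y]
    {m : Y → Measure K} [∀ y, IsProbabilityMeasure (m y)]
    (h : ∀ f : BoundedContinuousFunction K NNReal, Measurable fun y => ∫⁻ x, f x ∂(m y)) :
    Measurable m :=
  .measure_of_isPiSystem_of_isProbabilityMeasure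
    (BorelSpace.measurable_eq.trans borel_eq_generateFrom_isClosed) isPiSystem_isClosed
    fun _ hF => measurable_of_tendsto_metrizable (fun n => h (hF.apprSeq n))
      (tendsto_pi_nhds.2 fun y => HasOuterApproxClosed.tendsto_lintegral_apprSeq hF (m y))

instance borelSpace_probabilityMeasure (K : Type*) [TopologicalSpace K] [CompactSpace K]
    [MetrizableSpace K] [MeasurableSpace K] [BorelSpace K] :
    BorelSpace (ProbabilityMeasure K) := by
  have : SecondCountableTopology K := by
    let := metrizableSpaceMetric K
    infer_instance
  have := polishSpace_of_compact (ProbabilityMeasure K)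
  refine borelSpace_of_countablySeparated (Measurable.comap_le ?_)
  let : MeasurableSpace (ProbabilityMeasure K) := borel _
  have : BorelSpace (ProbabilityMeasure K) := ⟨rfl⟩
  exact measurable_measure_of_forall_boundedContinuousFunction
    (m := fun m : ProbabilityMeasure K => (m : Measure K)) fun f =>
      (ProbabilityMeasure.continuous_lintegral_boundedContinuousFunction f).measurable

theorem measurableEmbedding_probabilityMeasure_map {S T : Type*} [MeasurableSpace S]
    [MeasurableSpace T] {e : S → T} (he : MeasurableEmbedding e) :
    MeasurableEmbedding fun m : ProbabilityMeasure S => m.map he.measurable.aemeasurable := by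
  let F (m : ProbabilityMeasure S) : ProbabilityMeasure T := m.map he.measurable.aemeasurable
  have hF : Measurable F :=
    Measurable.subtype_mk ((Measure.measurable_map _ he.measurable).comp measurable_subtype_coe)
  have hprob (m : ProbabilityMeasure T) (hm : (m : Measure T) (range e) = 1) :
      IsProbabilityMeasure ((m : Measure T).comap e) := ⟨by rwa [he.comap_apply, image_univ]⟩
  have hrange : range F = {m : ProbabilityMeasure T | (m : Measure T) (range e) = 1} := by
    ext m
    refine ⟨?_, fun hm => ⟨⟨_, hprob m hm⟩, Subtype.ext ?_⟩⟩
    · rintro ⟨m, rfl⟩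
      change ((m : Measure S).map e) (range e) = 1
      rw [he.map_apply, preimage_range, measure_univ]
    · change ((m : Measure T).comap e).map e = m
      rw [he.map_comap, Measure.restrict_eq_self_of_ae_mem]
      exact (prob_compl_eq_zero_iff he.measurableSet_range).2 hm
  have hmeas : MeasurableSet (range F) := by
    rw [hrange]
    exact ((Measure.measurable_coe he.measurableSet_range).comp measurable_subtype_coe)
      (measurableSet_singleton 1)
  refine .of_measurable_inverse_on_range (g := fun m => ⟨_, hprob m (hrange.subset m.2)⟩) hF hmeas
    (Measurable.subtype_mk (Measure.measurable_of_measurable_coe _ fun s hs => ?_))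
    fun m => Subtype.ext (he.comap_map (m : Measure S))
  simp_rw [he.comap_apply]
  exact (Measure.measurable_coe (he.measurableSet_image.2 hs)).comp
    (measurable_subtype_coe.comp measurable_subtype_coe)

instance standardBorelSpace_probabilityMeasure (T : Type*) [MeasurableSpace T]
    [StandardBorelSpace T] : StandardBorelSpace (ProbabilityMeasure T) := by
  obtain ⟨e, he, hinj⟩ := MeasurableSpace.measurable_injection_nat_bool_of_countablySeparated T
  have := polishSpace_of_compact (ProbabilityMeasure (ℕ → Bool))
  exact standardBorelSpace_of_measurableEmbedding
    (measurableEmbedding_probabilityMeasure_map (he.measurableEmbedding hinj))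

end ProbabilityMeasures

section TotalVariation

open Set

variable {S : Type*} [MeasurableSpace S]

/-- The total variation distance between probability measures, normalised as the supremum of
`|m A - m' A|` over the measurable sets `A`. -/
noncomputable def tvDist (m m' : ProbabilityMeasure S) : ℝ :=
  ⨆ A : {A : Set S // MeasurableSet A}, |(m : Measure S).real A - (m' : Measure S).real A|

theorem abs_measureReal_sub_le_one (m m' : ProbabilityMeasure S) (A : Set S) :
    |(m : Measure S).real A - (m' : Measure S).real A| ≤ 1 :=
  abs_sub_le_of_nonneg_of_le measureReal_nonneg measureReal_le_one measureReal_nonneg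
    measureReal_le_one

theorem abs_measureReal_sub_le_tvDist (m m' : ProbabilityMeasure S) {A : Set S}
    (hA : MeasurableSet A) : |(m : Measure S).real A - (m' : Measure S).real A| ≤ tvDist m m' :=
  le_ciSup (f := fun A : {A : Set S // MeasurableSet A} =>
      |(m : Measure S).real A - (m' : Measure S).real A|)
    ⟨1, by rintro _ ⟨A, rfl⟩; exact abs_measureReal_sub_le_one m m' A⟩ ⟨A, hA⟩

theorem tvDist_le {m m' : ProbabilityMeasure S} {r : ℝ}
    (h : ∀ A, MeasurableSet A → |(m : Measure S).real A - (m' : Measure S).real A| ≤ r) :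
    tvDist m m' ≤ r :=
  have : Nonempty {A : Set S // MeasurableSet A} := ⟨⟨∅, .empty⟩⟩
  ciSup_le fun A => h A A.2

theorem tvDist_nonneg (m m' : ProbabilityMeasure S) : 0 ≤ tvDist m m' :=
  (abs_nonneg _).trans (abs_measureReal_sub_le_tvDist m m' .empty)

theorem tvDist_eq_zero_iff {m m' : ProbabilityMeasure S} : tvDist m m' = 0 ↔ m = m' := by
  refine ⟨fun h => ProbabilityMeasure.toMeasure_injective (Measure.ext fun A hA => ?_), ?_⟩
  · have hle := abs_measureReal_sub_le_tvDist m m' hA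
    rw [h, abs_nonpos_iff, sub_eq_zero] at hle
    exact (measureReal_eq_measureReal_iff).1 hle
  · rintro rfl
    exact le_antisymm (tvDist_le fun A _ => by simp) (tvDist_nonneg m m)

theorem tvDist_comm (m m' : ProbabilityMeasure S) : tvDist m m' = tvDist m' m := by
  simp only [tvDist, abs_sub_comm]

theorem tvDist_triangle (m₁ m₂ m₃ : ProbabilityMeasure S) :
    tvDist m₁ m₃ ≤ tvDist m₁ m₂ + tvDist m₂ m₃ :=
  tvDist_le fun _ hA => (abs_sub_le _ _ _).trans <| add_le_add
    (abs_measureReal_sub_le_tvDist m₁ m₂ hA) (abs_measureReal_sub_le_tvDist m₂ m₃ hA)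

theorem tvDist_map_le {T : Type*} [MeasurableSpace T] {f : S → T} (hf : Measurable f)
    (m m' : ProbabilityMeasure S) :
    tvDist (m.map hf.aemeasurable) (m'.map hf.aemeasurable) ≤ tvDist m m' := by
  refine tvDist_le fun A hA => ?_
  simp only [ProbabilityMeasure.toMeasure_map, map_measureReal_apply hf hA]
  exact abs_measureReal_sub_le_tvDist m m' (hf hA)

theorem tvDist_eq_iSup_of_isSetAlgebra {A : ℕ → Set S} (hA : IsSetAlgebra (range A))
    (hgen : ‹MeasurableSpace S› = MeasurableSpace.generateFrom (range A))
    (m m' : ProbabilityMeasure S) :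
    tvDist m m' = ⨆ n, |(m : Measure S).real (A n) - (m' : Measure S).real (A n)| := by
  have hAm (n : ℕ) : MeasurableSet (A n) := by
    rw [hgen]
    exact MeasurableSpace.measurableSet_generateFrom (mem_range_self n)
  have hbdd : BddAbove (range fun n =>
      |(m : Measure S).real (A n) - (m' : Measure S).real (A n)|) :=
    ⟨1, by rintro _ ⟨n, rfl⟩; exact abs_measureReal_sub_le_one m m' (A n)⟩
  refine le_antisymm (tvDist_le fun C hC => le_of_forall_pos_le_add fun ε hε => ?_)
    (ciSup_le fun n => abs_measureReal_sub_le_tvDist m m' (hAm n))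
  obtain ⟨_, ⟨n, rfl⟩, hn⟩ := (Measure.MeasureDense.of_generateFrom_isSetAlgebra_finite
    (m + m' : Measure S) hA hgen).approx C hC (measure_ne_top _ _) (ε / 2) (half_pos hε)
  have happrox (q : ProbabilityMeasure S) (hq : (q : Measure S) ≤ m + m') :
      |(q : Measure S).real C - (q : Measure S).real (A n)| ≤ ε / 2 :=
    (abs_measureReal_sub_le_measureReal_symmDiff hC.nullMeasurableSet
      (hAm n).nullMeasurableSet).trans
      (ENNReal.toReal_le_of_le_ofReal (half_pos hε).le ((hq _).trans hn.le))
  have hm := abs_le.1 (happrox m (Measure.le_add_right le_rfl))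
  have hm' := abs_le.1 (happrox m' (Measure.le_add_left le_rfl))
  have hsup := abs_le.1 (le_ciSup hbdd n)
  exact abs_le.2 ⟨by linarith [hm.1, hm'.2, hsup.1], by linarith [hm.2, hm'.1, hsup.2]⟩

theorem measurable_tvDist [MeasurableSpace.CountablyGenerated S] :
    Measurable fun p : ProbabilityMeasure S × ProbabilityMeasure S => tvDist p.1 p.2 := by
  obtain ⟨A, hA, hgen⟩ := exists_countable_setAlgebra S
  have hreal (n : ℕ) : Measurable fun m : ProbabilityMeasure S => (m : Measure S).real (A n) :=
    ENNReal.measurable_toReal.comp <| (Measure.measurable_coe <| by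
      rw [hgen]
      exact MeasurableSpace.measurableSet_generateFrom (mem_range_self n)).comp
        measurable_subtype_coe
  simp only [tvDist_eq_iSup_of_isSetAlgebra hA hgen]
  exact .iSup fun n => (((hreal n).comp measurable_fst).sub ((hreal n).comp measurable_snd)).abs

theorem exists_countable_tvDist_dense [MeasurableSpace.CountablyGenerated S] {ρ : Measure S}
    [SigmaFinite ρ] {R : Set (ProbabilityMeasure S)} (hR : ∀ m ∈ R, (m : Measure S) ≪ ρ) :
    ∃ D : Set (ProbabilityMeasure S), D.Countable ∧ D ⊆ R ∧
      ∀ m ∈ R, ∀ ε > 0, ∃ m' ∈ D, tvDist m m' < ε := by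
  let density (m : ProbabilityMeasure S) (x : S) : ℝ := ((m : Measure S).rnDeriv ρ x).toReal
  have hden (m : ProbabilityMeasure S) : Integrable (density m) ρ :=
    Measure.integrable_toReal_rnDeriv
  let L (m : ProbabilityMeasure S) : Lp ℝ 1 ρ := (hden m).toL1 (density m)
  have tvDist_le_dist (m : ProbabilityMeasure S) (hm : m ∈ R) (m' : ProbabilityMeasure S)
      (hm' : m' ∈ R) : tvDist m m' ≤ dist (L m) (L m') := by
    refine tvDist_le fun A _ => ?_
    rw [← Measure.setIntegral_toReal_rnDeriv (hR m hm),
      ← Measure.setIntegral_toReal_rnDeriv (hR m' hm'),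
      ← integral_sub (hden m).integrableOn (hden m').integrableOn, dist_eq_norm,
      ← Integrable.toL1_sub, L1.norm_of_fun_eq_integral_norm, ← Real.norm_eq_abs]
    exact (norm_integral_le_integral_norm _).trans <| setIntegral_le_integral
      ((hden m).sub (hden m')).norm (.of_forall fun x => norm_nonneg _)
  have : Fact ((1 : ENNReal) ≠ ⊤) := ⟨ENNReal.one_ne_top⟩
  obtain ⟨D, hDR, hDcount, hDdense⟩ :=
    (IsSeparable.of_separableSpace (L '' R)).exists_countable_dense_subset
  obtain ⟨D', hD'R, hbij⟩ := SurjOn.exists_bijOn_subset (f := L) hDR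
  refine ⟨D', hbij.mapsTo.countable_of_injOn hbij.injOn hDcount, hD'R, fun m hm ε hε => ?_⟩
  obtain ⟨_, hxD, hx⟩ := Metric.mem_closure_iff.1 (hDdense ⟨m, hm, rfl⟩) ε hε
  obtain ⟨m', hm', rfl⟩ := hbij.surjOn hxD
  exact ⟨m', hm', (tvDist_le_dist m hm m' (hD'R hm')).trans_lt hx⟩

end TotalVariation

section Fields

open Set

/-- A measurable action of `Γ` on the trivial bundle `Ω × T` over `(Ω, μ)`: maps of the fiber `T`
satisfying the cocycle identities almost everywhere. -/
structure FiberAction (Γ Ω : Type u) [Group Γ] [MeasurableSpace Ω] [MulAction Γ Ω] (μ : Measure Ω)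
    (T : Type u) [MeasurableSpace T] where
  /-- The map from the fiber over `s` to the fiber over `γ • s`. -/
  act : Γ → Ω → T → T
  measurable_act : ∀ γ, Measurable fun p : Ω × T => act γ p.1 p.2
  act_one : ∀ᵐ s ∂μ, ∀ t, act 1 s t = t
  act_mul : ∀ γ₁ γ₂, ∀ᵐ s ∂μ, ∀ t, act (γ₁ * γ₂) s t = act γ₁ (γ₂ • s) (act γ₂ s t)

namespace FiberAction

variable {Γ Ω : Type u} [Group Γ] [MeasurableSpace Ω] [MulAction Γ Ω] {μ : Measure Ω}
  {T : Type u} [MeasurableSpace T]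

/-- The transformation of the total space `Ω × T` defined by `γ`. -/
def skew (τ : FiberAction Γ Ω μ T) (γ : Γ) (p : Ω × T) : Ω × T := (γ • p.1, τ.act γ p.1 p.2)

theorem measurable_skew [MeasurableConstSMul Γ Ω] (τ : FiberAction Γ Ω μ T) (γ : Γ) :
    Measurable (τ.skew γ) :=
  (measurable_fst.const_smul γ).prodMk (τ.measurable_act γ)

/-- The probability measures on `Ω × T` projecting to `μ`, that is, the measurable fields of
probability measures on the fibers. The type is indexed by `τ` because `Γ` acts on it through
`τ`. -/
def MargProb (_τ : FiberAction Γ Ω μ T) : Type u :=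
  {m : ProbabilityMeasure (Ω × T) // (m : Measure (Ω × T)).fst = μ}

variable {τ : FiberAction Γ Ω μ T}

namespace MargProb

/-- The measure on the total space underlying a point of `MargProb τ`. -/
def toMeasure (m : MargProb τ) : Measure (Ω × T) := (m.1 : Measure (Ω × T))

theorem fst_toMeasure (m : MargProb τ) : m.toMeasure.fst = μ := m.2

theorem ext {m m' : MargProb τ} (h : m.toMeasure = m'.toMeasure) : m = m' :=
  Subtype.ext (Subtype.ext h)

theorem ae_of_ae (m : MargProb τ) {p : Ω → Prop} (h : ∀ᵐ s ∂μ, p s) :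
    ∀ᵐ q ∂m.toMeasure, p q.1 := by
  rw [← m.fst_toMeasure] at h
  exact ae_of_ae_map measurable_fst.aemeasurable h

/-- A measure on the total space projecting to the probability measure `μ`, as a point of
`MargProb τ`. -/
def mk [IsProbabilityMeasure μ] (τ : FiberAction Γ Ω μ T) (m : Measure (Ω × T))
    (hm : m.fst = μ) : MargProb τ :=
  ⟨⟨m, ⟨by rw [← Measure.fst_univ, hm, measure_univ]⟩⟩, hm⟩

instance : MeasurableSpace (MargProb τ) := inferInstanceAs (MeasurableSpace (Subtype _))

theorem measurable_val : Measurable fun m : MargProb τ => m.1 := measurable_subtype_coe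

theorem measurable_toMeasure : Measurable (toMeasure (τ := τ)) :=
  measurable_subtype_coe.comp measurable_val

theorem measurable_mk [IsProbabilityMeasure μ] {Y : Type*} [MeasurableSpace Y]
    {m : Y → Measure (Ω × T)} (hm : Measurable m) (h : ∀ y, (m y).fst = μ) :
    Measurable fun y => mk τ (m y) (h y) :=
  Measurable.subtype_mk (Measurable.subtype_mk hm)

theorem measurable_tvDist [MeasurableSpace.CountablyGenerated (Ω × T)] :
    Measurable fun p : MargProb τ × MargProb τ => tvDist p.1.1 p.2.1 := by
  have hval : Measurable fun p : MargProb τ × MargProb τ => (p.1.1, p.2.1) :=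
    (measurable_val.comp measurable_fst).prodMk (measurable_val.comp measurable_snd)
  simpa only [Function.comp_def] using Dendro.measurable_tvDist.comp hval

instance [IsProbabilityMeasure μ] [StandardBorelSpace Ω] [StandardBorelSpace T] :
    StandardBorelSpace (MargProb τ) := by
  have hfst : Measurable fun m : ProbabilityMeasure (Ω × T) => m.map measurable_fst.aemeasurable :=
    Measurable.subtype_mk ((Measure.measurable_map _ measurable_fst).comp measurable_subtype_coe)
  have heq : {m : ProbabilityMeasure (Ω × T) | (m : Measure (Ω × T)).fst = μ} =
      (fun m => m.map measurable_fst.aemeasurable) ⁻¹' {(⟨μ, ‹_›⟩ : ProbabilityMeasure Ω)} := by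
    ext m
    exact (Subtype.ext_iff (a1 := m.map measurable_fst.aemeasurable) (a2 := ⟨μ, ‹_›⟩)).symm
  exact (heq ▸ hfst (measurableSet_singleton _)).standardBorel

end MargProb

section Action

variable [MeasurableConstSMul Γ Ω] [IsProbabilityMeasure μ] [SMulInvariantMeasure Γ Ω μ]

omit [IsProbabilityMeasure μ] in
theorem fst_map_skew (γ : Γ) (m : MargProb τ) : (m.toMeasure.map (τ.skew γ)).fst = μ :=
  calc (m.toMeasure.map (τ.skew γ)).fst = m.toMeasure.fst.map (γ • ·) := by
        rw [Measure.fst, Measure.fst, Measure.map_map measurable_fst (τ.measurable_skew γ),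
          Measure.map_map (measurable_const_smul γ) measurable_fst]
        rfl
    _ = μ := by rw [m.fst_toMeasure, (measurePreserving_smul γ μ).map_eq]

noncomputable instance : MulAction Γ (MargProb τ) where
  smul γ m := .mk τ (m.toMeasure.map (τ.skew γ)) (fst_map_skew γ m)
  one_smul m := by
    refine MargProb.ext ?_
    calc m.toMeasure.map (τ.skew 1) = m.toMeasure.map id := by
          refine Measure.map_congr ?_
          filter_upwards [m.ae_of_ae τ.act_one] with p hp
          simp [skew, hp]
      _ = m.toMeasure := Measure.map_id
  mul_smul γ₁ γ₂ m := by
    refine MargProb.ext ?_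
    calc m.toMeasure.map (τ.skew (γ₁ * γ₂)) = m.toMeasure.map (τ.skew γ₁ ∘ τ.skew γ₂) := by
          refine Measure.map_congr ?_
          filter_upwards [m.ae_of_ae (τ.act_mul γ₁ γ₂)] with p hp
          simp [skew, hp, mul_smul]
      _ = (m.toMeasure.map (τ.skew γ₂)).map (τ.skew γ₁) :=
          (Measure.map_map (τ.measurable_skew _) (τ.measurable_skew _)).symm

instance : MeasurableConstSMul Γ (MargProb τ) where
  measurable_const_smul γ := MargProb.measurable_mk
    ((Measure.measurable_map _ (τ.measurable_skew γ)).comp MargProb.measurable_toMeasure) _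

theorem tvDist_smul_le (γ : Γ) (m m' : MargProb τ) :
    tvDist (γ • m).1 (γ • m').1 ≤ tvDist m.1 m'.1 :=
  tvDist_map_le (τ.measurable_skew γ) m.1 m'.1

theorem tvDist_smul (γ : Γ) (m m' : MargProb τ) :
    tvDist (γ • m).1 (γ • m').1 = tvDist m.1 m'.1 :=
  (tvDist_smul_le γ m m').antisymm (by simpa using tvDist_smul_le γ⁻¹ (γ • m) (γ • m'))

end Action

section Projection

variable [IsProbabilityMeasure μ] {Z W : Type u} [MeasurableSpace Z] [MeasurableSpace W]
  {τZ : FiberAction Γ Ω μ Z} {τW : FiberAction Γ Ω μ W} {π : W → Z} {c : W → ℕ}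

omit [IsProbabilityMeasure μ] in
theorem fst_map_prodMap (hπ : Measurable π) (m : MargProb τW) :
    (m.toMeasure.map (Prod.map id π)).fst = μ := by
  rw [Measure.fst, Measure.map_map measurable_fst (measurable_id.prodMap hπ)]
  exact m.fst_toMeasure

/-- The push-forward of a field of probability measures under a map `π` of the fibers. -/
noncomputable def MargProb.proj (τZ : FiberAction Γ Ω μ Z) (hπ : Measurable π)
    (m : MargProb τW) : MargProb τZ :=
  .mk τZ (m.toMeasure.map (Prod.map id π)) (fst_map_prodMap hπ m)

theorem measurable_proj (hπ : Measurable π) :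
    Measurable (MargProb.proj (τW := τW) τZ hπ) :=
  MargProb.measurable_mk ((Measure.measurable_map _ (measurable_id.prodMap hπ)).comp
    MargProb.measurable_toMeasure) _

theorem proj_smul [MeasurableConstSMul Γ Ω] [SMulInvariantMeasure Γ Ω μ] (hπ : Measurable π)
    (hequiv : ∀ γ, ∀ᵐ s ∂μ, ∀ w, π (τW.act γ s w) = τZ.act γ s (π w)) (γ : Γ) (m : MargProb τW) :
    MargProb.proj τZ hπ (γ • m) = γ • MargProb.proj τZ hπ m := by
  refine MargProb.ext ?_
  change (m.toMeasure.map (τW.skew γ)).map (Prod.map id π) =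
    (m.toMeasure.map (Prod.map id π)).map (τZ.skew γ)
  rw [Measure.map_map (measurable_id.prodMap hπ) (τW.measurable_skew γ),
    Measure.map_map (τZ.measurable_skew γ) (measurable_id.prodMap hπ)]
  refine Measure.map_congr ?_
  filter_upwards [m.ae_of_ae (hequiv γ)] with p hp
  simp [skew, hp]

/- As the fibers of `π` are countable, all fields of measures lifting `v` are dominated by a single
`σ`-finite measure. -/
theorem exists_sigmaFinite_dominating_fiber [StandardBorelSpace Ω] [StandardBorelSpace W]
    [StandardBorelSpace Z] (hπ : Measurable π) (hc : Measurable c)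
    (hinj : Function.Injective fun w => (π w, c w)) (v : MargProb τZ) :
    ∃ ρ : Measure (Ω × W), SigmaFinite ρ ∧
      ∀ m : MargProb τW, MargProb.proj τZ hπ m = v → m.toMeasure ≪ ρ := by
  let j (p : Ω × W) : (Ω × Z) × ℕ := ((p.1, π p.2), c p.2)
  have hj : MeasurableEmbedding j := by
    refine Measurable.measurableEmbedding
      ((measurable_fst.prodMk (hπ.comp measurable_snd)).prodMk (hc.comp measurable_snd)) ?_
    rintro ⟨s, w⟩ ⟨s', w'⟩ h
    simp only [j, Prod.mk.injEq] at h
    exact Prod.ext h.1.1 (hinj (Prod.ext h.1.2 h.2))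
  have : IsProbabilityMeasure v.toMeasure := v.1.2
  let ρ : Measure ((Ω × Z) × ℕ) := v.toMeasure.prod Measure.count
  refine ⟨ρ.comap j, .of_map _ hj.measurable.aemeasurable (by rw [hj.map_comap]; infer_instance),
    fun m hm => Measure.AbsolutelyContinuous.mk fun N hN hN0 => ?_⟩
  rw [hj.comap_apply, Measure.measure_prod_null (hj.measurableSet_image.2 hN), ← hm] at hN0
  refine measure_eq_zero_iff_ae_notMem.2 ?_
  filter_upwards [ae_of_ae_map (measurable_id.prodMap hπ).aemeasurable hN0] with p hp hpN
  exact Set.notMem_empty (c p.2) (Measure.count_eq_zero_iff.1 hp ▸ mem_image_of_mem j hpN)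

theorem exists_countable_tvDist_dense_fiber [StandardBorelSpace Ω] [StandardBorelSpace W]
    [StandardBorelSpace Z] (hπ : Measurable π) (hc : Measurable c)
    (hinj : Function.Injective fun w => (π w, c w)) (v : MargProb τZ) :
    ∃ D : Set (MargProb τW), D.Countable ∧ D ⊆ MargProb.proj τZ hπ ⁻¹' {v} ∧
      ∀ m : MargProb τW, MargProb.proj τZ hπ m = v → ∀ ε > 0, ∃ m' ∈ D, tvDist m.1 m'.1 < ε := by
  obtain ⟨ρ, _, hρ⟩ := exists_sigmaFinite_dominating_fiber (τW := τW) hπ hc hinj v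
  let R : Set (ProbabilityMeasure (Ω × W)) :=
    Subtype.val '' (MargProb.proj (τW := τW) τZ hπ ⁻¹' {v})
  obtain ⟨D, hDcount, hDR, hD⟩ := exists_countable_tvDist_dense (ρ := ρ) (R := R)
    (by rintro _ ⟨m, hm, rfl⟩; exact hρ m hm)
  refine ⟨Subtype.val ⁻¹' D, hDcount.preimage Subtype.val_injective, fun m hm => ?_,
    fun m hm ε hε => ?_⟩
  · obtain ⟨m', hm', heq⟩ := hDR hm
    exact Subtype.ext heq ▸ hm'
  · obtain ⟨m', hm', hlt⟩ := hD m.1 ⟨m, hm, rfl⟩ ε hε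
    obtain ⟨m'', -, rfl⟩ := hDR hm'
    exact ⟨m'', hm', hlt⟩

theorem isFiberwiseIsometric_proj [MeasurableConstSMul Γ Ω] [SMulInvariantMeasure Γ Ω μ]
    [StandardBorelSpace Ω] [StandardBorelSpace W] [StandardBorelSpace Z] (hπ : Measurable π)
    (hc : Measurable c) (hinj : Function.Injective fun w => (π w, c w))
    (hequiv : ∀ γ, ∀ᵐ s ∂μ, ∀ w, π (τW.act γ s w) = τZ.act γ s (π w)) :
    IsFiberwiseIsometric Γ (MargProb.proj (τW := τW) τZ hπ) fun m m' => tvDist m.1 m'.1 where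
  measurable := MargProb.measurable_tvDist.comp measurable_subtype_coe
  nonneg _ _ _ := tvDist_nonneg _ _
  eq_zero_iff _ _ _ := tvDist_eq_zero_iff.trans Subtype.val_inj
  symm _ _ _ := tvDist_comm _ _
  triangle _ _ _ _ _ := tvDist_triangle _ _ _
  separable := exists_countable_tvDist_dense_fiber hπ hc hinj
  measurable_proj := measurable_proj hπ
  equivariant_proj := proj_smul hπ hequiv
  isometric γ m m' _ := tvDist_smul γ m m'

end Projection

section Graph

variable [IsProbabilityMeasure μ] {f g : Ω → T}

/-- The field of Dirac masses at the points of a measurable section `f`. -/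
noncomputable def graph (τ : FiberAction Γ Ω μ T) (hf : Measurable f) : MargProb τ :=
  .mk τ (μ.map fun s => (s, f s)) (by rw [Measure.fst_map_prodMk hf, Measure.map_id'])

theorem ae_eq_of_graph_eq [StandardBorelSpace T] (hf : Measurable f) (hg : Measurable g)
    (h : τ.graph hf = τ.graph hg) : ∀ᵐ s ∂μ, f s = g s := by
  have hmap : μ.map (fun s => (s, f s)) = μ.map (fun s => (s, g s)) :=
    congrArg MargProb.toMeasure h
  have hset : MeasurableSet {p : Ω × T | p.2 = g p.1} :=
    measurableSet_eq_fun measurable_snd (hg.comp measurable_fst)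
  have hgraph : ∀ᵐ p ∂(μ.map fun s => (s, g s)), p.2 = g p.1 :=
    (ae_map_iff (measurable_id.prodMk hg).aemeasurable hset).2 (by simp)
  rw [← hmap] at hgraph
  exact (ae_map_iff (measurable_id.prodMk hf).aemeasurable hset).1 hgraph

theorem smul_graph [MeasurableConstSMul Γ Ω] [SMulInvariantMeasure Γ Ω μ] (γ : Γ)
    (hf : Measurable f) (hg : Measurable g) (h : ∀ᵐ s ∂μ, g (γ • s) = τ.act γ s (f s)) :
    γ • τ.graph hf = τ.graph hg := by
  refine MargProb.ext ?_
  calc (μ.map fun s => (s, f s)).map (τ.skew γ) = μ.map (τ.skew γ ∘ fun s => (s, f s)) :=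
        Measure.map_map (τ.measurable_skew γ) (measurable_id.prodMk hf)
    _ = μ.map ((fun s => (s, g s)) ∘ fun s => γ • s) := by
        refine Measure.map_congr ?_
        filter_upwards [h] with s hs
        simp [skew, hs]
    _ = (μ.map fun s => γ • s).map fun s => (s, g s) :=
        (Measure.map_map (measurable_id.prodMk hg) (measurable_const_smul γ)).symm
    _ = μ.map fun s => (s, g s) := by rw [(measurePreserving_smul γ μ).map_eq]

theorem proj_graph {Z : Type u} [MeasurableSpace Z] {τZ : FiberAction Γ Ω μ Z} {π : T → Z}
    (hπ : Measurable π) {g : Ω → Z} (hf : Measurable f) (hg : Measurable g)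
    (h : ∀ᵐ s ∂μ, π (f s) = g s) : MargProb.proj τZ hπ (τ.graph hf) = τZ.graph hg := by
  refine MargProb.ext ?_
  calc (μ.map fun s => (s, f s)).map (Prod.map id π) = μ.map (Prod.map id π ∘ fun s => (s, f s)) :=
        Measure.map_map (measurable_id.prodMap hπ) (measurable_id.prodMk hf)
    _ = μ.map fun s => (s, g s) := by
        refine Measure.map_congr ?_
        filter_upwards [h] with s hs
        simp [hs]

theorem measurable_graph {Y : Type*} [MeasurableSpace Y] {f : Y × Ω → T} (hf : Measurable f) :
    Measurable fun y => τ.graph (f := fun s => f (y, s)) (hf.comp measurable_prodMk_left) := by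
  refine MargProb.measurable_mk (Measure.measurable_of_measurable_coe _ fun A hA => ?_) _
  have hslice (y : Y) : Measurable fun s => (s, f (y, s)) :=
    measurable_id.prodMk (hf.comp measurable_prodMk_left)
  simp only [Measure.map_apply (hslice _) hA]
  exact measurable_measure_prodMk_left ((measurable_snd.prodMk hf) hA)

/- Relative metric ergodicity is applied to the fields of Dirac masses: as `π` has countable
fibers, the total variation metric is separable on the lifts of a fixed field of measures. -/
theorem exists_graph_factorization [StandardBorelSpace Ω] [MeasurableConstSMul Γ Ω]
    [SMulInvariantMeasure Γ Ω μ] {Y Z₀ Z W : Type u} [MeasurableSpace Y] [MeasurableSpace Z₀]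
    [MulAction Γ Y] [MulAction Γ Z₀] {η : Measure Y} {ζ : Measure Z₀} {q : Y → Z₀}
    (hq : IsRelativelyMetricallyErgodic Γ η ζ q) [MeasurableSpace Z] [MeasurableSpace W]
    [StandardBorelSpace Z] [StandardBorelSpace W] (τZ : FiberAction Γ Ω μ Z)
    (τW : FiberAction Γ Ω μ W) {π : W → Z} (hπ : Measurable π) {c : W → ℕ} (hc : Measurable c)
    (hinj : Function.Injective fun w => (π w, c w))
    (hequiv : ∀ γ, ∀ᵐ s ∂μ, ∀ w, π (τW.act γ s w) = τZ.act γ s (π w))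
    {f : Y × Ω → W} (hf : Measurable f)
    (hfe : ∀ γ : Γ, ∀ᵐ y ∂η, ∀ᵐ s ∂μ, f (γ • y, γ • s) = τW.act γ s (f (y, s)))
    {g : Z₀ × Ω → Z} (hg : Measurable g)
    (hge : ∀ γ : Γ, ∀ᵐ z ∂ζ, ∀ᵐ s ∂μ, g (γ • z, γ • s) = τZ.act γ s (g (z, s)))
    (hfg : ∀ᵐ y ∂η, ∀ᵐ s ∂μ, π (f (y, s)) = g (q y, s)) :
    ∃ ψ : Z₀ → MargProb τW, ∀ᵐ y ∂η,
      ψ (q y) = τW.graph (f := fun s => f (y, s)) (hf.comp measurable_prodMk_left) := by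
  obtain ⟨ψ, -, -, hψ, -⟩ := hq (MargProb τW) (MargProb τZ) (MargProb.proj τZ hπ)
    (fun m m' => tvDist m.1 m'.1)
    (fun y => τW.graph (f := fun s => f (y, s)) (hf.comp measurable_prodMk_left))
    (fun z => τZ.graph (f := fun s => g (z, s)) (hg.comp measurable_prodMk_left))
    (isFiberwiseIsometric_proj hπ hc hinj hequiv)
    (measurable_graph hf) (fun γ => (hfe γ).mono fun y hy => (smul_graph γ _ _ hy).symm)
    (measurable_graph hg) (fun γ => (hge γ).mono fun z hz => (smul_graph γ _ _ hz).symm)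
    (hfg.mono fun y hy => proj_graph hπ _ _ hy)
  exact ⟨ψ, hψ⟩

end Graph

end FiberAction

end Fields

section Ergodicity

open Set FiberAction

theorem ae_smul_iff {Γ Y : Type*} [Group Γ] [MeasurableSpace Y] [MulAction Γ Y] {η : Measure Y}
    (hη : ∀ γ : Γ, Measure.QuasiMeasurePreserving (fun y : Y => γ • y) η η) (γ : Γ)
    {p : Y → Prop} : (∀ᵐ y ∂η, p (γ • y)) ↔ ∀ᵐ y ∂η, p y := by
  refine ⟨fun h => ?_, fun h => (hη γ).ae h⟩
  filter_upwards [(hη γ⁻¹).ae h] with y hy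
  simpa only [smul_inv_smul] using hy

section Prod

variable {Y Z : Type*} [MeasurableSpace Y] [MeasurableSpace Z] {η : Measure Y} {ζ : Measure Z}
  [SFinite η] [SFinite ζ]

theorem ae_prod_swap {p : Y × Z → Prop} (h : ∀ᵐ w ∂(η.prod ζ), p w) :
    ∀ᵐ w ∂(ζ.prod η), p w.swap :=
  Measure.measurePreserving_swap.quasiMeasurePreserving.ae h

theorem ae_ae_swap_of_ae_prod {p : Y × Z → Prop} (h : ∀ᵐ w ∂(η.prod ζ), p w) :
    ∀ᵐ z ∂ζ, ∀ᵐ y ∂η, p (y, z) :=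
  Measure.ae_ae_of_ae_prod (ae_prod_swap h)

omit [SFinite η] in
theorem measurableSet_setOf_ae {A : Set (Y × Z)} (hA : MeasurableSet A) :
    MeasurableSet {y | ∀ᵐ z ∂ζ, (y, z) ∈ A} :=
  measurable_measure_prodMk_left hA.compl (measurableSet_singleton 0)

theorem ae_prod_of_ae_ae_swap {A : Set (Y × Z)} (hA : MeasurableSet A)
    (h : ∀ᵐ z ∂ζ, ∀ᵐ y ∂η, (y, z) ∈ A) : ∀ᵐ w ∂(η.prod ζ), w ∈ A :=
  ae_prod_swap ((Measure.ae_prod_mem_iff_ae_ae_mem (measurable_swap hA)).2 h)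

omit [SFinite η] in
theorem ae_prod_ae_of_ae_ae_ae {W : Type*} [MeasurableSpace W] {θ : Measure W} [SFinite θ]
    {A : Set ((Y × Z) × W)} (hA : MeasurableSet A)
    (h : ∀ᵐ y ∂η, ∀ᵐ z ∂ζ, ∀ᵐ x ∂θ, ((y, z), x) ∈ A) :
    ∀ᵐ w ∂(η.prod θ), ∀ᵐ z ∂ζ, ((w.1, z), w.2) ∈ A := by
  have hmeas : Measurable fun p : (Y × W) × Z => ((p.1.1, p.2), p.1.2) := by fun_prop
  refine (Measure.ae_prod_mem_iff_ae_ae_mem (measurableSet_setOf_ae (hmeas hA))).2 ?_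
  filter_upwards [h] with y hy
  have hmeas_y : Measurable fun p : Z × W => ((y, p.1), p.2) := by fun_prop
  exact ae_ae_swap_of_ae_prod ((Measure.ae_prod_mem_iff_ae_ae_mem (hmeas_y hA)).2 hy)

theorem exists_ae_eq_of_ae_eq_fst_of_ae_eq_snd [NeZero ζ] {U : Type*} {F : Y × Z → U}
    {ψ₁ : Y → U} {ψ₂ : Z → U} (h₁ : ∀ᵐ w ∂(η.prod ζ), ψ₁ w.1 = F w)
    (h₂ : ∀ᵐ w ∂(η.prod ζ), ψ₂ w.2 = F w) : ∃ u, ∀ᵐ w ∂(η.prod ζ), F w = u := by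
  have h₁₂ : ∀ᵐ w ∂(η.prod ζ), ψ₁ w.1 = ψ₂ w.2 := by
    filter_upwards [h₁, h₂] with w hw₁ hw₂ using hw₁.trans hw₂.symm
  obtain ⟨z₀, hz₀⟩ := (ae_ae_swap_of_ae_prod h₁₂).exists
  refine ⟨ψ₂ z₀, ?_⟩
  filter_upwards [h₁, Measure.quasiMeasurePreserving_fst.ae hz₀] with w hw hw₀
  rw [← hw, hw₀]

end Prod

/-- The trivial action on the fibers, for which `MargProb` is the space of probability measures on
`Ω × T` with marginal `μ` with its diagonal action. -/
def trivialAction (Γ : Type u) {Ω : Type u} [Group Γ] [MeasurableSpace Ω] [MulAction Γ Ω]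
    (μ : Measure Ω) (T : Type u) [MeasurableSpace T] : FiberAction Γ Ω μ T where
  act _ _ t := t
  measurable_act _ := measurable_snd
  act_one := by simp only [implies_true, Filter.eventually_true]
  act_mul := by simp only [implies_true, Filter.eventually_true]

variable {Γ Ω B : Type u} [Group Γ] [MeasurableSpace Ω] [StandardBorelSpace Ω]
  [MulAction Γ Ω] [MeasurableConstSMul Γ Ω] {μ : Measure Ω} [IsProbabilityMeasure μ]
  [MeasurableSpace B] [MulAction Γ B] {ν : Measure B} [SigmaFinite ν] [NeZero ν]
  {A : Set ((B × B) × Ω)}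

theorem IsBoundary.exists_measurableSet_ae_mem_iff [SMulInvariantMeasure Γ Ω μ]
    (hB : IsBoundary Γ ν) (hA : MeasurableSet A)
    (hinv : ∀ γ : Γ, ∀ᵐ y ∂(ν.prod ν), ∀ᵐ s ∂μ, ((γ • y, γ • s) ∈ A ↔ (y, s) ∈ A)) :
    ∃ S : Set Ω, MeasurableSet S ∧ ∀ᵐ y ∂(ν.prod ν), ∀ᵐ s ∂μ, ((y, s) ∈ A ↔ s ∈ S) := by
  have : DiscreteMeasurableSpace (ULift.{u} Prop) :=
    ⟨fun S => MeasurableSet.of_discrete (s := ULift.up ⁻¹' S)⟩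
  let f : (B × B) × Ω → ULift.{u} Prop := fun w => ⟨w ∈ A⟩
  have hf : Measurable f := measurable_up.comp (measurableSet_setOfPred.1 hA)
  let τ := trivialAction Γ μ (ULift.{u} Prop)
  let F : B × B → τ.MargProb := fun y => τ.graph (hf.comp (measurable_prodMk_left (x := y)))
  obtain ⟨c, hc⟩ := Countable.exists_injective_nat (ULift.{u} Prop)
  have hfactor : ∀ q : B × B → B, IsRelativelyMetricallyErgodic Γ (ν.prod ν) ν q →
      ∃ ψ : B → τ.MargProb, ∀ᵐ y ∂(ν.prod ν), ψ (q y) = F y := fun q hq =>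
    exists_graph_factorization hq (trivialAction Γ μ PUnit.{u + 1}) τ
      (π := fun _ => PUnit.unit) measurable_const (measurable_of_countable c)
      (fun w w' h => hc (congrArg Prod.snd h)) (fun _ => ae_of_all _ fun _ _ => rfl) hf
      (fun γ => (hinv γ).mono fun y hy => hy.mono fun s hs => congrArg ULift.up (propext hs))
      (g := fun _ => PUnit.unit) measurable_const (fun _ => ae_of_all _ fun _ => ae_of_all _
        fun _ => rfl) (ae_of_all _ fun _ => ae_of_all _ fun _ => rfl)
  obtain ⟨ψ₁, hψ₁⟩ := hfactor Prod.fst hB.ergodic_fst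
  obtain ⟨ψ₂, hψ₂⟩ := hfactor Prod.snd hB.ergodic_snd
  obtain ⟨u, hu⟩ := exists_ae_eq_of_ae_eq_fst_of_ae_eq_snd hψ₁ hψ₂
  obtain ⟨b, hb⟩ := (Measure.ae_ae_of_ae_prod hu).exists
  obtain ⟨b', hb'⟩ := hb.exists
  refine ⟨{s | ((b, b'), s) ∈ A}, measurable_prodMk_left hA, ?_⟩
  filter_upwards [hu] with y hy
  filter_upwards [ae_eq_of_graph_eq _ _ (hy.trans hb'.symm)] with s hs
  exact iff_of_eq (congrArg ULift.down hs)

theorem IsBoundary.ergodic_prod [ErgodicSMul Γ Ω μ] (hB : IsBoundary Γ ν) (hA : MeasurableSet A)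
    (hinv : ∀ γ : Γ, ∀ᵐ y ∂(ν.prod ν), ∀ᵐ s ∂μ, ((γ • y, γ • s) ∈ A ↔ (y, s) ∈ A)) :
    (∀ᵐ y ∂(ν.prod ν), ∀ᵐ s ∂μ, (y, s) ∈ A) ∨ (∀ᵐ y ∂(ν.prod ν), ∀ᵐ s ∂μ, (y, s) ∉ A) := by
  obtain ⟨S, hS, hAS⟩ := hB.exists_measurableSet_ae_mem_iff hA hinv
  have hinvS : ∀ γ : Γ, (γ • ·) ⁻¹' S =ᵐ[μ] S := fun γ => by
    have hsmul : Measure.QuasiMeasurePreserving (fun y : B × B => γ • y) (ν.prod ν) (ν.prod ν) :=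
      QuasiMeasurePreserving.prodMap (hB.quasiInvariant γ) (hB.quasiInvariant γ)
    obtain ⟨b, hb⟩ := (Measure.ae_ae_of_ae_prod
      ((hinv γ).and (hAS.and (hsmul.ae hAS)))).exists
    obtain ⟨b', hA, hS, hS'⟩ := hb.exists
    rw [Filter.eventuallyEq_set]
    filter_upwards [hA, hS, (measurePreserving_smul γ μ).quasiMeasurePreserving.ae hS']
      with s hA hS hS' using hS'.symm.trans (hA.trans hS)
  have hconst := ErgodicSMul.aeconst_of_forall_preimage_smul_ae_eq hS hinvS
  rw [Filter.eventuallyConst_set] at hconst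
  refine hconst.imp (fun h => ?_) fun h => ?_
  · filter_upwards [hAS] with y hy
    filter_upwards [hy, h] with s hs hsS using hs.2 hsS
  · filter_upwards [hAS] with y hy
    filter_upwards [hy, h] with s hs hsS using mt hs.1 hsS

end Ergodicity

section Labels

open Set

variable {X : Type u} [TopologicalSpace X] [CompactSpace X] [T2Space X] [SecondCountableTopology X]
  [PointSeparated X] [ConnectedSpace X] {K L L' : Set X}

variable (X) in
/-- A point of the `n`-th member of the net; these points label the components of the complements
of the closed sets. -/
noncomputable def netPt (n : ℕ) : X := (net_nonempty (X := X) n).choose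

theorem netPt_mem (n : ℕ) : netPt X n ∈ net X n := (net_nonempty (X := X) n).choose_spec

/-- The label of the component of the complement of `K` which contains `L`: the first `n` such that
`netPt X n` lies in it (and `0` if there is none, in particular if `L` meets `K`). -/
noncomputable def label (K L : Set X) : ℕ := sInf {n | SameSide K {netPt X n} L}

theorem label_congr (h : SameSide K L L') (hL : L.Nonempty) (hL' : L'.Nonempty) :
    label K L = label K L' := by
  simp only [label]
  congr 1
  ext n
  exact ⟨fun hn => hn.trans hL h, fun hn => hn.trans hL' h.symm⟩

theorem exists_net_disjoint (hK : IsClosed K) (hL : IsSubcontinuum L) (hne : L.Nonempty)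
    (h : Disjoint K L) : ∃ i, L ⊆ net X i ∧ Disjoint K (net X i) := by
  obtain ⟨i, hLi, hi⟩ := exists_net hL hne hK.isOpen_compl (subset_compl_iff_disjoint_left.2 h)
  exact ⟨i, hLi, subset_compl_iff_disjoint_left.1 hi⟩

theorem sameSide_netPt_iff (hK : IsClosed K) {n : ℕ} : SameSide K {netPt X n} L ↔
    ∃ i, netPt X n ∈ net X i ∧ L ⊆ net X i ∧ Disjoint K (net X i) := by
  constructor
  · rintro ⟨D, hD, hnD, hLD, hKD⟩
    obtain ⟨i, hDi, hi⟩ := exists_net_disjoint hK hD ⟨_, hnD rfl⟩ hKD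
    exact ⟨i, hDi (hnD rfl), hLD.trans hDi, hi⟩
  · rintro ⟨i, hni, hLi, hi⟩
    exact ⟨net X i, isSubcontinuum_net i, singleton_subset_iff.2 hni, hLi, hi⟩

theorem sameSide_label (hK : IsClosed K) (hL : IsSubcontinuum L) (hne : L.Nonempty)
    (h : Disjoint K L) : SameSide K {netPt X (label K L)} L := by
  obtain ⟨i, hLi, hi⟩ := exists_net_disjoint hK hL hne h
  have hex : {n | SameSide K {netPt X n} L}.Nonempty :=
    ⟨i, (sameSide_netPt_iff hK).2 ⟨i, netPt_mem i, hLi, hi⟩⟩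
  exact Nat.sInf_mem hex

theorem netPt_label_notMem (hK : IsClosed K) (hL : IsSubcontinuum L) (hne : L.Nonempty)
    (h : Disjoint K L) : netPt X (label K L) ∉ K := by
  obtain ⟨D, -, hD, -, hKD⟩ := sameSide_label hK hL hne h
  exact fun hmem => Set.disjoint_left.1 hKD hmem (hD rfl)

theorem measurable_sInf_setOf {Y : Type*} [MeasurableSpace Y] {p : Y → ℕ → Prop}
    (hp : ∀ n, MeasurableSet {y | p y n}) : Measurable fun y => sInf {n | p y n} := by
  classical
  have hnone : MeasurableSet {y | ∀ m, ¬ p y m} := by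
    simp only [ofPred_forall]
    exact MeasurableSet.iInter fun m => (hp m).compl
  have hex : ∀ y, ∃ n, p y n ∨ ∀ m, ¬ p y m := fun y => by
    by_cases h : ∃ n, p y n
    · exact h.imp fun n hn => Or.inl hn
    · exact ⟨0, Or.inr (not_exists.1 h)⟩
  convert measurable_find hex fun n => (hp n).union hnone using 2 with y
  by_cases h : ∃ n, p y n
  · refine (Nat.sInf_def (s := {n | p y n}) h).trans ?_
    exact Nat.find_congr' fun {n} => ⟨Or.inl, fun hn => hn.resolve_right fun hn => by
      obtain ⟨m, hm⟩ := h
      exact hn m hm⟩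
  · have hempty : {n | p y n} = ∅ := eq_empty_of_forall_notMem (not_exists.1 h)
    rw [hempty, Nat.sInf_empty, eq_comm, Nat.find_eq_zero]
    exact Or.inr (not_exists.1 h)

section Measurability

variable {Y : Type*} [MeasurableSpace Y] {K L : Y → NonemptyCompacts X}

theorem measurableSet_sameSide_netPt (hK : Measurable K) (hL : Measurable L) (n : ℕ) :
    MeasurableSet {y | SameSide (K y : Set X) {netPt X n} (L y)} := by
  simp only [sameSide_netPt_iff (K _).isCompact.isClosed, disjoint_iff_inter_eq_empty,
    ← not_nonempty_iff_eq_empty]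
  rw [ofPred_exists]
  refine MeasurableSet.iUnion fun i => (MeasurableSet.const _).inter ?_
  exact (measurableSet_subset hL (isSubcontinuum_net i).isClosed).inter
    (measurableSet_inter_nonempty hK (isSubcontinuum_net i).isClosed).compl

theorem measurable_label (hK : Measurable K) (hL : Measurable L) :
    Measurable fun y => label (K y : Set X) (L y : Set X) :=
  measurable_sInf_setOf (measurableSet_sameSide_netPt hK hL)

theorem measurable_singleton_netPt {n : Y → ℕ} (hn : Measurable n) :
    Measurable fun y => ({netPt X (n y)} : NonemptyCompacts X) :=
  (measurable_of_countable fun m => ({netPt X m} : NonemptyCompacts X)).comp hn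

end Measurability

variable (X) in
/-- The space of components of complements of compact sets, a component of the complement of `K`
being encoded by its label. -/
def Labelled : Type u :=
  {p : NonemptyCompacts X × ℕ // netPt X p.2 ∉ (p.1 : Set X) ∧
    label (p.1 : Set X) {netPt X p.2} = p.2}

namespace Labelled

instance : MeasurableSpace (Labelled X) := inferInstanceAs (MeasurableSpace (Subtype _))

instance : StandardBorelSpace (Labelled X) := by
  have hpt := measurable_singleton_netPt (X := X) (measurable_snd (α := NonemptyCompacts X))
  have hdisj := measurableSet_disjoint measurable_fst hpt
  simp only [NonemptyCompacts.coe_singleton, disjoint_singleton_right] at hdisj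
  have hlabel := measurable_label measurable_fst hpt
  simp only [NonemptyCompacts.coe_singleton] at hlabel
  exact (hdisj.inter (measurableSet_eq_fun hlabel measurable_snd)).standardBorel

variable {K K' L L' : NonemptyCompacts X}

/-- The component of the complement of `K` which contains `L`. -/
noncomputable def mk (K L : NonemptyCompacts X) (hL : IsSubcontinuum (L : Set X))
    (h : Disjoint (K : Set X) L) : Labelled X :=
  have hK := K.isCompact.isClosed
  ⟨(K, label (K : Set X) L), netPt_label_notMem hK hL L.nonempty h,
    label_congr (sameSide_label hK hL L.nonempty h) (singleton_nonempty _) L.nonempty⟩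

/-- The image of a component under a homeomorphism. -/
noncomputable def map (g : X ≃ₜ X) (w : Labelled X) : Labelled X :=
  mk (mapCL g w.1.1) {g (netPt X w.1.2)} (by simpa using isSubcontinuum_singleton _)
    (by simpa using w.2.1)

theorem map_mk (g : X ≃ₜ X) (hL : IsSubcontinuum (L : Set X)) (h : Disjoint (K : Set X) L)
    (hL' : IsSubcontinuum (mapCL g L : Set X))
    (h' : Disjoint (mapCL g K : Set X) (mapCL g L : Set X)) :
    map g (mk K L hL h) = mk (mapCL g K) (mapCL g L) hL' h' := by
  have hside := (sameSide_label K.isCompact.isClosed hL L.nonempty h).image g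
  rw [image_singleton] at hside
  refine Subtype.ext (Prod.ext rfl ?_)
  simpa only [map, mk, coe_mapCL, NonemptyCompacts.coe_singleton]
    using label_congr hside (singleton_nonempty _) (L.nonempty.image g)

theorem eq_mk (w : Labelled X) : w = mk w.1.1 {netPt X w.1.2}
    (by simpa using isSubcontinuum_singleton _) (by simpa using w.2.1) :=
  Subtype.ext (Prod.ext rfl (by simpa only [mk, NonemptyCompacts.coe_singleton] using w.2.2.symm))

theorem mk_congr {hL : IsSubcontinuum (L : Set X)} {h : Disjoint (K : Set X) L}
    {hL' : IsSubcontinuum (L' : Set X)} {h' : Disjoint (K' : Set X) L'} (hKK' : K = K')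
    (hLL' : L = L') : mk K L hL h = mk K' L' hL' h' := by
  subst hKK' hLL'
  rfl

theorem sameSide_of_mk_eq_mk {hL : IsSubcontinuum (L : Set X)} {h : Disjoint (K : Set X) L}
    {hL' : IsSubcontinuum (L' : Set X)} {h' : Disjoint (K : Set X) L'}
    (heq : mk K L hL h = mk K L' hL' h') : SameSide (K : Set X) L L' := by
  have hlabel : label (K : Set X) L = label (K : Set X) L' :=
    congrArg (fun w : Labelled X => w.1.2) heq
  have hK := K.isCompact.isClosed
  refine (sameSide_label hK hL L.nonempty h).symm.trans (singleton_nonempty _) ?_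
  rw [hlabel]
  exact sameSide_label hK hL' L'.nonempty h'

theorem map_one (w : Labelled X) : map 1 w = w := by
  conv_rhs => rw [w.eq_mk]
  exact mk_congr (mapCL_one _) rfl

theorem map_mul (g h : X ≃ₜ X) (w : Labelled X) : map (g * h) w = map g (map h w) := by
  have hL : IsSubcontinuum (mapCL g {h (netPt X w.1.2)} : Set X) := by
    simpa using isSubcontinuum_singleton _
  have hdisj : Disjoint (mapCL g (mapCL h w.1.1) : Set X) (mapCL g {h (netPt X w.1.2)}) := by
    simpa [disjoint_image_iff g.injective] using w.2.1
  refine Eq.trans ?_ (map_mk g _ _ hL hdisj).symm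
  exact mk_congr (mapCL_mul g h _) (mapCL_singleton g _).symm

theorem measurable_mk {Y : Type*} [MeasurableSpace Y] {K L : Y → NonemptyCompacts X}
    (hK : Measurable K) (hL : Measurable L) (hLs : ∀ y, IsSubcontinuum (L y : Set X))
    (h : ∀ y, Disjoint (K y : Set X) (L y)) :
    Measurable fun y => mk (K y) (L y) (hLs y) (h y) :=
  Measurable.subtype_mk (hK.prodMk (measurable_label hK hL))

theorem exists_measurable_eq_mk {Y : Type*} [MeasurableSpace Y] {K L : Y → NonemptyCompacts X}
    (hK : Measurable K) (hL : Measurable L) (hLs : ∀ y, IsSubcontinuum (L y : Set X))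
    (hne : ∃ y, Disjoint (K y : Set X) (L y)) :
    ∃ f : Y → Labelled X, Measurable f ∧
      ∀ y (h : Disjoint (K y : Set X) (L y)), f y = mk (K y) (L y) (hLs y) h := by
  classical
  obtain ⟨y₀, hy₀⟩ := hne
  let A : Set Y := {y | Disjoint (K y : Set X) (L y)}
  refine ⟨fun y => if h : y ∈ A then mk (K y) (L y) (hLs y) h else mk (K y₀) (L y₀) (hLs y₀) hy₀,
    ?_, fun y h => dif_pos h⟩
  exact Measurable.dite (f := fun y : A => mk (K y.1) (L y.1) (hLs y.1) y.2)
    (measurable_mk (hK.comp measurable_subtype_coe) (hL.comp measurable_subtype_coe) _ _)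
    measurable_const (measurableSet_disjoint hK hL)

end Labelled

end Labels

/-! ### Equivariant families of subcontinua over a boundary -/

section Families

open Set FiberAction

variable {Γ Ω B X : Type u} [Group Γ] [MeasurableSpace Ω] [MulAction Γ Ω] {μ : Measure Ω}
  [MeasurableSpace B] [MulAction Γ B] {ν : Measure B} [TopologicalSpace X]
  {σ : Γ → Ω → (X ≃ₜ X)}

/-- Equivariant families of subcontinua over `B × Ω`: the families of subdendrites for the lift of
`σ` to `B × Ω`. -/
structure IsBoundaryFamily (ν : Measure B) (μ : Measure Ω) (σ : Γ → Ω → (X ≃ₜ X))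
    (K : B × Ω → NonemptyCompacts X) : Prop where
  measurable : Measurable K
  equivariant : ∀ γ : Γ, ∀ᵐ w ∂(ν.prod μ), K (γ • w) = mapCL (σ γ w.2) (K w)
  isSubcontinuum : ∀ w, IsSubcontinuum (K w : Set X)

theorem IsVirtualDendroMorphism.ae_one (hσ : IsVirtualDendroMorphism μ σ) :
    ∀ᵐ s ∂μ, σ 1 s = 1 := by
  filter_upwards [hσ.cocycle 1 1] with s hs
  simpa using hs

section Pairs

variable {K L : B × Ω → NonemptyCompacts X}

theorem IsBoundaryFamily.ae_pair [SFinite μ] (hK : IsBoundaryFamily ν μ σ K)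
    (hL : IsBoundaryFamily ν μ σ L) (γ : Γ) : ∀ᵐ y ∂(ν.prod ν), ∀ᵐ s ∂μ,
      K (γ • y.1, γ • s) = mapCL (σ γ s) (K (y.1, s)) ∧
      L (γ • y.2, γ • s) = mapCL (σ γ s) (L (y.2, s)) := by
  filter_upwards [
    Measure.quasiMeasurePreserving_fst.ae (Measure.ae_ae_of_ae_prod (hK.equivariant γ)),
    Measure.quasiMeasurePreserving_snd.ae (Measure.ae_ae_of_ae_prod (hL.equivariant γ))]
    with y hKy hLy
  exact hKy.and hLy

omit [MeasurableSpace Ω] [MeasurableSpace B] in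
theorem disjoint_mapCL_iff (g : X ≃ₜ X) (K L : NonemptyCompacts X) :
    Disjoint (mapCL g K : Set X) (mapCL g L : Set X) ↔ Disjoint (K : Set X) (L : Set X) := by
  simp only [coe_mapCL, disjoint_image_iff g.injective]

variable [T2Space X] [SecondCountableTopology X]

theorem measurableSet_disjoint_pair (hK : Measurable K) (hL : Measurable L) :
    MeasurableSet {w : (B × B) × Ω | Disjoint (K (w.1.1, w.2) : Set X) (L (w.1.2, w.2))} :=
  measurableSet_disjoint (hK.comp (by fun_prop)) (hL.comp (by fun_prop))

theorem ae_disjoint_or_ae_not_disjoint [StandardBorelSpace Ω] [MeasurableConstSMul Γ Ω]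
    [IsProbabilityMeasure μ] [ErgodicSMul Γ Ω μ] [SigmaFinite ν] [NeZero ν]
    (hB : IsBoundary Γ ν) (hK : IsBoundaryFamily ν μ σ K) (hL : IsBoundaryFamily ν μ σ L) :
    (∀ᵐ y ∂(ν.prod ν), ∀ᵐ s ∂μ, Disjoint (K (y.1, s) : Set X) (L (y.2, s))) ∨
    (∀ᵐ y ∂(ν.prod ν), ∀ᵐ s ∂μ, ¬ Disjoint (K (y.1, s) : Set X) (L (y.2, s))) := by
  refine hB.ergodic_prod (measurableSet_disjoint_pair hK.measurable hL.measurable) fun γ => ?_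
  filter_upwards [hK.ae_pair hL γ] with y hy
  filter_upwards [hy] with s hs
  simp only [Prod.smul_fst, Prod.smul_snd, hs.1, hs.2, disjoint_mapCL_iff]

end Pairs

/- Relative metric ergodicity of the first projection, applied to graphs over `Ω`: a countable
labelling over `B × Ω` cannot depend on a second, independent, point of the boundary. -/
theorem IsBoundary.ae_eq_of_fst_eq [StandardBorelSpace Ω] [MeasurableConstSMul Γ Ω]
    [IsProbabilityMeasure μ] [SMulInvariantMeasure Γ Ω μ] [SFinite ν]
    {Z W : Type u} [MeasurableSpace Z] [MeasurableSpace W] [StandardBorelSpace Z]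
    [StandardBorelSpace W] (hB : IsBoundary Γ ν) (τZ : FiberAction Γ Ω μ Z)
    (τW : FiberAction Γ Ω μ W) {π : W → Z} (hπ : Measurable π) {c : W → ℕ} (hc : Measurable c)
    (hinj : Function.Injective fun w => (π w, c w))
    (hequiv : ∀ γ, ∀ᵐ s ∂μ, ∀ w, π (τW.act γ s w) = τZ.act γ s (π w))
    {f : (B × B) × Ω → W} (hf : Measurable f)
    (hfe : ∀ γ : Γ, ∀ᵐ y ∂(ν.prod ν), ∀ᵐ s ∂μ, f (γ • y, γ • s) = τW.act γ s (f (y, s)))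
    {g : B × Ω → Z} (hg : Measurable g)
    (hge : ∀ γ : Γ, ∀ᵐ b ∂ν, ∀ᵐ s ∂μ, g (γ • b, γ • s) = τZ.act γ s (g (b, s)))
    (hfg : ∀ᵐ y ∂(ν.prod ν), ∀ᵐ s ∂μ, π (f (y, s)) = g (y.1, s)) :
    ∀ᵐ w ∂(ν.prod μ), ∀ᵐ y ∂(ν.prod ν), f ((w.1, y.1), w.2) = f ((w.1, y.2), w.2) := by
  obtain ⟨ψ, hψ⟩ :=
    exists_graph_factorization hB.ergodic_fst τZ τW hπ hc hinj hequiv hf hfe hg hge hfg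
  refine ae_prod_ae_of_ae_ae_ae
    (A := {v : (B × (B × B)) × Ω | f ((v.1.1, v.1.2.1), v.2) = f ((v.1.1, v.1.2.2), v.2)})
    (measurableSet_eq_fun (hf.comp (by fun_prop)) (hf.comp (by fun_prop))) ?_
  filter_upwards [Measure.ae_ae_of_ae_prod hψ] with b hb
  filter_upwards [Measure.quasiMeasurePreserving_fst.ae hb,
    Measure.quasiMeasurePreserving_snd.ae hb] with y hy₁ hy₂
  exact ae_eq_of_graph_eq _ _ (hy₁.symm.trans hy₂)

variable [CompactSpace X] [T2Space X] [SecondCountableTopology X]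

/-- The action of a virtual dendro-morphism on the hyperspace. -/
def actCL (hσ : IsVirtualDendroMorphism μ σ) : FiberAction Γ Ω μ (NonemptyCompacts X) where
  act γ s K := mapCL (σ γ s) K
  measurable_act γ := measurable_mapCL ((hσ.measurable γ).comp measurable_fst) measurable_snd
  act_one := by
    filter_upwards [hσ.ae_one] with s hs K
    rw [hs, mapCL_one]
  act_mul γ₁ γ₂ := by
    filter_upwards [hσ.cocycle γ₁ γ₂] with s hs K
    rw [hs, mapCL_mul]

variable [PointSeparated X] [ConnectedSpace X]

/-- The action of a virtual dendro-morphism on the components of complements of compact sets. -/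
noncomputable def actLabelled (hσ : IsVirtualDendroMorphism μ σ) :
    FiberAction Γ Ω μ (Labelled X) where
  act γ s w := Labelled.map (σ γ s) w
  measurable_act γ := by
    have hg : Measurable fun p : Ω × Labelled X => σ γ p.1 := (hσ.measurable γ).comp measurable_fst
    have hw : Measurable fun p : Ω × Labelled X => p.2.1 :=
      measurable_subtype_coe.comp measurable_snd
    have hpt := measurable_mapCL hg (measurable_singleton_netPt (measurable_snd.comp hw))
    simp only [mapCL_singleton] at hpt
    exact Labelled.measurable_mk (measurable_mapCL hg (measurable_fst.comp hw)) hpt _ _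
  act_one := by
    filter_upwards [hσ.ae_one] with s hs w
    rw [hs, Labelled.map_one]
  act_mul γ₁ γ₂ := by
    filter_upwards [hσ.cocycle γ₁ γ₂] with s hs w
    rw [hs, Labelled.map_mul]

variable [StandardBorelSpace Ω] [MeasurableConstSMul Γ Ω] [IsProbabilityMeasure μ]
  [SMulInvariantMeasure Γ Ω μ] [SigmaFinite ν] [NeZero ν] {K L : B × Ω → NonemptyCompacts X}

theorem ae_mk_eq_mk (hB : IsBoundary Γ ν) (hσ : IsVirtualDendroMorphism μ σ)
    (hK : IsBoundaryFamily ν μ σ K) (hL : IsBoundaryFamily ν μ σ L)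
    (hdisj : ∀ᵐ y ∂(ν.prod ν), ∀ᵐ s ∂μ, Disjoint (K (y.1, s) : Set X) (L (y.2, s))) :
    ∀ᵐ w ∂(ν.prod μ), ∀ᵐ y ∂(ν.prod ν),
      ∀ (h : Disjoint (K w : Set X) (L (y.1, w.2))) (h' : Disjoint (K w : Set X) (L (y.2, w.2))),
        Labelled.mk (K w) (L (y.1, w.2)) (hL.isSubcontinuum _) h =
          Labelled.mk (K w) (L (y.2, w.2)) (hL.isSubcontinuum _) h' := by
  obtain ⟨f, hf, hfmk⟩ := Labelled.exists_measurable_eq_mk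
    (K := fun w : (B × B) × Ω => K (w.1.1, w.2)) (L := fun w => L (w.1.2, w.2))
    (hK.measurable.comp (by fun_prop)) (hL.measurable.comp (by fun_prop))
    (fun _ => hL.isSubcontinuum _) (by
      obtain ⟨b, hb⟩ := (Measure.ae_ae_of_ae_prod hdisj).exists
      obtain ⟨b', hb'⟩ := hb.exists
      obtain ⟨s, hs⟩ := hb'.exists
      exact ⟨((b, b'), s), hs⟩)
  have hfe : ∀ γ : Γ, ∀ᵐ y ∂(ν.prod ν), ∀ᵐ s ∂μ,
      f (γ • y, γ • s) = (actLabelled hσ).act γ s (f (y, s)) := fun γ => by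
    filter_upwards [hK.ae_pair hL γ, hdisj] with y hy hd
    filter_upwards [hy, hd] with s ⟨hKs, hLs⟩ hd
    have hd' := (disjoint_mapCL_iff (σ γ s) _ _).2 hd
    have hd'' : Disjoint (K (γ • y.1, γ • s) : Set X) (L (γ • y.2, γ • s)) := by rwa [hKs, hLs]
    rw [hfmk (y, s) hd, hfmk (γ • y, γ • s) hd'']
    exact (Labelled.mk_congr hKs hLs).trans (Labelled.map_mk _ _ _ ((hL.isSubcontinuum _).image _)
      hd').symm
  have hlabel := hB.ae_eq_of_fst_eq (actCL hσ) (actLabelled hσ)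
    (π := fun w => w.1.1) (measurable_fst.comp measurable_subtype_coe)
    (c := fun w => w.1.2) (measurable_snd.comp measurable_subtype_coe)
    (fun _ _ h => Subtype.ext h) (fun _ => ae_of_all _ fun _ _ => rfl) hf hfe hK.measurable
    (fun γ => Measure.ae_ae_of_ae_prod (hK.equivariant γ))
    (hdisj.mono fun y hy => hy.mono fun s hs => by rw [hfmk (y, s) hs]; rfl)
  filter_upwards [hlabel] with w hw
  filter_upwards [hw] with y hy h h'
  exact (hfmk ((w.1, y.1), w.2) h).symm.trans (hy.trans (hfmk ((w.1, y.2), w.2) h'))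

theorem ae_exists_sameSide (hB : IsBoundary Γ ν) (hσ : IsVirtualDendroMorphism μ σ)
    (hK : IsBoundaryFamily ν μ σ K) (hL : IsBoundaryFamily ν μ σ L)
    (hdisj : ∀ᵐ y ∂(ν.prod ν), ∀ᵐ s ∂μ, Disjoint (K (y.1, s) : Set X) (L (y.2, s))) :
    ∀ᵐ w ∂(ν.prod μ), ∃ x ∉ (K w : Set X), ∀ᵐ b ∂ν,
      SameSide (K w : Set X) {x} (L (b, w.2)) := by
  have hdisj' := ae_prod_ae_of_ae_ae_ae (measurableSet_disjoint_pair hK.measurable hL.measurable)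
    (Measure.ae_ae_of_ae_prod hdisj)
  filter_upwards [ae_mk_eq_mk hB hσ hK hL hdisj, hdisj'] with w hmk hd
  obtain ⟨b₀, hb₀, hd₀⟩ := ((Measure.ae_ae_of_ae_prod hmk).and hd).exists
  obtain ⟨x, hx⟩ := (L (b₀, w.2)).nonempty
  refine ⟨x, fun hxK => disjoint_left.1 hd₀ hxK hx, ?_⟩
  filter_upwards [hb₀, hd] with b hb hdb
  obtain ⟨D, hD, hb₀D, hbD, hKD⟩ := Labelled.sameSide_of_mk_eq_mk (hb hd₀ hdb)
  exact ⟨D, hD, singleton_subset_iff.2 (hb₀D hx), hbD, hKD⟩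

end Families

/-! ### The minimal family of subdendrites -/

section Cores

open Set

variable {X : Type u} [TopologicalSpace X] [CompactSpace X] [T2Space X] [SecondCountableTopology X]
  [PointSeparated X] [ConnectedSpace X] {Y : Type*} [MeasurableSpace Y] {η : Measure Y}
  {P : Y → Set X → Prop}

theorem exists_measurable_ae_eq_core (hmono : ∀ y, Monotone (P y))
    (hP : ∀ᵐ y ∂η, ¬ P y ∅) (hne : ∀ᵐ y ∂η, (core (P y)).Nonempty)
    (hmeas : ∀ n, MeasurableSet {y | P y (net X n)}) :
    ∃ κ : Y → NonemptyCompacts X, Measurable κ ∧ (∀ y, IsSubcontinuum (κ y : Set X)) ∧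
      ∀ᵐ y ∂η, (κ y : Set X) = core (P y) := by
  obtain ⟨T, hT, hTm, hTη⟩ := exists_measurable_superset_of_null (hP.and hne)
  have hgood : ∀ y ∉ T, ¬ P y ∅ ∧ (core (P y)).Nonempty := fun y hy =>
    of_not_not fun h => hy (hT h)
  -- On the null set `T` the condition is replaced by the void one, whose core is `univ`.
  let P' : Y → Set X → Prop := fun y D => y ∉ T ∧ P y D
  have hcore : ∀ y ∉ T, core (P' y) = core (P y) := fun y hy => by
    simp only [P', hy, not_false_eq_true, true_and]
  have hne' : ∀ y, (core (P' y)).Nonempty := fun y => by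
    by_cases hy : y ∈ T
    · exact (univ_nonempty).mono fun x _ D hD => absurd hy hD.2.1
    · rw [hcore y hy]
      exact (hgood y hy).2
  refine ⟨fun y => coreCL (P' y) (hne' y), ?_, fun y => isSubcontinuum_core _, ?_⟩
  · exact measurable_of_eq_core (P := P') (fun y D E hDE hD => ⟨hD.1, hmono y hDE hD.2⟩)
      (fun y h => (hgood y h.1).1 h.2) (fun n => hTm.compl.inter (hmeas n)) fun y => rfl
  · filter_upwards [measure_eq_zero_iff_ae_notMem.1 hTη] with y hy using hcore y hy

theorem exists_equivariant_ae_eq_core {Γ : Type*} [Group Γ] [MulAction Γ Y]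
    (hη : ∀ γ : Γ, Measure.QuasiMeasurePreserving (fun y : Y => γ • y) η η)
    {c : Γ → Y → (X ≃ₜ X)} (hmono : ∀ y, Monotone (P y)) (hP : ∀ᵐ y ∂η, ¬ P y ∅)
    (hne : ∀ᵐ y ∂η, (core (P y)).Nonempty) (hmeas : ∀ n, MeasurableSet {y | P y (net X n)})
    (heq : ∀ γ : Γ, ∀ᵐ y ∂η, ∀ D, P y D ↔ P (γ • y) (c γ y '' D)) :
    ∃ κ : Y → NonemptyCompacts X, Measurable κ ∧ (∀ y, IsSubcontinuum (κ y : Set X)) ∧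
      (∀ᵐ y ∂η, (κ y : Set X) = core (P y)) ∧
      ∀ γ : Γ, ∀ᵐ y ∂η, κ (γ • y) = mapCL (c γ y) (κ y) := by
  obtain ⟨κ, hκ, hκs, hκP⟩ := exists_measurable_ae_eq_core hmono hP hne hmeas
  refine ⟨κ, hκ, hκs, hκP, fun γ => ?_⟩
  filter_upwards [hκP, (hη γ).ae hκP, heq γ] with y hy hγy heqy
  apply SetLike.coe_injective
  rw [coe_mapCL, hy, hγy]
  exact (image_core _ fun D _ => heqy D).symm

theorem subset_of_forall_net {A D : Set X} (hD : IsSubcontinuum D) (hne : D.Nonempty)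
    (h : ∀ n, D ⊆ net X n → A ⊆ net X n) : A ⊆ D := by
  intro x hx
  by_contra hxD
  obtain ⟨n, hn, hxn⟩ := exists_net hD hne isOpen_compl_singleton
    (subset_compl_singleton_iff.2 hxD)
  exact hxn (h n hn hx) rfl

theorem measurableSet_subset_subcontinuum {K L : Y → NonemptyCompacts X} (hK : Measurable K)
    (hL : Measurable L) (hLs : ∀ y, IsSubcontinuum (L y : Set X)) :
    MeasurableSet {y | (K y : Set X) ⊆ L y} := by
  have hiff : ∀ y, (K y : Set X) ⊆ L y ↔
      ∀ n, (L y : Set X) ⊆ net X n → (K y : Set X) ⊆ net X n := fun y =>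
    ⟨fun h n hn => h.trans hn, subset_of_forall_net (hLs y) (L y).nonempty⟩
  simp only [hiff, ofPred_forall]
  refine MeasurableSet.iInter fun n => ?_
  have hn := (isSubcontinuum_net (X := X) n).isClosed
  simp only [imp_iff_not_or]
  exact (measurableSet_subset hL hn).compl.union (measurableSet_subset hK hn)

end Cores

section Minimal

open Set

variable {Γ Ω X : Type u} [Group Γ] [MeasurableSpace Ω] [MulAction Γ Ω] {μ : Measure Ω}
  [TopologicalSpace X] {σ : Γ → Ω → (X ≃ₜ X)} {M N N' : Ω → NonemptyCompacts X}

theorem IsEquivariantFamily.ae_eq_mapCL (hN : IsEquivariantFamily μ σ N) (γ : Γ) :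
    ∀ᵐ s ∂μ, N (γ • s) = mapCL (σ γ s) (N s) := by
  filter_upwards [hN.equivariant γ] with s hs
  exact SetLike.coe_injective hs

theorem IsMinimalFamily.ae_eq (hM : IsMinimalFamily μ σ M) (hN : IsMinimalFamily μ σ N) :
    N =ᵐ[μ] M := by
  filter_upwards [hM.minimal N hN.toIsSubdendriteFamily,
    hN.minimal M hM.toIsSubdendriteFamily] with s hMN hNM
  exact SetLike.coe_injective (hNM.antisymm hMN)

theorem IsSubdendriteFamily.isSubcontinuum [T2Space X] (hN : IsSubdendriteFamily μ σ N) (s : Ω) :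
    IsSubcontinuum (N s : Set X) :=
  ⟨(N s).isCompact.isClosed, (hN.connected s).isPreconnected⟩

theorem IsEquivariantFamily.exists_ae_eq [MeasurableConstSMul Γ Ω] [SMulInvariantMeasure Γ Ω μ]
    (hN : IsEquivariantFamily μ σ N) {p : NonemptyCompacts X → Prop} (h : ∀ᵐ s ∂μ, p (N s))
    (hp : ∃ K, p K) :
    ∃ N' : Ω → NonemptyCompacts X, IsEquivariantFamily μ σ N' ∧ ∀ s, p (N' s) := by
  obtain ⟨N', hN', hN'p, hae⟩ :=
    hN.measurable.aemeasurable.exists_ae_eq_range_subset (t := {K | p K}) h hp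
  refine ⟨N', ⟨hN', fun γ => ?_⟩, fun s => hN'p (mem_range_self s)⟩
  filter_upwards [hae, (measurePreserving_smul γ μ).quasiMeasurePreserving.ae hae,
    hN.equivariant γ] with s hs hγs heq
  rw [← hs, ← hγs, heq]

theorem isElementary_of_ae_pair [Nonempty X] [MeasurableConstSMul Γ Ω]
    [SMulInvariantMeasure Γ Ω μ] (hN : IsEquivariantFamily μ σ N)
    (h : ∀ᵐ s ∂μ, ∃ x y : X, (N s : Set X) = {x, y}) : IsElementary μ σ := by
  obtain ⟨x₀⟩ := ‹Nonempty X›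
  exact hN.exists_ae_eq (p := fun K => ∃ x y : X, (K : Set X) = {x, y}) h
    ⟨pairCL x₀ x₀, x₀, x₀, coe_pairCL x₀ x₀⟩

variable [MeasurableConstSMul Γ Ω] [CompactSpace X] [T2Space X] [SecondCountableTopology X]
  [PointSeparated X] [ConnectedSpace X]

theorem isElementary_of_ae_hull [SMulInvariantMeasure Γ Ω μ] (hN : IsEquivariantFamily μ σ N)
    (h : ∀ᵐ s ∂μ, ∃ x y : X, (N s : Set X) = hull {x, y}) : IsElementary μ σ := by
  obtain ⟨x₀⟩ := (inferInstance : Nonempty X)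
  obtain ⟨N', hN', hhull⟩ := hN.exists_ae_eq
    (p := fun K => ∃ x y : X, (K : Set X) = hull {x, y}) h
    ⟨hullCL (pairCL x₀ x₀), x₀, x₀, by rw [coe_hullCL, coe_pairCL]⟩
  obtain ⟨κ, hκ, hκpair, hκhull⟩ := exists_measurable_pair hN'.measurable hhull
  refine ⟨κ, ⟨hκ, fun γ => ?_⟩, hκpair⟩
  filter_upwards [hN'.equivariant γ] with s hs
  obtain ⟨a, b, hab⟩ := hκpair s
  obtain ⟨a', b', hab'⟩ := hκpair (γ • s)
  rw [hκhull, hκhull, image_hull, hab, hab', image_pair] at hs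
  rw [hab, hab', image_pair]
  exact pair_eq_of_hull_eq hs

theorem exists_subdendriteFamily_ae_eq_core [SMulInvariantMeasure Γ Ω μ] {P : Ω → Set X → Prop}
    (hmono : ∀ s, Monotone (P s)) (hP : ∀ᵐ s ∂μ, ¬ P s ∅) (hne : ∀ᵐ s ∂μ, (core (P s)).Nonempty)
    (hmeas : ∀ n, MeasurableSet {s | P s (net X n)})
    (heq : ∀ γ : Γ, ∀ᵐ s ∂μ, ∀ D, P s D ↔ P (γ • s) (σ γ s '' D)) :
    ∃ κ : Ω → NonemptyCompacts X, IsSubdendriteFamily μ σ κ ∧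
      ∀ᵐ s ∂μ, (κ s : Set X) = core (P s) := by
  obtain ⟨κ, hκ, hκs, hκP, hκσ⟩ := exists_equivariant_ae_eq_core
    (fun γ => (measurePreserving_smul γ μ).quasiMeasurePreserving) hmono hP hne hmeas heq
  exact ⟨κ, ⟨⟨hκ, fun γ => (hκσ γ).mono fun s hs => congrArg SetLike.coe hs⟩,
    fun s => ⟨(κ s).nonempty, (hκs s).isPreconnected⟩⟩, hκP⟩

/- The gate of one family towards a disjoint one is a point. -/
theorem isElementary_of_ae_disjoint [SMulInvariantMeasure Γ Ω μ] (hN : IsSubdendriteFamily μ σ N)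
    (hN' : IsSubdendriteFamily μ σ N') (h : ∀ᵐ s ∂μ, Disjoint (N s : Set X) (N' s)) :
    IsElementary μ σ := by
  have hgate : ∀ᵐ s ∂μ, ∃ q, gate (N s : Set X) (N' s) = {q} := by
    filter_upwards [h] with s hs
    exact exists_gate_eq_singleton (hN.isSubcontinuum s) (N s).nonempty
      (hN'.isSubcontinuum s).isPreconnected (N' s).nonempty hs
  obtain ⟨κ, hκ, hκgate⟩ := exists_subdendriteFamily_ae_eq_core (μ := μ) (σ := σ)
    (P := fun s => GatePred (N s : Set X) ((N' s : Set X) ⊆ ·))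
    (fun s => monotone_gatePred fun _ _ hDE hD => hD.trans hDE)
    (ae_of_all _ fun s => not_gatePred_empty (N s).nonempty)
    (ae_of_all _ fun s => gate_nonempty (N s).nonempty (N' s).nonempty)
    (fun n => measurableSet_gatePred hN.measurable (isSubcontinuum_net n).isClosed
      (measurableSet_subset hN'.measurable (isSubcontinuum_net n).isClosed))
    (fun γ => by
      filter_upwards [hN.equivariant γ, hN'.equivariant γ] with s hs hs' D
      rw [hs, hs']
      exact gatePred_image_iff _ (image_subset_image_iff (σ γ s).injective).symm)
  refine isElementary_of_ae_pair hκ.toIsEquivariantFamily ?_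
  filter_upwards [hgate, hκgate] with s ⟨q, hq⟩ hs
  exact ⟨q, q, by rw [pair_eq_singleton, ← hq]; exact hs⟩

variable [ErgodicSMul Γ Ω μ]

theorem ae_inter_nonempty (hne : ¬ IsElementary μ σ) (hN : IsSubdendriteFamily μ σ N)
    (hN' : IsSubdendriteFamily μ σ N') : ∀ᵐ s ∂μ, ((N s : Set X) ∩ N' s).Nonempty := by
  have hconst := ErgodicSMul.aeconst_of_forall_preimage_smul_ae_eq (G := Γ) (μ := μ)
    (measurableSet_disjoint hN.measurable hN'.measurable) fun γ => by
      rw [Filter.eventuallyEq_set]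
      filter_upwards [hN.ae_eq_mapCL γ, hN'.ae_eq_mapCL γ] with s hs hs'
      simp only [mem_preimage, mem_ofPred_eq, hs, hs', disjoint_mapCL_iff]
  rcases Filter.eventuallyConst_set.1 hconst with h | h
  · exact absurd (isElementary_of_ae_disjoint hN hN' h) hne
  · exact h.mono fun s hs => not_disjoint_iff_nonempty_inter.1 hs

theorem exists_subdendriteFamily_ae_subset (hne : ¬ IsElementary μ σ) {ι : Type*} [Countable ι]
    {N : ι → Ω → NonemptyCompacts X} (hN : ∀ i, IsSubdendriteFamily μ σ (N i)) :
    ∃ κ : Ω → NonemptyCompacts X, IsSubdendriteFamily μ σ κ ∧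
      ∀ᵐ s ∂μ, ∀ i, (κ s : Set X) ⊆ N i s := by
  have hinter : ∀ᵐ s ∂μ, ∀ i j, ((N i s : Set X) ∩ N j s).Nonempty :=
    ae_all_iff.2 fun i => ae_all_iff.2 fun j => ae_inter_nonempty hne (hN i) (hN j)
  obtain ⟨κ, hκ, hκcore⟩ := exists_subdendriteFamily_ae_eq_core (μ := μ) (σ := σ)
    (P := fun s D => ∃ i, (N i s : Set X) ⊆ D)
    (fun s D E hDE ⟨i, hi⟩ => ⟨i, hi.trans hDE⟩)
    (ae_of_all _ fun s ⟨i, hi⟩ => (N i s).nonempty.not_subset_empty hi)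
    (hinter.mono fun s hs => core_nonempty fun D E _ _ ⟨i, hi⟩ ⟨j, hj⟩ =>
      (hs i j).mono (inter_subset_inter hi hj))
    (fun n => by
      rw [ofPred_exists]
      exact MeasurableSet.iUnion fun i =>
        measurableSet_subset (hN i).measurable (isSubcontinuum_net n).isClosed)
    (fun γ => by
      filter_upwards [ae_all_iff.2 fun i => (hN i).equivariant γ] with s hs D
      simp only [hs, image_subset_image_iff (σ γ s).injective])
  refine ⟨κ, hκ, ?_⟩
  filter_upwards [hκcore] with s hs i
  rw [hs]
  exact core_subset ((hN i).isSubcontinuum s) ⟨i, subset_rfl⟩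

theorem exists_subdendriteFamily_measure_le (hne : ¬ IsElementary μ σ) :
    ∃ M : Ω → NonemptyCompacts X, IsSubdendriteFamily μ σ M ∧
      ∀ N : Ω → NonemptyCompacts X, IsSubdendriteFamily μ σ N → ∀ n,
        μ {s | (N s : Set X) ⊆ net X n} ≤ μ {s | (M s : Set X) ⊆ net X n} := by
  let F := {N : Ω → NonemptyCompacts X // IsSubdendriteFamily μ σ N}
  let m : ℕ → F → ENNReal := fun n N => μ {s | (N.1 s : Set X) ⊆ net X n}
  have : Nonempty F := by
    refine ⟨fun _ => ⊤, ⟨measurable_const, fun γ => ae_of_all _ fun s => ?_⟩, fun _ => ?_⟩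
    · simp [(σ γ s).surjective.range_eq]
    · simpa using isConnected_univ
  have hseq : ∀ n, ∃ N : ℕ → F, Filter.Tendsto (fun k => m n (N k)) Filter.atTop
      (nhds (⨆ N, m n N)) := fun n => by
    obtain ⟨u, -, hu, humem⟩ := exists_seq_tendsto_sSup (range_nonempty (m n)) (OrderTop.bddAbove _)
    choose N hN using humem
    exact ⟨N, by simpa only [hN, sSup_range] using hu⟩
  choose N hN using hseq
  obtain ⟨M, hM, hMN⟩ := exists_subdendriteFamily_ae_subset hne
    (N := fun i : ℕ × ℕ => (N i.1 i.2).1) fun i => (N i.1 i.2).2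
  refine ⟨M, hM, fun N' hN' n => ?_⟩
  refine (le_iSup (m n) ⟨N', hN'⟩).trans (le_of_tendsto' (hN n) fun k => measure_mono_ae ?_)
  filter_upwards [hMN] with s hs hsub
  exact (hs (n, k)).trans hsub

theorem exists_isMinimalFamily [IsFiniteMeasure μ] (hne : ¬ IsElementary μ σ) :
    ∃ M : Ω → NonemptyCompacts X, IsMinimalFamily μ σ M := by
  obtain ⟨M, hM, hmax⟩ := exists_subdendriteFamily_measure_le hne
  refine ⟨M, hM, fun N hN => ?_⟩
  obtain ⟨κ, hκ, hκsub⟩ := exists_subdendriteFamily_ae_subset hne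
    (N := fun b : Bool => cond b M N) (by rintro (_ | _) <;> assumption)
  have hnet : ∀ n, {s | (M s : Set X) ⊆ net X n} =ᵐ[μ] {s | (κ s : Set X) ⊆ net X n} := fun n => by
    refine ae_eq_of_ae_subset_of_measure_ge ?_ (hmax κ hκ n) (measurableSet_subset hM.measurable
      (isSubcontinuum_net n).isClosed).nullMeasurableSet (measure_ne_top _ _)
    filter_upwards [hκsub] with s hs hsub using (hs true).trans hsub
  filter_upwards [hκsub, ae_all_iff.2 fun n => Filter.eventuallyEq_set.1 (hnet n)] with s hs hnet
  have hMκ : (M s : Set X) ⊆ κ s := subset_of_forall_net (hκ.isSubcontinuum s) (κ s).nonempty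
    fun n hn => (hnet n).2 hn
  exact hMκ.trans (hs false)

end Minimal

section BoundaryMinimal

open Set

variable {Γ Ω B X : Type u} [Group Γ] [MeasurableSpace Ω] [MulAction Γ Ω] {μ : Measure Ω}
  [MeasurableSpace B] [MulAction Γ B] {ν : Measure B} [TopologicalSpace X]
  {σ : Γ → Ω → (X ≃ₜ X)} {M : Ω → NonemptyCompacts X} {K L : B × Ω → NonemptyCompacts X}

theorem IsBoundaryFamily.ae_subset_image_iff [SFinite μ] [SFinite ν]
    (hL : IsBoundaryFamily ν μ σ L) (γ : Γ) : ∀ᵐ s ∂μ, ∀ᵐ b ∂ν, ∀ D : Set X,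
      (L (γ • b, γ • s) : Set X) ⊆ σ γ s '' D ↔ (L (b, s) : Set X) ⊆ D := by
  filter_upwards [ae_ae_swap_of_ae_prod (hL.equivariant γ)] with s hs
  filter_upwards [hs] with b hb D
  rw [← image_subset_image_iff (σ γ s).injective (s := (L (b, s) : Set X)), ← coe_mapCL, ← hb]
  rfl

theorem IsBoundaryFamily.ae_ae_subset_iff [SFinite μ] [SFinite ν] (hL : IsBoundaryFamily ν μ σ L)
    (hν : ∀ γ : Γ, Measure.QuasiMeasurePreserving (fun b : B => γ • b) ν ν) (γ : Γ) :
    ∀ᵐ s ∂μ, ∀ D : Set X, (∀ᵐ b ∂ν, (L (b, s) : Set X) ⊆ D) ↔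
      ∀ᵐ b ∂ν, (L (b, γ • s) : Set X) ⊆ σ γ s '' D := by
  filter_upwards [hL.ae_subset_image_iff γ] with s hs D
  rw [← ae_smul_iff hν γ (p := fun b => (L (b, γ • s) : Set X) ⊆ σ γ s '' D)]
  exact Filter.eventually_congr (hs.mono fun b hb => (hb D).symm)

theorem IsBoundaryFamily.ae_frequently_subset_iff [SFinite μ] [SFinite ν]
    (hL : IsBoundaryFamily ν μ σ L)
    (hν : ∀ γ : Γ, Measure.QuasiMeasurePreserving (fun b : B => γ • b) ν ν) (γ : Γ) :
    ∀ᵐ s ∂μ, ∀ D : Set X, (∃ᶠ b in ae ν, (L (b, s) : Set X) ⊆ D) ↔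
      ∃ᶠ b in ae ν, (L (b, γ • s) : Set X) ⊆ σ γ s '' D := by
  filter_upwards [hL.ae_subset_image_iff γ] with s hs D
  refine not_congr ?_
  rw [← ae_smul_iff hν γ (p := fun b => ¬ (L (b, γ • s) : Set X) ⊆ σ γ s '' D)]
  exact Filter.eventually_congr (hs.mono fun b hb => not_congr (hb D).symm)

theorem IsBoundaryFamily.measurableSet_ae_subset [SFinite ν] (hL : IsBoundaryFamily ν μ σ L)
    {D : Set X} (hD : IsClosed D) : MeasurableSet {s | ∀ᵐ b ∂ν, (L (b, s) : Set X) ⊆ D} :=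
  measurableSet_setOf_ae (A := {p : Ω × B | (L (p.2, p.1) : Set X) ⊆ D})
    (measurableSet_subset (hL.measurable.comp measurable_swap) hD)

theorem IsBoundaryFamily.measurableSet_frequently_subset [SFinite ν]
    (hL : IsBoundaryFamily ν μ σ L) {D : Set X} (hD : IsClosed D) :
    MeasurableSet {s | ∃ᶠ b in ae ν, (L (b, s) : Set X) ⊆ D} :=
  (measurableSet_setOf_ae (A := {p : Ω × B | ¬ (L (p.2, p.1) : Set X) ⊆ D})
    (measurableSet_subset (hL.measurable.comp measurable_swap) hD).compl).compl

variable [CompactSpace X] [T2Space X] [SecondCountableTopology X] [PointSeparated X]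
  [ConnectedSpace X] [MeasurableConstSMul Γ Ω]

theorem IsMinimalFamily.ae_subset_core [SMulInvariantMeasure Γ Ω μ] (hM : IsMinimalFamily μ σ M)
    {P : Ω → Set X → Prop} (hmono : ∀ s, Monotone (P s)) (hP : ∀ᵐ s ∂μ, ¬ P s ∅)
    (hne : ∀ᵐ s ∂μ, (core (P s)).Nonempty) (hmeas : ∀ n, MeasurableSet {s | P s (net X n)})
    (heq : ∀ γ : Γ, ∀ᵐ s ∂μ, ∀ D, P s D ↔ P (γ • s) (σ γ s '' D)) :
    ∀ᵐ s ∂μ, (M s : Set X) ⊆ core (P s) := by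
  obtain ⟨κ, hκ, hκP⟩ := exists_subdendriteFamily_ae_eq_core hmono hP hne hmeas heq
  filter_upwards [hκP, hM.minimal κ hκ] with s hs hMs
  rwa [← hs]

variable [SMulInvariantMeasure Γ Ω μ] [SFinite μ] [SFinite ν]

theorem IsMinimalFamily.subset_of_ae_subset [NeZero ν]
    (hν : ∀ γ : Γ, Measure.QuasiMeasurePreserving (fun b : B => γ • b) ν ν)
    (hM : IsMinimalFamily μ σ M) (hL : IsBoundaryFamily ν μ σ L) :
    ∀ᵐ s ∂μ, ∀ D : Set X, IsSubcontinuum D → (∀ᵐ b ∂ν, (L (b, s) : Set X) ⊆ D) →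
      (M s : Set X) ⊆ D := by
  have hcore := hM.ae_subset_core (P := fun s D => ∀ᵐ b ∂ν, (L (b, s) : Set X) ⊆ D)
    (fun s D E hDE hD => hD.mono fun b hb => hb.trans hDE)
    (ae_of_all _ fun s h => h.exists.elim fun b => (L (b, s)).nonempty.not_subset_empty)
    (ae_of_all _ fun s => core_nonempty fun D E _ _ hD hE => by
      obtain ⟨b, hbD, hbE⟩ := (hD.and hE).exists
      exact (L (b, s)).nonempty.mono (subset_inter hbD hbE))
    (fun n => hL.measurableSet_ae_subset (isSubcontinuum_net n).isClosed)
    (hL.ae_ae_subset_iff hν)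
  filter_upwards [hcore] with s hs D hD hLD using hs.trans (core_subset hD hLD)

theorem IsMinimalFamily.subset_of_frequently_subset
    (hν : ∀ γ : Γ, Measure.QuasiMeasurePreserving (fun b : B => γ • b) ν ν)
    (hM : IsMinimalFamily μ σ M) (hL : IsBoundaryFamily ν μ σ L)
    (h : ∀ᵐ y ∂(ν.prod ν), ∀ᵐ s ∂μ, ¬ Disjoint (L (y.1, s) : Set X) (L (y.2, s))) :
    ∀ᵐ s ∂μ, ∀ D : Set X, IsSubcontinuum D → (∃ᶠ b in ae ν, (L (b, s) : Set X) ⊆ D) →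
      (M s : Set X) ⊆ D := by
  have hmeet : ∀ᵐ s ∂μ, ∀ᵐ b ∂ν, ∀ᵐ b' ∂ν, ¬ Disjoint (L (b, s) : Set X) (L (b', s)) := by
    have h' := (Measure.ae_prod_mem_iff_ae_ae_mem
      (measurableSet_disjoint_pair hL.measurable hL.measurable).compl).2 h
    filter_upwards [ae_ae_swap_of_ae_prod h'] with s hs using Measure.ae_ae_of_ae_prod hs
  have hcore := hM.ae_subset_core (P := fun s D => ∃ᶠ b in ae ν, (L (b, s) : Set X) ⊆ D)
    (fun s D E hDE hD => hD.mono fun b hb => hb.trans hDE)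
    (ae_of_all _ fun s h => h.exists.elim fun b => (L (b, s)).nonempty.not_subset_empty)
    (hmeet.mono fun s hs => core_nonempty fun D E _ _ hD hE => by
      obtain ⟨b, hbD, hb⟩ := (hD.and_eventually hs).exists
      obtain ⟨b', hbE, hbb'⟩ := (hE.and_eventually hb).exists
      exact (not_disjoint_iff_nonempty_inter.1 hbb').mono (inter_subset_inter hbD hbE))
    (fun n => hL.measurableSet_frequently_subset (isSubcontinuum_net n).isClosed)
    (hL.ae_frequently_subset_iff hν)
  filter_upwards [hcore] with s hs D hD hLD using hs.trans (core_subset hD hLD)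

theorem IsMinimalFamily.ae_subset_of_ae_not_disjoint
    (hν : ∀ γ : Γ, Measure.QuasiMeasurePreserving (fun b : B => γ • b) ν ν)
    (hM : IsMinimalFamily μ σ M) (hL : IsBoundaryFamily ν μ σ L)
    (h : ∀ᵐ y ∂(ν.prod ν), ∀ᵐ s ∂μ, ¬ Disjoint (L (y.1, s) : Set X) (L (y.2, s))) :
    ∀ᵐ w ∂(ν.prod μ), (M w.2 : Set X) ⊆ L w := by
  refine ae_prod_of_ae_ae_swap (A := {w | (M w.2 : Set X) ⊆ L w})
    (measurableSet_subset_subcontinuum (hM.measurable.comp measurable_snd) hL.measurable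
      hL.isSubcontinuum) ?_
  filter_upwards [hM.subset_of_frequently_subset hν hL h] with s hs
  have hnet : ∀ᵐ b ∂ν, ∀ n, (L (b, s) : Set X) ⊆ net X n → (M s : Set X) ⊆ net X n :=
    ae_all_iff.2 fun n => by
      by_cases hn : ∃ᶠ b in ae ν, (L (b, s) : Set X) ⊆ net X n
      · exact ae_of_all _ fun _ _ => hs _ (isSubcontinuum_net n) hn
      · exact (Filter.not_frequently.1 hn).mono fun b hb hb' => absurd hb' hb
  filter_upwards [hnet] with b hb
  exact subset_of_forall_net (hL.isSubcontinuum _) (L (b, s)).nonempty hb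

end BoundaryMinimal

section Sides

open Set

variable {Γ Ω B X : Type u} [Group Γ] [MeasurableSpace Ω] [StandardBorelSpace Ω] [MulAction Γ Ω]
  [MeasurableConstSMul Γ Ω] {μ : Measure Ω} [IsProbabilityMeasure μ] [SMulInvariantMeasure Γ Ω μ]
  [MeasurableSpace B] [MulAction Γ B] {ν : Measure B} [SigmaFinite ν] [NeZero ν]
  [TopologicalSpace X] [CompactSpace X] [T2Space X] [SecondCountableTopology X]
  [PointSeparated X] [ConnectedSpace X] {σ : Γ → Ω → (X ≃ₜ X)}
  {M : Ω → NonemptyCompacts X} {K L : B × Ω → NonemptyCompacts X}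

theorem ae_exists_core_gatePred_eq_gate (hB : IsBoundary Γ ν) (hσ : IsVirtualDendroMorphism μ σ)
    (hK : IsBoundaryFamily ν μ σ K) (hL : IsBoundaryFamily ν μ σ L)
    (hdisj : ∀ᵐ y ∂(ν.prod ν), ∀ᵐ s ∂μ, Disjoint (K (y.1, s) : Set X) (L (y.2, s))) :
    ∀ᵐ w ∂(ν.prod μ), ∃ x ∉ (K w : Set X),
      (∀ᵐ b ∂ν, (L (b, w.2) : Set X) ⊆ closure (side (K w : Set X) x)) ∧
      core (GatePred (K w : Set X) fun D => ∀ᵐ b ∂ν, (L (b, w.2) : Set X) ⊆ D) =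
        gate (K w : Set X) {x} := by
  filter_upwards [ae_exists_sameSide hB hσ hK hL hdisj] with w ⟨x, hx, hside⟩
  have hLside : ∀ᵐ b ∂ν, (L (b, w.2) : Set X) ⊆ side (K w : Set X) x :=
    hside.mono fun b hb => hb.subset_side
  have hLclosure : ∀ᵐ b ∂ν, (L (b, w.2) : Set X) ⊆ closure (side (K w : Set X) x) :=
    hLside.mono fun b hb => hb.trans subset_closure
  refine ⟨x, hx, hLclosure, core_gatePred_eq (hK.isSubcontinuum w) (K w).nonempty hx hLclosure
    fun D hD => ?_⟩
  obtain ⟨b, hbD, hb⟩ := (hD.and hLside).exists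
  obtain ⟨y, hy⟩ := (L (b, w.2)).nonempty
  exact ⟨y, hbD hy, hb hy⟩

theorem IsMinimalFamily.ae_exists_subset_closure_side (hB : IsBoundary Γ ν)
    (hσ : IsVirtualDendroMorphism μ σ) (hM : IsMinimalFamily μ σ M)
    (hK : IsBoundaryFamily ν μ σ K) (hL : IsBoundaryFamily ν μ σ L)
    (hdisj : ∀ᵐ y ∂(ν.prod ν), ∀ᵐ s ∂μ, Disjoint (K (y.1, s) : Set X) (L (y.2, s))) :
    ∀ᵐ w ∂(ν.prod μ), ∃ x ∉ (K w : Set X), (M w.2 : Set X) ⊆ closure (side (K w : Set X) x) := by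
  filter_upwards [ae_exists_core_gatePred_eq_gate hB hσ hK hL hdisj,
    Measure.quasiMeasurePreserving_snd.ae (hM.subset_of_ae_subset hB.quasiInvariant hL)]
    with w ⟨x, hx, hLx, _⟩ hMw
  exact ⟨x, hx, hMw _ isSubcontinuum_closure_side hLx⟩

end Sides

/-! ### Furstenberg maps -/

section FurstenbergFamilies

open Set

variable {Γ Ω B X : Type u} [Group Γ] [MeasurableSpace Ω] [MulAction Γ Ω] {μ : Measure Ω}
  [MeasurableSpace B] [MulAction Γ B] {ν : Measure B} [TopologicalSpace X]
  {σ : Γ → Ω → (X ≃ₜ X)} {M N : Ω → NonemptyCompacts X} {φ ψ : B × Ω → X}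

theorem quasiMeasurePreserving_smul_prod [MeasurableConstSMul Γ Ω] [SMulInvariantMeasure Γ Ω μ]
    [SFinite μ] [SFinite ν]
    (hν : ∀ γ : Γ, Measure.QuasiMeasurePreserving (fun b : B => γ • b) ν ν) (γ : Γ) :
    Measure.QuasiMeasurePreserving (fun w : B × Ω => γ • w) (ν.prod μ) (ν.prod μ) :=
  QuasiMeasurePreserving.prodMap (hν γ) (measurePreserving_smul γ μ).quasiMeasurePreserving

theorem ae_of_ae_prod_snd [NeZero ν] [SFinite μ] {p : Ω → Prop}
    (h : ∀ᵐ w ∂(ν.prod μ), p w.2) : ∀ᵐ s ∂μ, p s :=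
  (Measure.ae_ae_of_ae_prod h).exists.choose_spec

theorem IsFurstenbergMap.congr [MeasurableConstSMul Γ Ω] [SMulInvariantMeasure Γ Ω μ]
    [SFinite μ] [SFinite ν] [MeasurableSpace X]
    (hν : ∀ γ : Γ, Measure.QuasiMeasurePreserving (fun b : B => γ • b) ν ν)
    (hφ : IsFurstenbergMap ν μ σ φ) (hψ : Measurable ψ) (h : ψ =ᵐ[ν.prod μ] φ) :
    IsFurstenbergMap ν μ σ ψ where
  measurable := hψ
  equivariant γ := by
    filter_upwards [hφ.equivariant γ, h, (quasiMeasurePreserving_smul_prod hν γ).ae h]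
      with w hφw hw hγw
    exact hγw.trans (hφw.trans (by rw [hw]))

theorem isElementary_of_ae_subsingleton [MeasurableConstSMul Γ Ω]
    [SMulInvariantMeasure Γ Ω μ] [Nonempty X] (hN : IsEquivariantFamily μ σ N)
    (h : ∀ᵐ s ∂μ, (N s : Set X).Subsingleton) : IsElementary μ σ := by
  refine isElementary_of_ae_pair hN ?_
  filter_upwards [h] with s hs
  obtain ⟨q, hq⟩ := exists_eq_singleton_iff_nonempty_subsingleton.2 ⟨(N s).nonempty, hs⟩
  exact ⟨q, q, by rw [hq, pair_eq_singleton]⟩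

variable [T2Space X]

theorem IsSubdendriteFamily.isBoundaryFamily (hM : IsSubdendriteFamily μ σ M) :
    IsBoundaryFamily ν μ σ fun w => M w.2 where
  measurable := hM.measurable.comp measurable_snd
  equivariant γ := Measure.quasiMeasurePreserving_snd.ae (hM.ae_eq_mapCL γ)
  isSubcontinuum w := hM.isSubcontinuum w.2

theorem measurableSet_subsingleton {Y : Type*} [MeasurableSpace Y] {K : Y → NonemptyCompacts X}
    (hK : Measurable K) : MeasurableSet {y | (K y : Set X).Subsingleton} := by
  have hset : {y | (K y : Set X).Subsingleton} =
      K ⁻¹' range fun x : X => ({x} : NonemptyCompacts X) := by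
    ext y
    simp only [mem_ofPred_eq, mem_preimage, mem_range, ← SetLike.coe_set_eq,
      NonemptyCompacts.coe_singleton, eq_comm (b := (K y : Set X)),
      exists_eq_singleton_iff_nonempty_subsingleton, (K y).nonempty, true_and]
  rw [hset]
  exact hK (NonemptyCompacts.isClosedEmbedding_singleton (α := X)).isClosed_range.measurableSet

theorem ae_nontrivial [MeasurableConstSMul Γ Ω] [ErgodicSMul Γ Ω μ] [Nonempty X]
    (hne : ¬ IsElementary μ σ) (hN : IsEquivariantFamily μ σ N) :
    ∀ᵐ s ∂μ, (N s : Set X).Nontrivial := by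
  have hconst := ErgodicSMul.aeconst_of_forall_preimage_smul_ae_eq (G := Γ) (μ := μ)
    (measurableSet_subsingleton hN.measurable) fun γ => by
      rw [Filter.eventuallyEq_set]
      filter_upwards [hN.equivariant γ] with s hs
      simp only [mem_preimage, mem_ofPred_eq, hs, (σ γ s).injective.subsingleton_image_iff]
  rcases Filter.eventuallyConst_set.1 hconst with h | h
  · exact absurd (isElementary_of_ae_subsingleton hN h) hne
  · exact h.mono fun s hs => not_subsingleton_iff.1 hs

variable [MeasurableSpace X] [BorelSpace X]

theorem IsFurstenbergMap.isBoundaryFamily (hφ : IsFurstenbergMap ν μ σ φ) :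
    IsBoundaryFamily ν μ σ fun w => {φ w} where
  measurable := measurable_singletonCL_iff.2 hφ.measurable
  equivariant γ := by
    filter_upwards [hφ.equivariant γ] with w hw
    rw [mapCL_singleton, ← hw]
    rfl
  isSubcontinuum w := by
    rw [NonemptyCompacts.coe_singleton]
    exact isSubcontinuum_singleton (φ w)

theorem IsBoundaryFamily.exists_furstenbergMap [MeasurableConstSMul Γ Ω]
    [SMulInvariantMeasure Γ Ω μ] [SFinite μ] [SFinite ν] [Nonempty X]
    {κ : B × Ω → NonemptyCompacts X} (hκ : IsBoundaryFamily ν μ σ κ)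
    (hν : ∀ γ : Γ, Measure.QuasiMeasurePreserving (fun b : B => γ • b) ν ν)
    (h : ∀ᵐ w ∂(ν.prod μ), ∃ q, (κ w : Set X) = {q}) :
    ∃ φ : B × Ω → X, IsFurstenbergMap ν μ σ φ := by
  obtain ⟨κ', hκ', hκ'range, hae⟩ := hκ.measurable.aemeasurable.exists_ae_eq_range_subset
    (t := range fun q : X => ({q} : NonemptyCompacts X))
    (h.mono fun w ⟨q, hq⟩ => ⟨q, SetLike.coe_injective (by simpa using hq.symm)⟩)
    (range_nonempty _)
  choose φ hφ using fun w => hκ'range (mem_range_self w)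
  refine ⟨φ, measurable_singletonCL_iff.1 (by simpa only [hφ] using hκ'), fun γ => ?_⟩
  filter_upwards [hae, (quasiMeasurePreserving_smul_prod hν γ).ae hae, hκ.equivariant γ]
    with w hw hγw heq
  rw [hw, hγw, ← hφ, ← hφ, mapCL_singleton] at heq
  exact NonemptyCompacts.isClosedEmbedding_singleton.injective heq

variable [CompactSpace X] [SecondCountableTopology X] [PointSeparated X] [ConnectedSpace X]

theorem IsFurstenbergMap.isBoundaryFamily_hull (hφ : IsFurstenbergMap ν μ σ φ)
    (hψ : IsFurstenbergMap ν μ σ ψ) :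
    IsBoundaryFamily ν μ σ fun w => hullCL (pairCL (φ w) (ψ w)) where
  measurable := measurable_hullCL.comp
    (continuous_pairCL.measurable.comp (hφ.measurable.prodMk hψ.measurable))
  equivariant γ := by
    filter_upwards [hφ.equivariant γ, hψ.equivariant γ] with w hφw hψw
    apply SetLike.coe_injective
    rw [coe_mapCL, coe_hullCL, coe_hullCL, image_hull, coe_pairCL, coe_pairCL, image_pair,
      ← hφw, ← hψw]
    rfl
  isSubcontinuum w := isSubcontinuum_hull _

variable [MeasurableConstSMul Γ Ω] [SMulInvariantMeasure Γ Ω μ]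

omit [MeasurableSpace X] [BorelSpace X] in
theorem exists_boundaryFamily_ae_eq_core [SFinite μ] [SFinite ν] {P : B × Ω → Set X → Prop}
    (hν : ∀ γ : Γ, Measure.QuasiMeasurePreserving (fun b : B => γ • b) ν ν)
    (hmono : ∀ w, Monotone (P w)) (hP : ∀ᵐ w ∂(ν.prod μ), ¬ P w ∅)
    (hne : ∀ᵐ w ∂(ν.prod μ), (core (P w)).Nonempty) (hmeas : ∀ n, MeasurableSet {w | P w (net X n)})
    (heq : ∀ γ : Γ, ∀ᵐ w ∂(ν.prod μ), ∀ D, P w D ↔ P (γ • w) (σ γ w.2 '' D)) :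
    ∃ κ : B × Ω → NonemptyCompacts X, IsBoundaryFamily ν μ σ κ ∧
      ∀ᵐ w ∂(ν.prod μ), (κ w : Set X) = core (P w) := by
  obtain ⟨κ, hκ, hκs, hκP, hκσ⟩ := exists_equivariant_ae_eq_core (c := fun γ w => σ γ w.2)
    (quasiMeasurePreserving_smul_prod hν) hmono hP hne hmeas heq
  exact ⟨κ, ⟨hκ, hκσ, hκs⟩, hκP⟩

end FurstenbergFamilies

section Furstenberg

open Set

variable {Γ Ω B X : Type u} [Group Γ] [MeasurableSpace Ω] [MulAction Γ Ω]
  [MeasurableConstSMul Γ Ω] {μ : Measure Ω} [IsProbabilityMeasure μ] [ErgodicSMul Γ Ω μ]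
  [StandardBorelSpace Ω] [MeasurableSpace B] [MulAction Γ B] {ν : Measure B} [SigmaFinite ν]
  [NeZero ν] [TopologicalSpace X] [CompactSpace X] [T2Space X] [SecondCountableTopology X]
  [PointSeparated X] [ConnectedSpace X] {σ : Γ → Ω → (X ≃ₜ X)} {M : Ω → NonemptyCompacts X}
  {φ ψ : B × Ω → X}

theorem IsMinimalFamily.ae_subsingleton_inter (hB : IsBoundary Γ ν)
    (hσ : IsVirtualDendroMorphism μ σ) (hM : IsMinimalFamily μ σ M)
    {K L : B × Ω → NonemptyCompacts X} (hK : IsBoundaryFamily ν μ σ K)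
    (hL : IsBoundaryFamily ν μ σ L)
    (hdisj : ∀ᵐ y ∂(ν.prod ν), ∀ᵐ s ∂μ, Disjoint (K (y.1, s) : Set X) (L (y.2, s))) :
    ∀ᵐ w ∂(ν.prod μ), ((K w : Set X) ∩ M w.2).Subsingleton := by
  filter_upwards [hM.ae_exists_subset_closure_side hB hσ hK hL hdisj] with w ⟨x, hx, hMx⟩
  refine Subsingleton.anti ?_ (inter_subset_inter_right _ hMx)
  rw [inter_closure_side (hK.isSubcontinuum w) (K w).nonempty hx]
  exact subsingleton_gate (hK.isSubcontinuum w) isPreconnected_singleton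
    (disjoint_singleton_right.2 hx)

variable [MeasurableSpace X] [BorelSpace X]

theorem IsFurstenbergMap.ae_mem (hB : IsBoundary Γ ν) (hσ : IsVirtualDendroMorphism μ σ)
    (hne : ¬ IsElementary μ σ) (hM : IsMinimalFamily μ σ M) (hφ : IsFurstenbergMap ν μ σ φ) :
    ∀ᵐ w ∂(ν.prod μ), φ w ∈ (M w.2 : Set X) := by
  have hK : IsBoundaryFamily ν μ σ fun w => M w.2 := hM.isBoundaryFamily
  have hL := hφ.isBoundaryFamily
  rcases ae_disjoint_or_ae_not_disjoint hB hK hL with h | h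
  · refine absurd (isElementary_of_ae_subsingleton hM.toIsEquivariantFamily ?_) hne
    refine ae_of_ae_prod_snd (ν := ν) ?_
    filter_upwards [hM.ae_subsingleton_inter hB hσ hK hL h] with w hw
    rwa [inter_self] at hw
  · have h' := (Measure.ae_prod_mem_iff_ae_ae_mem
      (measurableSet_disjoint_pair hK.measurable hL.measurable).compl).2 h
    have hae : ∀ᵐ s ∂μ, ∀ᵐ b ∂ν, φ (b, s) ∈ (M s : Set X) := by
      filter_upwards [ae_ae_swap_of_ae_prod h'] with s hs
      obtain ⟨b, hb⟩ := (Measure.ae_ae_of_ae_prod hs).exists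
      exact hb.mono fun b' hb' => by simpa using hb'
    have hmeas : MeasurableSet {w : B × Ω | φ w ∈ (M w.2 : Set X)} := by
      convert (measurableSet_disjoint hL.measurable hK.measurable).compl using 1
      ext w
      simp
    exact ae_prod_of_ae_ae_swap hmeas hae

theorem IsFurstenbergMap.ae_mem_ends (hB : IsBoundary Γ ν) (hσ : IsVirtualDendroMorphism μ σ)
    (hne : ¬ IsElementary μ σ) (hM : IsMinimalFamily μ σ M) (hφ : IsFurstenbergMap ν μ σ φ) :
    ∀ᵐ w ∂(ν.prod μ), φ w ∈ ends (M w.2 : Set X) := by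
  have hK := hφ.isBoundaryFamily
  have hnontriv := ae_nontrivial hne hM.toIsEquivariantFamily
  rcases ae_disjoint_or_ae_not_disjoint hB hK hK with h | h
  · filter_upwards [hM.ae_exists_subset_closure_side hB hσ hK hK h, hφ.ae_mem hB hσ hne hM,
      Measure.quasiMeasurePreserving_snd.ae hnontriv] with w ⟨x, _, hMx⟩ hmem hw
    rw [NonemptyCompacts.coe_singleton] at hMx
    have hside : ∀ y ∈ (M w.2 : Set X), y ≠ φ w → SameSide {φ w} {x} {y} := fun y hy hyφ =>
      mem_side_of_mem_closure isClosed_singleton (hMx hy) hyφ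
    obtain ⟨y, hy, hyφ⟩ := hw.exists_ne (φ w)
    exact mem_ends_of_sameSide (hM.isSubcontinuum _) hmem ⟨y, hy, hyφ⟩ fun y hy z hz hyφ hzφ =>
      (hside y hy hyφ).symm.trans (singleton_nonempty x) (hside z hz hzφ)
  · refine absurd (isElementary_of_ae_subsingleton hM.toIsEquivariantFamily ?_) hne
    refine ae_of_ae_prod_snd (ν := ν) ?_
    filter_upwards [hM.ae_subset_of_ae_not_disjoint hB.quasiInvariant hK h] with w hw
    rw [NonemptyCompacts.coe_singleton] at hw
    exact subsingleton_singleton.anti hw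

theorem IsFurstenbergMap.ae_eq (hB : IsBoundary Γ ν) (hσ : IsVirtualDendroMorphism μ σ)
    (hne : ¬ IsElementary μ σ) (hM : IsMinimalFamily μ σ M) (hφ : IsFurstenbergMap ν μ σ φ)
    (hψ : IsFurstenbergMap ν μ σ ψ) : ψ =ᵐ[ν.prod μ] φ := by
  have hK := hφ.isBoundaryFamily_hull hψ
  have hφM := hφ.ae_mem hB hσ hne hM
  have hψM := hψ.ae_mem hB hσ hne hM
  rcases ae_disjoint_or_ae_not_disjoint hB hK hK with h | h
  · filter_upwards [hM.ae_subsingleton_inter hB hσ hK hK h, hφM, hψM] with w hw hφw hψw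
    rw [coe_hullCL, coe_pairCL] at hw
    exact hw ⟨right_mem_hull_pair, hψw⟩ ⟨left_mem_hull_pair, hφw⟩
  · refine absurd (isElementary_of_ae_hull hM.toIsEquivariantFamily ?_) hne
    refine ae_of_ae_prod_snd (ν := ν) ?_
    filter_upwards [hM.ae_subset_of_ae_not_disjoint hB.quasiInvariant hK h, hφM, hψM]
      with w hw hφw hψw
    rw [coe_hullCL, coe_pairCL] at hw
    exact ⟨φ w, ψ w, hw.antisymm (hull_pair_subset (hM.isSubcontinuum _) hφw hψw)⟩

theorem IsFurstenbergMap.exists_forall_mem_ends (hB : IsBoundary Γ ν)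
    (hσ : IsVirtualDendroMorphism μ σ) (hne : ¬ IsElementary μ σ) (hM : IsMinimalFamily μ σ M)
    (hφ : IsFurstenbergMap ν μ σ φ) : ∃ ψ : B × Ω → X, IsFurstenbergMap ν μ σ ψ ∧
      ∀ᵐ s ∂μ, ∀ b : B, ψ (b, s) ∈ ends (M s : Set X) := by
  classical
  obtain ⟨T, hT, hTm, hTnull⟩ := exists_measurable_superset_of_null (hφ.ae_mem_ends hB hσ hne hM)
  have hTae : ∀ᵐ w ∂(ν.prod μ), w ∉ T := measure_eq_zero_iff_ae_notMem.1 hTnull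
  have hends : ∀ w ∉ T, φ w ∈ ends (M w.2 : Set X) := fun w hw => of_not_not fun h => hw (hT h)
  obtain ⟨b₀, hb₀⟩ := (Measure.ae_ae_of_ae_prod hTae).exists
  refine ⟨fun w => if w ∈ T then φ (b₀, w.2) else φ w, hφ.congr hB.quasiInvariant ?_ ?_, ?_⟩
  · exact Measurable.ite hTm (hφ.measurable.comp (by fun_prop)) hφ.measurable
  · exact hTae.mono fun w hw => if_neg hw
  · filter_upwards [hb₀] with s hs b
    by_cases h : (b, s) ∈ T
    · simpa only [if_pos h] using hends _ hs
    · simpa only [if_neg h] using hends _ h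

end Furstenberg

section Measures

open Set

theorem inter_nonempty_of_half_lt {X : Type*} [MeasurableSpace X] {m : Measure X}
    [IsProbabilityMeasure m] {D E : Set X} (hE : MeasurableSet E) (hmD : 1 / 2 < m D)
    (hmE : 1 / 2 < m E) : (D ∩ E).Nonempty := by
  refine nonempty_inter_of_measure_lt_add m hE (subset_univ D) (subset_univ E) ?_
  rw [measure_univ, ← ENNReal.add_halves 1]
  exact ENNReal.add_lt_add hmD hmE

theorem not_disjoint_of_half_le {X : Type*} [MeasurableSpace X] {m : Measure X}
    [IsProbabilityMeasure m] {D E F : Set X} (hE : MeasurableSet E) (hF : MeasurableSet F)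
    (hmD : 1 / 2 ≤ m D) (hmE : 1 / 2 ≤ m E) (hmF : 1 / 2 ≤ m F) (hDE : Disjoint D E)
    (hDF : Disjoint D F) : ¬ Disjoint E F := by
  intro hEF
  have hsum : m (D ∪ E ∪ F) = m D + m E + m F := by
    rw [measure_union (disjoint_union_left.2 ⟨hDF, hEF⟩) hF, measure_union hDE hE]
  have hle : (1 : ENNReal) + 1 / 2 ≤ 1 := calc
    (1 : ENNReal) + 1 / 2 = 1 / 2 + 1 / 2 + 1 / 2 := by rw [ENNReal.add_halves]
    _ ≤ m D + m E + m F := by gcongr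
    _ = m (D ∪ E ∪ F) := hsum.symm
    _ ≤ 1 := prob_le_one
  exact hle.not_gt (ENNReal.lt_add_right ENNReal.one_ne_top (by simp))

variable {X : Type*} [TopologicalSpace X]

theorem disjoint_of_mem_hull_pair {D E : Set X} {x y p : X} (hD : IsSubcontinuum D)
    (hE : IsSubcontinuum E) (hx : x ∈ D) (hy : y ∈ E) (hpD : p ∉ D) (hpE : p ∉ E)
    (hp : p ∈ hull {x, y}) : Disjoint D E := by
  rw [disjoint_iff_inter_eq_empty, ← not_nonempty_iff_eq_empty]
  exact fun hDE => (hull_pair_subset (hD.union hE hDE) (Or.inl hx) (Or.inr hy) hp).elim hpD hpE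

variable [PointSeparated X] [ConnectedSpace X] [MeasurableSpace X] {m : Measure X}
  [IsProbabilityMeasure m]

theorem exists_subcontinuum_half_le {x p : X} (hx : x ∈ core fun D : Set X => 1 / 2 < m D)
    (hxp : x ≠ p) : ∃ D : Set X, IsSubcontinuum D ∧ x ∈ D ∧ p ∉ D ∧ 1 / 2 ≤ m D := by
  obtain ⟨z, U, V, hcut, hxU, hpV⟩ := PointSeparated.exists_isCut x p hxp
  refine ⟨insert z U, hcut.isSubcontinuum_insert, Or.inr hxU, hcut.notMem_insert hpV, ?_⟩
  have hmV : m (insert z V) ≤ 1 / 2 := le_of_not_gt fun h =>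
    hcut.symm.notMem_insert hxU (hx _ ⟨hcut.symm.isSubcontinuum_insert, h⟩)
  have hmU : 1 ≤ m (insert z U) + 1 / 2 := calc
    1 = m (insert z U ∪ insert z V) := by
      rw [hcut.insert_eq_compl, compl_subset_iff_union.1 (by simp), measure_univ]
    _ ≤ m (insert z U) + m (insert z V) := measure_union_le _ _
    _ ≤ m (insert z U) + 1 / 2 := by gcongr
  exact (ENNReal.add_le_add_iff_right (a := 1 / 2) (by simp)).1 (by rwa [ENNReal.add_halves])

variable [CompactSpace X] [T2Space X] [BorelSpace X]

theorem core_half_lt_nonempty : (core fun D : Set X => 1 / 2 < m D).Nonempty :=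
  core_nonempty fun _ _ _ hE hmD hmE =>
    inter_nonempty_of_half_lt hE.isClosed.measurableSet hmD hmE

theorem exists_eq_hull_pair_of_subset_core {D : Set X} (hD : IsSubcontinuum D)
    (hne : D.Nonempty) (h : D ⊆ core fun E : Set X => 1 / 2 < m E) : ∃ x y, D = hull {x, y} := by
  refine exists_eq_hull_pair hD hne fun x hx y hy z hz p hxy hyz hxz => ?_
  by_contra! ⟨hxp, hyp, hzp⟩
  obtain ⟨E, hE, hxE, hpE, hmE⟩ := exists_subcontinuum_half_le (h hx) hxp.symm
  obtain ⟨F, hF, hyF, hpF, hmF⟩ := exists_subcontinuum_half_le (h hy) hyp.symm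
  obtain ⟨G, hG, hzG, hpG, hmG⟩ := exists_subcontinuum_half_le (h hz) hzp.symm
  exact not_disjoint_of_half_le hF.isClosed.measurableSet hG.isClosed.measurableSet hmE hmF hmG
    (disjoint_of_mem_hull_pair hE hF hxE hyF hpE hpF hxy)
    (disjoint_of_mem_hull_pair hE hG hxE hzG hpE hpG hxz)
    (disjoint_of_mem_hull_pair hF hG hyF hzG hpF hpG hyz)

end Measures

section FurstenbergOfMeasures

open Set

variable {Γ Ω B X : Type u} [Group Γ] [MeasurableSpace Ω] [MulAction Γ Ω]
  [MeasurableConstSMul Γ Ω] {μ : Measure Ω} [IsProbabilityMeasure μ]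
  [MeasurableSpace B] [MulAction Γ B] {ν : Measure B} [SigmaFinite ν]
  [TopologicalSpace X] [CompactSpace X] [T2Space X] [SecondCountableTopology X]
  [PointSeparated X] [ConnectedSpace X] [MeasurableSpace X] [BorelSpace X]
  {σ : Γ → Ω → (X ≃ₜ X)} {M : Ω → NonemptyCompacts X}

theorem exists_boundaryFamily_ae_eq_core_half_lt [SMulInvariantMeasure Γ Ω μ]
    (hν : ∀ γ : Γ, Measure.QuasiMeasurePreserving (fun b : B => γ • b) ν ν)
    {m : B × Ω → Measure X} (hm : Measurable m) (hprob : ∀ w, IsProbabilityMeasure (m w))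
    (heq : ∀ γ : Γ, ∀ᵐ w ∂(ν.prod μ), m (γ • w) = (m w).map (σ γ w.2)) :
    ∃ J : B × Ω → NonemptyCompacts X, IsBoundaryFamily ν μ σ J ∧
      ∀ᵐ w ∂(ν.prod μ), (J w : Set X) = core fun D => 1 / 2 < m w D := by
  refine exists_boundaryFamily_ae_eq_core hν
    (fun w D E hDE (hD : 1 / 2 < m w D) => hD.trans_le (measure_mono hDE))
    (ae_of_all _ fun w => by simp) (ae_of_all _ fun w => core_half_lt_nonempty)
    (fun n => measurableSet_lt measurable_const
      ((Measure.measurable_coe (isSubcontinuum_net n).isClosed.measurableSet).comp hm))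
    fun γ => ?_
  filter_upwards [heq γ] with w hw D
  rw [hw, ← (σ γ w.2).toMeasurableEquiv_coe, MeasurableEquiv.map_apply,
    preimage_image_eq _ (σ γ w.2).toMeasurableEquiv.injective]

variable [StandardBorelSpace Ω] [NeZero ν]

/- The gate of `K (b, s)` towards almost every `L (b', s)` is a single point, which depends
equivariantly on `(b, s)`. -/
theorem exists_furstenbergMap_of_ae_disjoint [SMulInvariantMeasure Γ Ω μ] (hB : IsBoundary Γ ν)
    (hσ : IsVirtualDendroMorphism μ σ) {K L : B × Ω → NonemptyCompacts X}
    (hK : IsBoundaryFamily ν μ σ K) (hL : IsBoundaryFamily ν μ σ L)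
    (hdisj : ∀ᵐ y ∂(ν.prod ν), ∀ᵐ s ∂μ, Disjoint (K (y.1, s) : Set X) (L (y.2, s))) :
    ∃ φ : B × Ω → X, IsFurstenbergMap ν μ σ φ := by
  have hgate : ∀ᵐ w ∂(ν.prod μ), ∃ q,
      core (GatePred (K w : Set X) fun D => ∀ᵐ b ∂ν, (L (b, w.2) : Set X) ⊆ D) = {q} := by
    filter_upwards [ae_exists_core_gatePred_eq_gate hB hσ hK hL hdisj] with w ⟨x, hx, _, hw⟩
    rw [hw]
    exact exists_gate_eq_singleton (hK.isSubcontinuum w) (K w).nonempty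
      isPreconnected_singleton (singleton_nonempty x) (disjoint_singleton_right.2 hx)
  obtain ⟨κ, hκ, hκcore⟩ := exists_boundaryFamily_ae_eq_core (σ := σ) (μ := μ)
    (P := fun w => GatePred (K w : Set X) fun D => ∀ᵐ b ∂ν, (L (b, w.2) : Set X) ⊆ D)
    hB.quasiInvariant
    (fun w => monotone_gatePred fun D E hDE hD => hD.mono fun b hb => hb.trans hDE)
    (ae_of_all _ fun w => not_gatePred_empty (K w).nonempty)
    (hgate.mono fun w ⟨q, hq⟩ => hq ▸ singleton_nonempty q)
    (fun n => measurableSet_gatePred hK.measurable (isSubcontinuum_net n).isClosed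
      (measurable_snd (hL.measurableSet_ae_subset (isSubcontinuum_net n).isClosed)))
    fun γ => by
      filter_upwards [hK.equivariant γ, Measure.quasiMeasurePreserving_snd.ae
        (hL.ae_ae_subset_iff hB.quasiInvariant γ)] with w hKw hLw D
      rw [hKw, coe_mapCL]
      exact gatePred_image_iff (σ γ w.2) (hLw D)
  refine hκ.exists_furstenbergMap hB.quasiInvariant ?_
  filter_upwards [hκcore, hgate] with w hw ⟨q, hq⟩ using ⟨q, hw.trans hq⟩

theorem exists_furstenbergMap_of_measure [ErgodicSMul Γ Ω μ] (hB : IsBoundary Γ ν)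
    (hσ : IsVirtualDendroMorphism μ σ) (hne : ¬ IsElementary μ σ) (hM : IsMinimalFamily μ σ M)
    {m : B × Ω → Measure X} (hm : Measurable m) (hprob : ∀ w, IsProbabilityMeasure (m w))
    (heq : ∀ γ : Γ, ∀ᵐ w ∂(ν.prod μ), m (γ • w) = (m w).map (σ γ w.2)) :
    ∃ φ : B × Ω → X, IsFurstenbergMap ν μ σ φ := by
  obtain ⟨J, hJ, hJcore⟩ :=
    exists_boundaryFamily_ae_eq_core_half_lt hB.quasiInvariant hm hprob heq
  rcases ae_disjoint_or_ae_not_disjoint hB hJ hJ with h | h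
  · exact exists_furstenbergMap_of_ae_disjoint hB hσ hJ hJ h
  · refine absurd (isElementary_of_ae_hull hM.toIsEquivariantFamily ?_) hne
    refine ae_of_ae_prod_snd (ν := ν) ?_
    filter_upwards [hM.ae_subset_of_ae_not_disjoint hB.quasiInvariant hJ h, hJcore] with w hMw hw
    exact exists_eq_hull_pair_of_subset_core (hM.isSubcontinuum _) (M w.2).nonempty (hw ▸ hMw)

end FurstenbergOfMeasures

/-! ### States on integrable families of continuous functions -/

section Transport

open Set

variable {Γ Ω X : Type u} [Group Γ] [MulAction Γ Ω] [TopologicalSpace X] {σ : Γ → Ω → (X ≃ₜ X)}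

/-- The action of `Γ` on families `F : Ω → C(X, ℝ)`, through which a cocycle acts isometrically on
the separable Banach space `L¹(Ω, C(X))`; the inverses make it a left action. -/
def transport (σ : Γ → Ω → (X ≃ₜ X)) (γ : Γ) (F : Ω → C(X, ℝ)) (s : Ω) : C(X, ℝ) :=
  (F (γ⁻¹ • s)).comp (σ γ⁻¹ s : C(X, X))

theorem transport_apply (γ : Γ) (F : Ω → C(X, ℝ)) (s : Ω) (x : X) :
    transport σ γ F s x = F (γ⁻¹ • s) (σ γ⁻¹ s x) := rfl

theorem norm_transport [CompactSpace X] (γ : Γ) (F : Ω → C(X, ℝ)) (s : Ω) :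
    ‖transport σ γ F s‖ = ‖F (γ⁻¹ • s)‖ := by
  simp only [ContinuousMap.norm_eq_iSup_norm, transport_apply]
  exact (σ γ⁻¹ s).surjective.iSup_comp fun y => ‖F (γ⁻¹ • s) y‖

variable [MeasurableSpace Ω] [MeasurableConstSMul Γ Ω] {μ : Measure Ω}
  [SMulInvariantMeasure Γ Ω μ]

theorem transport_congr {F G : Ω → C(X, ℝ)} (h : F =ᵐ[μ] G) (γ : Γ) :
    transport σ γ F =ᵐ[μ] transport σ γ G := by
  filter_upwards [(measurePreserving_smul γ⁻¹ μ).quasiMeasurePreserving.ae h] with s hs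
  simp only [transport, hs]

variable [CompactSpace X]

theorem eLpNorm_transport (γ : Γ) {F : Ω → C(X, ℝ)} (hF : AEStronglyMeasurable F μ) :
    eLpNorm (transport σ γ F) 1 μ = eLpNorm F 1 μ := by
  rw [eLpNorm_congr_norm_ae (g := F ∘ (γ⁻¹ • ·)) (ae_of_all _ fun s => norm_transport γ F s)]
  exact eLpNorm_comp_measurePreserving hF (measurePreserving_smul γ⁻¹ μ)

variable [T2Space X] [SecondCountableTopology X]

theorem aestronglyMeasurable_transport (hσ : IsVirtualDendroMorphism μ σ) (γ : Γ)
    {F : Ω → C(X, ℝ)} (hF : AEStronglyMeasurable F μ) :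
    AEStronglyMeasurable (transport σ γ F) μ := by
  let := metrizableSpaceMetric X
  borelize C(X, X)
  have := borelSpace_homeo (X := X)
  have hcoe : Continuous fun g : X ≃ₜ X => (g : C(X, X)) := continuous_induced_dom
  have hγ : AEStronglyMeasurable (fun s => (σ γ⁻¹ s : C(X, X))) μ :=
    (hcoe.measurable.comp (hσ.measurable γ⁻¹)).stronglyMeasurable.aestronglyMeasurable
  exact ContinuousMap.continuous_comp'.comp_aestronglyMeasurable (hγ.prodMk
    (hF.comp_quasiMeasurePreserving (measurePreserving_smul γ⁻¹ μ).quasiMeasurePreserving))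

theorem memLp_transport (hσ : IsVirtualDendroMorphism μ σ) (γ : Γ) {F : Ω → C(X, ℝ)}
    (hF : MemLp F 1 μ) : MemLp (transport σ γ F) 1 μ :=
  ⟨aestronglyMeasurable_transport hσ γ hF.1, (eLpNorm_transport γ hF.1).trans_lt hF.2⟩

/-- The action `transport` on classes of integrable families. -/
noncomputable def transportLp (hσ : IsVirtualDendroMorphism μ σ) (γ : Γ) (F : Lp C(X, ℝ) 1 μ) :
    Lp C(X, ℝ) 1 μ :=
  (memLp_transport hσ γ (Lp.memLp F)).toLp _

theorem coeFn_transportLp (hσ : IsVirtualDendroMorphism μ σ) (γ : Γ) (F : Lp C(X, ℝ) 1 μ) :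
    transportLp hσ γ F =ᵐ[μ] transport σ γ F :=
  MemLp.coeFn_toLp _

theorem transportLp_toLp (hσ : IsVirtualDendroMorphism μ σ) (γ : Γ) {F : Ω → C(X, ℝ)}
    (hF : MemLp F 1 μ) : transportLp hσ γ (hF.toLp F) = (memLp_transport hσ γ hF).toLp _ :=
  (MemLp.toLp_eq_toLp_iff _ _).2 (transport_congr hF.coeFn_toLp γ)

theorem transportLp_add (hσ : IsVirtualDendroMorphism μ σ) (γ : Γ) (F G : Lp C(X, ℝ) 1 μ) :
    transportLp hσ γ (F + G) = transportLp hσ γ F + transportLp hσ γ G := by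
  apply Lp.ext
  filter_upwards [coeFn_transportLp hσ γ (F + G), coeFn_transportLp hσ γ F,
    coeFn_transportLp hσ γ G, Lp.coeFn_add (transportLp hσ γ F) (transportLp hσ γ G),
    transport_congr (σ := σ) (Lp.coeFn_add F G) γ] with s hFG hF hG hadd hcongr
  rw [hFG, hadd, hcongr, Pi.add_apply, hF, hG]
  rfl

theorem transportLp_smul (hσ : IsVirtualDendroMorphism μ σ) (γ : Γ) (c : ℝ)
    (F : Lp C(X, ℝ) 1 μ) : transportLp hσ γ (c • F) = c • transportLp hσ γ F := by
  apply Lp.ext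
  filter_upwards [coeFn_transportLp hσ γ (c • F), coeFn_transportLp hσ γ F,
    Lp.coeFn_smul c (transportLp hσ γ F), transport_congr (σ := σ) (Lp.coeFn_smul c F) γ]
    with s hcF hF hsmul hcongr
  rw [hcF, hsmul, hcongr, Pi.smul_apply, hF]
  rfl

theorem norm_transportLp (hσ : IsVirtualDendroMorphism μ σ) (γ : Γ) (F : Lp C(X, ℝ) 1 μ) :
    ‖transportLp hσ γ F‖ = ‖F‖ := by
  rw [transportLp, Lp.norm_toLp, eLpNorm_transport γ (Lp.aestronglyMeasurable F), Lp.norm_def]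

theorem transportLp_mul (hσ : IsVirtualDendroMorphism μ σ) (γ₁ γ₂ : Γ) (F : Lp C(X, ℝ) 1 μ) :
    transportLp hσ (γ₁ * γ₂) F = transportLp hσ γ₁ (transportLp hσ γ₂ F) := by
  apply Lp.ext
  filter_upwards [coeFn_transportLp hσ (γ₁ * γ₂) F,
    coeFn_transportLp hσ γ₁ (transportLp hσ γ₂ F),
    transport_congr (σ := σ) (coeFn_transportLp hσ γ₂ F) γ₁, hσ.cocycle γ₂⁻¹ γ₁⁻¹]
    with s hmul hγ₁ hγ₂ hcocycle
  rw [hmul, hγ₁, hγ₂]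
  ext x
  simp only [transport_apply, mul_inv_rev, mul_smul, hcocycle]
  rfl

theorem transportLp_one (hσ : IsVirtualDendroMorphism μ σ) (F : Lp C(X, ℝ) 1 μ) :
    transportLp hσ 1 F = F := by
  apply Lp.ext
  filter_upwards [coeFn_transportLp hσ 1 F, hσ.ae_one] with s hF hone
  rw [hF]
  ext x
  simp only [transport_apply, inv_one, one_smul, hone]
  rfl

/-- `transportLp` as a linear isometry of `L¹(Ω, C(X))`. -/
noncomputable def transportIsometry (hσ : IsVirtualDendroMorphism μ σ) (γ : Γ) :
    Lp C(X, ℝ) 1 μ ≃ₗᵢ[ℝ] Lp C(X, ℝ) 1 μ where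
  toFun := transportLp hσ γ
  invFun := transportLp hσ γ⁻¹
  map_add' := transportLp_add hσ γ
  map_smul' := transportLp_smul hσ γ
  left_inv F := by rw [← transportLp_mul, inv_mul_cancel, transportLp_one]
  right_inv F := by rw [← transportLp_mul, mul_inv_cancel, transportLp_one]
  norm_map' := norm_transportLp hσ γ

end Transport

section States

open Set

variable {Ω X : Type u} [MeasurableSpace Ω] {μ : Measure Ω} [TopologicalSpace X] [CompactSpace X]

/-- The constant family `1` in `L¹(Ω, C(X))`. -/
noncomputable def oneLp (μ : Measure Ω) [IsFiniteMeasure μ] (X : Type u) [TopologicalSpace X]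
    [CompactSpace X] : Lp C(X, ℝ) 1 μ :=
  (memLp_const (1 : C(X, ℝ))).toLp _

theorem norm_oneLp [IsProbabilityMeasure μ] [Nonempty X] : ‖oneLp μ X‖ = 1 := by
  rw [oneLp, Lp.norm_toLp, eLpNorm_const _ one_ne_zero (IsProbabilityMeasure.ne_zero μ)]
  simp

/-- The states on `L¹(Ω, C(X))`: the functionals of norm at most one which are `1` at the constant
family `1`. Such a functional is a field of probability measures on `X` over `Ω`. -/
def states (μ : Measure Ω) [IsFiniteMeasure μ] (X : Type u) [TopologicalSpace X]
    [CompactSpace X] : Set (WeakDual ℝ (Lp C(X, ℝ) 1 μ)) :=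
  {ξ | (∀ e, |ξ e| ≤ ‖e‖) ∧ ξ (oneLp μ X) = 1}

theorem states_nonempty [IsProbabilityMeasure μ] [Nonempty X] : (states μ X).Nonempty := by
  have hone : ‖oneLp μ X‖ ≠ 0 := norm_oneLp.trans_ne one_ne_zero
  obtain ⟨g, hg, hg_one⟩ := exists_dual_vector ℝ (oneLp μ X) hone
  exact ⟨StrongDual.toWeakDual g, fun e => (g.le_opNorm e).trans_eq (by rw [hg, one_mul]),
    hg_one.trans (by simp [norm_oneLp])⟩

variable [IsFiniteMeasure μ]

theorem isClosed_states : IsClosed (states μ X) := by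
  have hstates : states μ X = (⋂ e, {ξ | |ξ e| ≤ ‖e‖}) ∩ {ξ | ξ (oneLp μ X) = 1} := by
    ext ξ
    simp [states]
  rw [hstates]
  exact (isClosed_iInter fun e =>
    isClosed_le (WeakDual.eval_continuous e).abs continuous_const).inter
      (isClosed_eq (WeakDual.eval_continuous _) continuous_const)

theorem isCompact_states : IsCompact (states μ X) := by
  refine (WeakDual.isCompact_closedBall 0 1).of_isClosed_subset isClosed_states fun ξ hξ => ?_
  rw [mem_preimage, mem_closedBall_zero_iff]
  exact ContinuousLinearMap.opNorm_le_bound _ zero_le_one fun e => (hξ.1 e).trans_eq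
    (one_mul _).symm

theorem convex_states : Convex ℝ (states μ X) := by
  intro ξ hξ ξ' hξ' a b ha hb hab
  refine ⟨fun e => ?_, ?_⟩
  · calc |a * ξ e + b * ξ' e| ≤ |a * ξ e| + |b * ξ' e| := abs_add_le _ _
      _ = a * |ξ e| + b * |ξ' e| := by rw [abs_mul, abs_mul, abs_of_nonneg ha, abs_of_nonneg hb]
      _ ≤ a * ‖e‖ + b * ‖e‖ := by gcongr; exacts [hξ.1 e, hξ'.1 e]
      _ = ‖e‖ := by rw [← add_mul, hab, one_mul]
  · change a * ξ _ + b * ξ' _ = 1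
    rw [hξ.2, hξ'.2, mul_one, mul_one, hab]

variable {Γ B : Type u} [Group Γ] [MulAction Γ Ω] [MeasurableConstSMul Γ Ω]
  [SMulInvariantMeasure Γ Ω μ] [T2Space X] [SecondCountableTopology X] {σ : Γ → Ω → (X ≃ₜ X)}

theorem transportLp_oneLp (hσ : IsVirtualDendroMorphism μ σ) (γ : Γ) :
    transportLp hσ γ (oneLp μ X) = oneLp μ X := by
  rw [oneLp, transportLp_toLp]
  rfl

theorem mem_states_iff_of_forall_transportIsometry (hσ : IsVirtualDendroMorphism μ σ) (γ : Γ)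
    {f g : WeakDual ℝ (Lp C(X, ℝ) 1 μ)} (hfg : ∀ e, g (transportIsometry hσ γ e) = f e) :
    f ∈ states μ X ↔ g ∈ states μ X := by
  have hone : transportIsometry hσ γ (oneLp μ X) = oneLp μ X := transportLp_oneLp hσ γ
  refine and_congr ?_ (by rw [← hfg, hone])
  rw [(transportIsometry hσ γ).surjective.forall (p := fun e => |g e| ≤ ‖e‖)]
  simp only [hfg, LinearIsometryEquiv.norm_map]

theorem exists_equivariant_states [IsProbabilityMeasure μ] [Nonempty X]
    [MeasurableSpace.CountablyGenerated Ω] [MeasurableSpace B] [MulAction Γ B] {ν : Measure B}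
    (hν : ∀ γ : Γ, Measure.QuasiMeasurePreserving (fun b : B => γ • b) ν ν)
    (hamen : IsZimmerAmenable Γ ν) (hσ : IsVirtualDendroMorphism μ σ) :
    ∃ ξ : B → WeakDual ℝ (Lp C(X, ℝ) 1 μ), (∀ e, Measurable fun b => ξ b e) ∧
      (∀ b, ξ b ∈ states μ X) ∧
      ∀ γ : Γ, ∀ᵐ b ∂ν, ∀ e, ξ (γ • b) (transportLp hσ γ e) = ξ b e := by
  have : Fact ((1 : ENNReal) ≠ ⊤) := ⟨ENNReal.one_ne_top⟩
  borelize (WeakDual ℝ (Lp C(X, ℝ) 1 μ))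
  obtain ⟨ξ, hξ, hξstates, hξσ⟩ := hamen (Lp C(X, ℝ) 1 μ) (fun γ _ => transportIsometry hσ γ)
    (fun _ => states μ X) (fun _ _ => measurable_const)
    (fun γ₁ γ₂ => ae_of_all _ fun _ => by ext1 F; exact transportLp_mul hσ γ₁ γ₂ F)
    (fun _ => ⟨states_nonempty, isCompact_states, convex_states, fun _ hf => hf.1⟩)
    (measurable_snd isClosed_states.measurableSet)
    (fun γ => ae_of_all _ fun _ _ _ hfg => mem_states_iff_of_forall_transportIsometry hσ γ hfg)
  obtain ⟨ξ', hξ', hξ'range, hae⟩ :=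
    hξ.aemeasurable.exists_ae_eq_range_subset hξstates states_nonempty
  refine ⟨ξ', fun e => (WeakDual.eval_continuous e).measurable.comp hξ',
    fun b => hξ'range (mem_range_self b), fun γ => ?_⟩
  filter_upwards [hξσ γ, hae, (hν γ).ae hae] with b hσb hb hγb e
  rw [← hb, ← hγb]
  exact hσb e

end States

/-! ### Representation of states by measures -/

section PositiveFunctionals

open Set

theorem exists_measure_of_positive {Z : Type*} [TopologicalSpace Z] [CompactSpace Z] [T2Space Z]
    [MeasurableSpace Z] [BorelSpace Z] (Λ : C(Z, ℝ) →ₗ[ℝ] ℝ)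
    (hΛ : ∀ f : C(Z, ℝ), (∀ z, 0 ≤ f z) → 0 ≤ Λ f) :
    ∃ ρ : Measure Z, IsFiniteMeasure ρ ∧ ∀ f : C(Z, ℝ), ∫ z, f z ∂ρ = Λ f := by
  let restrict : CompactlySupportedContinuousMap Z ℝ →ₗ[ℝ] ℝ :=
    { toFun f := Λ f.toContinuousMap
      map_add' f g := Λ.map_add f.toContinuousMap g.toContinuousMap
      map_smul' c f := Λ.map_smul c f.toContinuousMap }
  let Λ' : CompactlySupportedContinuousMap Z ℝ →ₚ[ℝ] ℝ :=
    PositiveLinearMap.mk₀ restrict fun f hf => hΛ _ fun z => hf z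
  exact ⟨RealRMK.rieszMeasure Λ', inferInstance, fun f =>
    RealRMK.integral_rieszMeasure Λ' (CompactlySupportedContinuousMap.continuousMapEquiv f)⟩

theorem exists_map_prodMap_eq {Ω T X : Type*} [MeasurableSpace Ω] [MeasurableSpace T]
    [MeasurableSpace X] {μ : Measure Ω} {e : Ω → T} (he : MeasurableEmbedding e)
    {ρ : Measure (T × X)} (hρ : ρ.fst = μ.map e) :
    ∃ η : Measure (Ω × X), η.fst = μ ∧ η.map (Prod.map e id) = ρ := by
  have hj : MeasurableEmbedding (Prod.map e id : Ω × X → T × X) :=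
    he.prodMap MeasurableEmbedding.id
  have hrange : ∀ᵐ z ∂ρ, z ∈ range (Prod.map e id : Ω × X → T × X) := by
    have hfst : ∀ᵐ t ∂ρ.fst, t ∈ range e := by
      rw [hρ, he.ae_map_iff]
      exact ae_of_all _ mem_range_self
    filter_upwards [ae_of_ae_map measurable_fst.aemeasurable hfst] with z ⟨s, hs⟩
    exact ⟨(s, z.2), Prod.ext hs rfl⟩
  have hmap : (ρ.comap (Prod.map e id)).map (Prod.map e id) = ρ := by
    rw [hj.map_comap, Measure.restrict_eq_self_of_ae_mem hrange]
  refine ⟨ρ.comap (Prod.map e id), ?_, hmap⟩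
  have hfst : (ρ.comap (Prod.map e id)).fst.map e = μ.map e := by
    rw [← hρ, Measure.fst, Measure.fst, Measure.map_map he.measurable measurable_fst]
    conv_rhs => rw [← hmap, Measure.map_map measurable_fst hj.measurable]
    rfl
  rw [← he.comap_map (ρ.comap (Prod.map e id)).fst, hfst, he.comap_map]

end PositiveFunctionals

section Representation

open Set

variable {Ω X : Type u} [MeasurableSpace Ω] {μ : Measure Ω} [TopologicalSpace X] [CompactSpace X]

theorem abs_state_le [IsFiniteMeasure μ] {ξ : WeakDual ℝ (Lp C(X, ℝ) 1 μ)} (hξ : ξ ∈ states μ X)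
    {F : Ω → C(X, ℝ)} (hF : Integrable F μ) : |ξ (hF.toL1 F)| ≤ ∫ s, ‖F s‖ ∂μ := by
  rw [← L1.norm_of_fun_eq_integral_norm hF]
  exact hξ.1 _

theorem integral_le_state [IsProbabilityMeasure μ] [Nonempty X]
    {ξ : WeakDual ℝ (Lp C(X, ℝ) 1 μ)} (hξ : ξ ∈ states μ X) {F : Ω → C(X, ℝ)}
    (hF : Integrable F μ) {a : Ω → ℝ} (ha : Integrable a μ) (haF : ∀ s x, a s ≤ F s x) {c : ℝ}
    (hFc : ∀ s x, F s x ≤ c) : ∫ s, a s ∂μ ≤ ξ (hF.toL1 F) := by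
  have hone := integrable_const (μ := μ) (1 : C(X, ℝ))
  have hnorm : ∀ s, ‖c • (1 : C(X, ℝ)) - F s‖ ≤ c - a s := fun s => by
    refine (ContinuousMap.norm_le_of_nonempty _).2 fun x => ?_
    have hx : (c • (1 : C(X, ℝ)) - F s) x = c - F s x := by simp
    rw [hx, Real.norm_of_nonneg (sub_nonneg.2 (hFc s x))]
    exact sub_le_sub_left (haF s x) c
  have hsub : c - ξ (hF.toL1 F) ≤ c - ∫ s, a s ∂μ := calc
    c - ξ (hF.toL1 F) = ξ (((hone.smul c).sub hF).toL1 _) := by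
      rw [Integrable.toL1_sub _ _ (hone.smul c) hF, Integrable.toL1_smul' _ hone, map_sub,
        map_smul, show hone.toL1 _ = oneLp μ X from rfl, hξ.2, smul_eq_mul, mul_one]
    _ ≤ ∫ s, ‖c • (1 : C(X, ℝ)) - F s‖ ∂μ :=
      (le_abs_self _).trans (abs_state_le hξ ((hone.smul c).sub hF))
    _ ≤ ∫ s, (c - a s) ∂μ :=
      integral_mono ((hone.smul c).sub hF).norm ((integrable_const c).sub ha) hnorm
    _ = c - ∫ s, a s ∂μ := by
      rw [integral_sub (integrable_const c) ha, integral_const, probReal_univ, one_smul]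
  exact (sub_le_sub_iff_left c).1 hsub

section Cantor

variable {e : Ω → (ℕ → Bool)}

theorem integrable_comp_continuous [IsFiniteMeasure μ] (he : Measurable e) {Y : Type*}
    [NormedAddCommGroup Y] (g : C(ℕ → Bool, Y)) : Integrable (fun s => g (e s)) μ :=
  (integrable_const ‖g‖).mono'
    (g.continuous.comp_aestronglyMeasurable he.aestronglyMeasurable)
    (ae_of_all _ fun _ => g.norm_coe_le_norm _)

/-- The functional on `C(2^ℕ × X)` obtained from a state and a coordinate `e : Ω → 2^ℕ`; it
reduces the representation of states to the Riesz representation theorem. -/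
noncomputable def stateFunctional [IsFiniteMeasure μ] (he : Measurable e)
    (ξ : WeakDual ℝ (Lp C(X, ℝ) 1 μ)) : C((ℕ → Bool) × X, ℝ) →ₗ[ℝ] ℝ where
  toFun f := ξ ((integrable_comp_continuous he f.curry).toL1 _)
  map_add' f g := by
    rw [← map_add, ← Integrable.toL1_add]
    rfl
  map_smul' c f := by
    rw [← map_smul, ← Integrable.toL1_smul]
    rfl

theorem stateFunctional_apply [IsFiniteMeasure μ] (he : Measurable e)
    (ξ : WeakDual ℝ (Lp C(X, ℝ) 1 μ)) (f : C((ℕ → Bool) × X, ℝ)) : stateFunctional he ξ f =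
      ξ ((integrable_comp_continuous he f.curry).toL1 fun s => f.curry (e s)) := rfl

variable [IsProbabilityMeasure μ] [Nonempty X]

theorem integral_le_stateFunctional (he : Measurable e) {ξ : WeakDual ℝ (Lp C(X, ℝ) 1 μ)}
    (hξ : ξ ∈ states μ X) {f : C((ℕ → Bool) × X, ℝ)} {k : C(ℕ → Bool, ℝ)}
    (hkf : ∀ z, k z.1 ≤ f z) : ∫ s, k (e s) ∂μ ≤ stateFunctional he ξ f :=
  integral_le_state hξ _ (integrable_comp_continuous he k) (fun s x => hkf (e s, x))
    fun _ _ => (le_abs_self _).trans (f.norm_coe_le_norm _)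

theorem stateFunctional_nonneg (he : Measurable e) {ξ : WeakDual ℝ (Lp C(X, ℝ) 1 μ)}
    (hξ : ξ ∈ states μ X) (f : C((ℕ → Bool) × X, ℝ)) (hf : ∀ z, 0 ≤ f z) :
    0 ≤ stateFunctional he ξ f := by
  simpa using integral_le_stateFunctional he hξ (k := 0) hf

theorem stateFunctional_comp_fst (he : Measurable e) {ξ : WeakDual ℝ (Lp C(X, ℝ) 1 μ)}
    (hξ : ξ ∈ states μ X) (k : C(ℕ → Bool, ℝ)) :
    stateFunctional he ξ (k.comp ContinuousMap.fst) = ∫ s, k (e s) ∂μ := by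
  have hneg := integral_le_stateFunctional he hξ (k := -k) (f := -(k.comp ContinuousMap.fst))
    fun _ => le_rfl
  simp only [map_neg, ContinuousMap.neg_apply, integral_neg, neg_le_neg_iff] at hneg
  exact hneg.antisymm (integral_le_stateFunctional he hξ fun _ => le_rfl)

variable [T2Space X] [SecondCountableTopology X] [MeasurableSpace X] [BorelSpace X]

theorem exists_measure_integral_eq_stateFunctional (he : MeasurableEmbedding e)
    {ξ : WeakDual ℝ (Lp C(X, ℝ) 1 μ)} (hξ : ξ ∈ states μ X) :
    ∃ ρ : Measure ((ℕ → Bool) × X), ρ.fst = μ.map e ∧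
      ∀ f : C((ℕ → Bool) × X, ℝ), ∫ z, f z ∂ρ = stateFunctional he.measurable ξ f := by
  obtain ⟨ρ, hρ, hrep⟩ := exists_measure_of_positive (stateFunctional he.measurable ξ)
    (stateFunctional_nonneg he.measurable hξ)
  refine ⟨ρ, ext_of_forall_integral_eq_of_IsFiniteMeasure fun k => ?_, hrep⟩
  rw [he.integral_map, Measure.fst, integral_map measurable_fst.aemeasurable
    k.continuous.aestronglyMeasurable]
  exact (hrep (k.toContinuousMap.comp ContinuousMap.fst)).trans
    (stateFunctional_comp_fst he.measurable hξ k.toContinuousMap)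

end Cantor

section Pairing

variable {e : Ω → (ℕ → Bool)} {F : Ω → C(X, ℝ)}

theorem exists_integral_norm_sub_curry_le [T2Space X] [IsFiniteMeasure μ]
    (he : MeasurableEmbedding e) (hF : Integrable F μ)
    {ε : ℝ} (hε : 0 < ε) :
    ∃ f : C((ℕ → Bool) × X, ℝ), ∫ s, ‖F s - f.curry (e s)‖ ∂μ ≤ ε := by
  borelize C(X, ℝ)
  obtain ⟨F', -, hFF'⟩ := hF.1
  let G : (ℕ → Bool) → C(X, ℝ) := Function.extend e F' 0
  have hGe : ∀ s, G (e s) = F' s := fun s => he.injective.extend_apply _ _ _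
  have hFG : ∀ᵐ s ∂μ, F s = G (e s) := hFF'.mono fun s hs => hs.trans (hGe s).symm
  have hG : Integrable G (μ.map e) := he.integrable_map_iff.2 (hF.congr hFG)
  obtain ⟨g, hg, -⟩ := hG.exists_boundedContinuous_integral_sub_le hε
  rw [he.integral_map] at hg
  refine ⟨ContinuousMap.uncurry g.toContinuousMap, (integral_congr_ae ?_).trans_le hg⟩
  filter_upwards [hFG] with s hs
  rw [hs]
  rfl

theorem abs_integral_pairing_le [MeasurableSpace X] {η : Measure (Ω × X)} (hη : η.fst = μ)
    (hF : Integrable F μ) : |∫ p, F p.1 p.2 ∂η| ≤ ∫ s, ‖F s‖ ∂μ := by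
  have hfst : MeasurePreserving Prod.fst η μ := ⟨measurable_fst, hη⟩
  calc |∫ p, F p.1 p.2 ∂η| ≤ ∫ p, ‖F p.1‖ ∂η :=
        norm_integral_le_of_norm_le (hfst.integrable_comp_of_integrable hF.norm)
          (ae_of_all _ fun p => (F p.1).norm_coe_le_norm _)
    _ = ∫ s, ‖F s‖ ∂μ := by
        subst hη
        exact (integral_map measurable_fst.aemeasurable hF.1.norm).symm

variable [T2Space X] [SecondCountableTopology X] [MeasurableSpace X] [BorelSpace X]
  {η : Measure (Ω × X)}

theorem integrable_pairing (hη : η.fst = μ) (hF : Integrable F μ) :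
    Integrable (fun p : Ω × X => F p.1 p.2) η := by
  have hfst : MeasurePreserving Prod.fst η μ := ⟨measurable_fst, hη⟩
  let := metrizableSpaceMetric X
  refine (hfst.integrable_comp_of_integrable hF.norm).mono' ?_
    (ae_of_all _ fun p => (F p.1).norm_coe_le_norm _)
  exact continuous_eval.comp_aestronglyMeasurable
    ((hF.1.comp_measurePreserving hfst).prodMk measurable_snd.aestronglyMeasurable)

variable [IsProbabilityMeasure μ]

theorem state_eq_integral_of_forall_continuousMap (he : MeasurableEmbedding e)
    {ξ : WeakDual ℝ (Lp C(X, ℝ) 1 μ)} (hξ : ξ ∈ states μ X) (hη : η.fst = μ)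
    (hcont : ∀ f : C((ℕ → Bool) × X, ℝ),
      stateFunctional he.measurable ξ f = ∫ p, f (e p.1, p.2) ∂η)
    (hF : Integrable F μ) : ξ (hF.toL1 F) = ∫ p, F p.1 p.2 ∂η := by
  refine eq_of_forall_dist_le fun ε hε => ?_
  obtain ⟨f, hf⟩ := exists_integral_norm_sub_curry_le he hF (half_pos hε)
  have hfe := integrable_comp_continuous (μ := μ) he.measurable f.curry
  have hsub : ξ (hF.toL1 F) - ∫ p, F p.1 p.2 ∂η =
      ξ ((hF.sub hfe).toL1 _) - ∫ p, (F p.1 - f.curry (e p.1)) p.2 ∂η := by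
    simp only [ContinuousMap.sub_apply]
    rw [Integrable.toL1_sub _ _ hF hfe, map_sub, ← stateFunctional_apply he.measurable, hcont,
      integral_sub (integrable_pairing hη hF) (integrable_pairing hη hfe)]
    simp only [ContinuousMap.curry_apply, sub_sub_sub_cancel_right]
  calc dist (ξ (hF.toL1 F)) (∫ p, F p.1 p.2 ∂η)
      ≤ |ξ ((hF.sub hfe).toL1 _)| + |∫ p, (F p.1 - f.curry (e p.1)) p.2 ∂η| := by
        rw [Real.dist_eq, hsub]
        exact abs_sub _ _
    _ ≤ ε / 2 + ε / 2 := add_le_add ((abs_state_le hξ (hF.sub hfe)).trans hf)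
        ((abs_integral_pairing_le hη (hF.sub hfe)).trans hf)
    _ = ε := add_halves ε

theorem exists_measure_of_state [Nonempty X] (he : MeasurableEmbedding e)
    {ξ : WeakDual ℝ (Lp C(X, ℝ) 1 μ)} (hξ : ξ ∈ states μ X) :
    ∃ η : Measure (Ω × X), η.fst = μ ∧
      ∀ (F : Ω → C(X, ℝ)) (hF : Integrable F μ), ξ (hF.toL1 F) = ∫ p, F p.1 p.2 ∂η := by
  obtain ⟨ρ, hρ, hrep⟩ := exists_measure_integral_eq_stateFunctional he hξ
  obtain ⟨η, hη, rfl⟩ := exists_map_prodMap_eq he hρ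
  refine ⟨η, hη, fun F hF => state_eq_integral_of_forall_continuousMap he hξ hη (fun f => ?_) hF⟩
  rw [← hrep, (he.prodMap MeasurableEmbedding.id).integral_map]
  rfl

end Pairing

end Representation

/-! ### Equivariant families of probability measures -/

section Kernels

open ProbabilityTheory

variable {Ω Ω' X X' Y : Type*} [MeasurableSpace Ω] [MeasurableSpace Ω'] [MeasurableSpace X]
  [MeasurableSpace X'] [MeasurableSpace Y]

theorem isProbabilityMeasure_of_fst_eq {μ : Measure Ω} [IsProbabilityMeasure μ]
    {η : Measure (Ω × X)} (hη : η.fst = μ) : IsProbabilityMeasure η :=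
  ⟨by rw [← Measure.fst_univ, hη, measure_univ]⟩

theorem measurable_of_measurable_map {j : X → X'} (hj : MeasurableEmbedding j) {η : Y → Measure X}
    (h : Measurable fun y => (η y).map j) : Measurable η := by
  refine Measure.measurable_of_measurable_coe _ fun A hA => ?_
  have himage : ∀ y, η y A = (η y).map j (j '' A) := fun y => by
    rw [hj.map_apply, Set.preimage_image_eq _ hj.injective]
  simp only [himage]
  exact (Measure.measurable_coe (hj.measurableSet_image.2 hA)).comp h

theorem measurable_measure_of_forall_continuousMap {K : Type*} [TopologicalSpace K]
    [HasOuterApproxClosed K] [MeasurableSpace K] [BorelSpace K]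
    {m : Y → Measure K} [∀ y, IsProbabilityMeasure (m y)]
    (h : ∀ f : C(K, ℝ), Measurable fun y => ∫ z, f z ∂(m y)) : Measurable m := by
  refine measurable_measure_of_forall_boundedContinuousFunction fun f => ?_
  have hreal : ∀ y, ∫⁻ z, f z ∂(m y) = ENNReal.ofReal (∫ z, (f z : ℝ) ∂(m y)) := fun y => by
    rw [← f.toReal_lintegral_coe_eq_integral,
      ENNReal.ofReal_toReal (f.lintegral_lt_top_of_nnreal _).ne]
  simp only [hreal]
  exact (h ⟨fun z => (f z : ℝ), by fun_prop⟩).ennreal_ofReal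

theorem id_prod_map_apply (κ : Kernel Y X) [IsSFiniteKernel κ] {g : Y → X → X'}
    (hg : Measurable fun p : Y × X => g p.1 p.2) (y : Y) :
    (Kernel.id ×ₖ κ).map (fun p => g p.1 p.2) y = (κ y).map (g y) := by
  rw [Kernel.map_apply _ hg, Kernel.prod_apply, Kernel.id_apply, Measure.dirac_prod,
    Measure.map_map hg measurable_prodMk_left]
  rfl

theorem measurable_kernel_map (κ : Kernel Y X) [IsSFiniteKernel κ] {g : Y → X → X'}
    (hg : Measurable fun p : Y × X => g p.1 p.2) : Measurable fun y => (κ y).map (g y) := by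
  simp only [← id_prod_map_apply κ hg]
  exact Kernel.measurable _

theorem measurableSet_setOf_eq_of_measurable {m m' : Y → Measure X} [StandardBorelSpace X]
    [∀ y, IsProbabilityMeasure (m y)] [∀ y, IsProbabilityMeasure (m' y)] (hm : Measurable m)
    (hm' : Measurable m') : MeasurableSet {y | m y = m' y} := by
  let p (y : Y) : ProbabilityMeasure X := ⟨m y, inferInstance⟩
  let p' (y : Y) : ProbabilityMeasure X := ⟨m' y, inferInstance⟩
  have hset : {y | m y = m' y} = {y | p y = p' y} := Set.ext fun y =>
    (Subtype.ext_iff (a1 := p y) (a2 := p' y)).symm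
  rw [hset]
  have hp : Measurable p := Measurable.subtype_mk hm
  have hp' : Measurable p' := Measurable.subtype_mk hm'
  exact measurableSet_eq_fun hp hp'

theorem compProd_sectR_condKernel [StandardBorelSpace X] [Nonempty X]
    [MeasurableSpace.CountableOrCountablyGenerated Y Ω] (κ : Kernel Y (Ω × X)) [IsFiniteKernel κ]
    (y : Y) : (κ y).fst ⊗ₘ κ.condKernel.sectR y = κ y := by
  rw [show (κ y).fst = κ.fst y from (Kernel.fst_apply κ y).symm,
    ← Kernel.compProd_apply_eq_compProd_sectR, κ.disintegrate]

theorem map_compProd_comap {μ : Measure Ω} {μ' : Measure Ω'} [SFinite μ] [SFinite μ'] {f : Ω → Ω'}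
    (hf : MeasurePreserving f μ μ') (κ : Kernel Ω' X) [IsSFiniteKernel κ] :
    (μ ⊗ₘ κ.comap f hf.measurable).map (Prod.map f id) = μ' ⊗ₘ κ := by
  have hj : Measurable (Prod.map f id : Ω × X → Ω' × X) := hf.measurable.prodMap measurable_id
  refine Measure.ext_of_lintegral _ fun F hF => ?_
  calc ∫⁻ z, F z ∂(μ ⊗ₘ κ.comap f hf.measurable).map (Prod.map f id)
      = ∫⁻ s, ∫⁻ x, F (f s, x) ∂κ (f s) ∂μ := by
        rw [lintegral_map hF hj]
        exact Measure.lintegral_compProd (hF.comp hj)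
    _ = ∫⁻ s, ∫⁻ x, F (s, x) ∂κ s ∂μ' := hf.lintegral_comp hF.lintegral_kernel_prod_right'
    _ = ∫⁻ z, F z ∂(μ' ⊗ₘ κ) := (Measure.lintegral_compProd hF).symm

theorem map_compProd_map {μ : Measure Ω} [SFinite μ] {f : Ω → Ω'} (hf : Measurable f)
    {g : Ω → X → X'} (hg : Measurable fun p : Ω × X => g p.1 p.2) (κ : Kernel Ω X)
    [IsSFiniteKernel κ] :
    (μ ⊗ₘ (Kernel.id ×ₖ κ).map fun p => g p.1 p.2).map (Prod.map f id) =
      (μ ⊗ₘ κ).map fun p => (f p.1, g p.1 p.2) := by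
  have hj : Measurable (Prod.map f id : Ω × X' → Ω' × X') := hf.prodMap measurable_id
  have hgs : ∀ s, Measurable (g s) := fun s => hg.comp measurable_prodMk_left
  refine Measure.ext_of_lintegral _ fun F hF => ?_
  rw [lintegral_map hF hj, lintegral_map hF (by fun_prop),
    Measure.lintegral_compProd (f := fun z => F (Prod.map f id z)) (hF.comp hj),
    Measure.lintegral_compProd (by fun_prop)]
  refine lintegral_congr fun s => ?_
  rw [id_prod_map_apply κ hg, lintegral_map (by fun_prop) (hgs s)]
  rfl

theorem ae_eq_map_of_compProd_eq_map [MeasurableSpace.CountableOrCountablyGenerated Ω X']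
    {μ : Measure Ω} {μ' : Measure Ω'} [IsFiniteMeasure μ] [IsFiniteMeasure μ'] {f : Ω → Ω'}
    (hf : MeasurePreserving f μ μ') (hemb : MeasurableEmbedding f) {g : Ω → X → X'}
    (hg : Measurable fun p : Ω × X => g p.1 p.2) {κ : Kernel Ω X} {κ' : Kernel Ω' X'}
    [IsFiniteKernel κ] [IsFiniteKernel κ']
    (h : μ' ⊗ₘ κ' = (μ ⊗ₘ κ).map fun p => (f p.1, g p.1 p.2)) :
    ∀ᵐ s ∂μ, κ' (f s) = (κ s).map (g s) := by
  have hj : MeasurableEmbedding (Prod.map f id : Ω × X' → Ω' × X') :=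
    hemb.prodMap MeasurableEmbedding.id
  have heq : μ ⊗ₘ κ'.comap f hf.measurable = μ ⊗ₘ (Kernel.id ×ₖ κ).map fun p => g p.1 p.2 := by
    rw [← hj.comap_map (μ ⊗ₘ κ'.comap f hf.measurable), map_compProd_comap hf, h,
      ← map_compProd_map hf.measurable hg, hj.comap_map]
  exact (Kernel.ae_eq_of_compProd_eq heq).mono fun s hs => hs.trans (id_prod_map_apply κ hg s)

end Kernels

section EquivariantMeasures

open Set ProbabilityTheory

variable {Γ Ω B X : Type u} [Group Γ] [MeasurableSpace Ω] [MulAction Γ Ω] {μ : Measure Ω}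
  [MeasurableSpace B] [MulAction Γ B] {ν : Measure B}
  [TopologicalSpace X] [CompactSpace X] [T2Space X] [SecondCountableTopology X]
  [MeasurableSpace X] [BorelSpace X] {σ : Γ → Ω → (X ≃ₜ X)} {e : Ω → (ℕ → Bool)}

/-- The action of `Γ` on `Ω × X` defined by a cocycle with values in `Homeo(X)`. -/
def pointAction (hσ : IsVirtualDendroMorphism μ σ) : FiberAction Γ Ω μ X where
  act γ s x := σ γ s x
  measurable_act γ := measurable_homeo_apply ((hσ.measurable γ).comp measurable_fst) measurable_snd
  act_one := hσ.ae_one.mono fun s hs x => by rw [hs]; rfl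
  act_mul γ₁ γ₂ := (hσ.cocycle γ₁ γ₂).mono fun s hs x => by rw [hs]; rfl

theorem measure_ext_of_forall_continuousMap (he : MeasurableEmbedding e)
    {η η' : Measure (Ω × X)} [IsFiniteMeasure η] [IsFiniteMeasure η']
    (h : ∀ f : C((ℕ → Bool) × X, ℝ), ∫ p, f (e p.1, p.2) ∂η = ∫ p, f (e p.1, p.2) ∂η') :
    η = η' := by
  have hj : MeasurableEmbedding (Prod.map e id : Ω × X → (ℕ → Bool) × X) :=
    he.prodMap MeasurableEmbedding.id
  have hmap : η.map (Prod.map e id) = η'.map (Prod.map e id) := by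
    refine ext_of_forall_integral_eq_of_IsFiniteMeasure fun k => ?_
    rw [hj.integral_map, hj.integral_map]
    exact h k.toContinuousMap
  rw [← hj.comap_map η, hmap, hj.comap_map]

theorem measurable_of_forall_measurable_integral (he : MeasurableEmbedding e)
    {η : B → Measure (Ω × X)} [∀ b, IsProbabilityMeasure (η b)]
    (h : ∀ f : C((ℕ → Bool) × X, ℝ), Measurable fun b => ∫ p, f (e p.1, p.2) ∂(η b)) :
    Measurable η := by
  have hj : MeasurableEmbedding (Prod.map e id : Ω × X → (ℕ → Bool) × X) :=
    he.prodMap MeasurableEmbedding.id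
  have hprob : ∀ b, IsProbabilityMeasure ((η b).map (Prod.map e id)) := fun b =>
    Measure.isProbabilityMeasure_map hj.measurable.aemeasurable
  let := metrizableSpaceMetric X
  refine measurable_of_measurable_map hj (measurable_measure_of_forall_continuousMap fun f => ?_)
  simp only [hj.integral_map]
  exact h f

variable [MeasurableConstSMul Γ Ω] [IsProbabilityMeasure μ]

theorem map_skew_inv_eq_of_integral_transport (hσ : IsVirtualDendroMorphism μ σ)
    (he : MeasurableEmbedding e) (γ : Γ) {η η' : Measure (Ω × X)} [IsFiniteMeasure η]
    [IsFiniteMeasure η'] (h : ∀ F : Ω → C(X, ℝ), Integrable F μ →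
      ∫ p, transport σ γ F p.1 p.2 ∂η' = ∫ p, F p.1 p.2 ∂η) :
    η'.map ((pointAction hσ).skew γ⁻¹) = η := by
  have hfinite := Measure.isFiniteMeasure_map η' ((pointAction hσ).skew γ⁻¹)
  refine measure_ext_of_forall_continuousMap he fun f => ?_
  have hf : Measurable fun p : Ω × X => f (e p.1, p.2) :=
    f.continuous.measurable.comp (he.measurable.prodMap measurable_id)
  rw [integral_map ((pointAction hσ).measurable_skew γ⁻¹).aemeasurable hf.aestronglyMeasurable]
  exact h _ (integrable_comp_continuous he.measurable f.curry)

variable [SMulInvariantMeasure Γ Ω μ] [StandardBorelSpace Ω] [Nonempty X]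

theorem exists_equivariant_joinings
    (hν : ∀ γ : Γ, Measure.QuasiMeasurePreserving (fun b : B => γ • b) ν ν)
    (hamen : IsZimmerAmenable Γ ν) (hσ : IsVirtualDendroMorphism μ σ) :
    ∃ η : B → Measure (Ω × X), Measurable η ∧ (∀ b, (η b).fst = μ) ∧
      ∀ γ : Γ, ∀ᵐ b ∂ν, η (γ • b) = (η b).map ((pointAction hσ).skew γ) := by
  obtain ⟨ξ, hξ, hstates, hξσ⟩ := exists_equivariant_states hν hamen hσ
  obtain ⟨e, hemeas, heinj⟩ := MeasurableSpace.measurable_injection_nat_bool_of_countablySeparated Ω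
  have he : MeasurableEmbedding e := hemeas.measurableEmbedding heinj
  choose η hη hrep using fun b => exists_measure_of_state he (hstates b)
  have hprob : ∀ b, IsProbabilityMeasure (η b) := fun b =>
    isProbabilityMeasure_of_fst_eq (hη b)
  let r (b : B) : (pointAction hσ).MargProb := FiberAction.MargProb.mk _ (η b) (hη b)
  refine ⟨η, measurable_of_forall_measurable_integral he fun f => ?_, hη, fun γ => ?_⟩
  · have hf := hξ ((integrable_comp_continuous he.measurable f.curry).toL1 _)
    simp only [hrep] at hf
    exact hf
  · filter_upwards [hξσ γ] with b hb
    have hinv : (η (γ • b)).map ((pointAction hσ).skew γ⁻¹) = η b :=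
      map_skew_inv_eq_of_integral_transport hσ he γ fun F hF => by
        have hF' := memLp_one_iff_integrable.2 hF
        rw [← hrep b F hF, ← hb, ← hrep _ _ (memLp_one_iff_integrable.1 (memLp_transport hσ γ hF'))]
        exact congrArg (ξ (γ • b)) (transportLp_toLp hσ γ hF').symm
    have hsmul : γ⁻¹ • r (γ • b) = r b := FiberAction.MargProb.ext hinv
    exact congrArg FiberAction.MargProb.toMeasure (inv_smul_eq_iff.1 hsmul)

theorem exists_equivariant_measures [SFinite ν]
    (hB : IsBoundary Γ ν) (hσ : IsVirtualDendroMorphism μ σ) :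
    ∃ m : B × Ω → Measure X, Measurable m ∧ (∀ w, IsProbabilityMeasure (m w)) ∧
      ∀ γ : Γ, ∀ᵐ w ∂(ν.prod μ), m (γ • w) = (m w).map (σ γ w.2) := by
  have := polishSpace_of_compact X
  obtain ⟨η, hη, hfst, hησ⟩ := exists_equivariant_joinings hB.quasiInvariant hB.amenable hσ
  have hprob : ∀ b, IsProbabilityMeasure (η b) := fun b =>
    isProbabilityMeasure_of_fst_eq (hfst b)
  let κ : Kernel B (Ω × X) := ⟨η, hη⟩
  have hκ : IsMarkovKernel κ := ⟨hprob⟩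
  let c : Kernel (B × Ω) X := κ.condKernel
  have hdis : ∀ b, μ ⊗ₘ c.sectR b = η b := fun b =>
    (congrArg (· ⊗ₘ c.sectR b) (hfst b)).symm.trans (compProd_sectR_condKernel κ b)
  refine ⟨c, c.measurable, inferInstance, fun γ => ?_⟩
  have hσγ := (pointAction hσ).measurable_act γ
  have hmap : Measurable fun w : B × Ω => (c w).map (σ γ w.2) :=
    measurable_kernel_map c (hσγ.comp (measurable_snd.prodMap measurable_id))
  have hmapprob : ∀ w : B × Ω, IsProbabilityMeasure ((c w).map (σ γ w.2)) := fun w =>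
    Measure.isProbabilityMeasure_map (σ γ w.2).continuous.measurable.aemeasurable
  refine (Measure.ae_prod_mem_iff_ae_ae_mem (measurableSet_setOf_eq_of_measurable
    (m := fun w => c (γ • w))
    (c.measurable.comp (quasiMeasurePreserving_smul_prod (μ := μ) hB.quasiInvariant γ).measurable)
    hmap)).2 ?_
  filter_upwards [hησ γ] with b hb
  refine ae_eq_map_of_compProd_eq_map (κ := c.sectR b) (κ' := c.sectR (γ • b))
    (measurePreserving_smul γ μ) (measurableEmbedding_const_smul γ) hσγ ?_
  rw [hdis, hdis, hb]
  rfl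

end EquivariantMeasures

end Dendro

theorem mainTheorem4_general {Γ Ω B X : Type u} [Group Γ]
    [MeasurableSpace Ω] [StandardBorelSpace Ω] [MulAction Γ Ω] [MeasurableConstSMul Γ Ω]
    (μ : Measure Ω) [IsProbabilityMeasure μ] [ErgodicSMul Γ Ω μ]
    [MeasurableSpace B] [MulAction Γ B]
    (ν : Measure B) [SigmaFinite ν] [NeZero ν] (hB : Dendro.IsBoundary Γ ν)
    [TopologicalSpace X] [MeasurableSpace X] [BorelSpace X] (hX : Dendro.IsDendrite X)
    (σ : Γ → Ω → (X ≃ₜ X)) (hσ : Dendro.IsVirtualDendroMorphism μ σ)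
    (hne : ¬ Dendro.IsElementary μ σ) :
    (∃ M : Ω → NonemptyCompacts X, Dendro.IsMinimalFamily μ σ M ∧
      ∀ N : Ω → NonemptyCompacts X, Dendro.IsMinimalFamily μ σ N → N =ᵐ[μ] M) ∧
    ∃ φ : B × Ω → X, Dendro.IsFurstenbergMap ν μ σ φ ∧
      (∀ M : Ω → NonemptyCompacts X, Dendro.IsMinimalFamily μ σ M →
        ∀ᵐ s ∂μ, ∀ b : B, φ (b, s) ∈ Dendro.ends (M s : Set X)) ∧
      ∀ ψ : B × Ω → X, Dendro.IsFurstenbergMap ν μ σ ψ → ψ =ᵐ[ν.prod μ] φ := by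
  have := hX.connected
  have := hX.compact
  have := hX.metrizable
  have : SecondCountableTopology X := by
    let := metrizableSpaceMetric X
    infer_instance
  have := hX.pointSeparated
  obtain ⟨M, hM⟩ := Dendro.exists_isMinimalFamily hne
  obtain ⟨m, hm, hprob, heq⟩ := Dendro.exists_equivariant_measures hB hσ
  obtain ⟨φ₀, hφ₀⟩ := Dendro.exists_furstenbergMap_of_measure hB hσ hne hM hm hprob heq
  obtain ⟨φ, hφ, hends⟩ := hφ₀.exists_forall_mem_ends hB hσ hne hM
  refine ⟨⟨M, hM, fun N hN => hM.ae_eq hN⟩, φ, hφ, fun N hN => ?_,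
    fun ψ hψ => hφ.ae_eq hB hσ hne hM hψ⟩
  filter_upwards [hends, hM.ae_eq hN] with s hs hNM
  rw [hNM]
  exact hs

theorem mainTheorem4 {Γ Ω B X : Type u} [Group Γ] [Countable Γ]
    [MeasurableSpace Ω] [StandardBorelSpace Ω] [MulAction Γ Ω] [MeasurableConstSMul Γ Ω]
    (μ : Measure Ω) [IsProbabilityMeasure μ] [ErgodicSMul Γ Ω μ]
    [MeasurableSpace B] [StandardBorelSpace B] [MulAction Γ B] [MeasurableConstSMul Γ B]
    (ν : Measure B) [SigmaFinite ν] [NeZero ν] (hB : Dendro.IsBoundary Γ ν)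
    [TopologicalSpace X] [MeasurableSpace X] [BorelSpace X] (hX : Dendro.IsDendrite X)
    (σ : Γ → Ω → (X ≃ₜ X)) (hσ : Dendro.IsVirtualDendroMorphism μ σ)
    (hne : ¬ Dendro.IsElementary μ σ) :
    (∃ M : Ω → NonemptyCompacts X, Dendro.IsMinimalFamily μ σ M ∧
      ∀ N : Ω → NonemptyCompacts X, Dendro.IsMinimalFamily μ σ N → N =ᵐ[μ] M) ∧
    ∃ φ : B × Ω → X, Dendro.IsFurstenbergMap ν μ σ φ ∧
      (∀ M : Ω → NonemptyCompacts X, Dendro.IsMinimalFamily μ σ M →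
        ∀ᵐ s ∂μ, ∀ b : B, φ (b, s) ∈ Dendro.ends (M s : Set X)) ∧
      ∀ ψ : B × Ω → X, Dendro.IsFurstenbergMap ν μ σ ψ → ψ =ᵐ[ν.prod μ] φ :=
  mainTheorem4_general μ ν hB hX σ hσ hne
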